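/- Let $\mu,\nu,c_0,c_1>0$, $w_d\ge 0$ and $\lambda>0$ be fixed constants, $I=(0,1)$, let $(\cdot,\cdot)$ be the $L^2(I)$ inner product, write $k_i=c_i+1+w_d$ ($i=0,1$), and let $$K_0(s)=\frac1\nu\Big(k_0s+\frac{2}{9c_0}s^3\Big),\qquad K_1(s)=-\frac1\nu\Big(k_1s+\frac{2}{9c_1}s^3\Big)$$ be the nonlinear Neumann feedback laws at $x=0$ and $x=1$. Let $\alpha$ satisfy $$0\le\alpha\le\frac12\min\Big\{\frac{\nu}{\mu+1},\ \frac{\nu}{2\mu+\nu},\ \frac{\nu k_0}{\nu+k_0\mu},\ \frac{\nu k_1}{\nu+k_1\mu}\Big\}.$$ For a subspace $V\subseteq H^1(I)$ consider the problem of finding $u:[0,\infty)\to V$ with $u_t\in L^2(0,T;H^1(I))$ for all $T>0$ such that, for almost all $t>0$ and all $\chi\in V$, $$(u_t,\chi)+\mu(u_{xt},\chi_x)+\nu(u_x,\chi_x)+(1+w_d)(u_x,\chi)+(uu_x,\chi) +\frac{\mu}{\nu}\sum_{i=0}^1\Big(k_i+\frac{2}{3c_i}u(i,t)^2\Big)u_t(i,t)\chi(i)+\sum_{i=0}^1\Big(k_iu(i,t)+\frac{2}{9c_i}u(i,t)^3\Big)\chi(i)=0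 .$$ Let $w_0\in H^2(I)$ and let $w$ be the weak solution of the closed-loop BBM--Burgers problem $w_t-\mu w_{xxt}-\nu w_{xx}+(1+w_d)w_x+ww_x=0$, $w_x(i,t)=K_i(w(i,t))$, that is, the solution of the problem above with $V=H^1(I)$ and $w(0)=w_0$. For a partition $0=x_0<\dots<x_N=1$ with $h=\max_j(x_j-x_{j-1})$ let $V_h\subset H^1(I)$ be the space of continuous functions on $[0,1]$ that are affine on each $[x_{j-1},x_j]$, let $w_{0h}\in V_h$ be the projection of $w_0$ given by $((w_0-w_{0h})_x,\chi_x)+\lambda(w_0-w_{0h},\chi)=0$ for all $\chi\in V_h$ (the $H^1$ projection if $\lambda=1$), and let $w_h$ be the semidiscrete solution, that is, the solution of the problem above with $V=V_h$ and $w_h(0)=w_{0h}$. (a) If in addition $w_0\in W^{2,\infty}(I)$, then there is a constant $C>0$, independent of the partition (in particular of $h$) and of $t$, such that $$\|(w-w_h)(t)\|_{L^\infty(I)}\le C\,\frac{h^2}{\sqrt\mu}\,e^{-\alpha t}\qquad\text{for all } t\ge0 .$$ (b) There is a constant $C>0$, independent of the partition (in particular of $h$) and of $t$, such that for $i=0,1$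 $$|K_i(w(i,t))-K_i(w_h(i,t))|\le C\,\frac{h^2}{\sqrt\mu}\,e^{-\alpha t}\qquad\text{for all } t\ge0$$ (superconvergence of the feedback controls). The constants depend on $w_0$ and on the fixed parameters $\mu,\nu,w_d,c_0,c_1,\lambda,\alpha$. -/

import Mathlib

open MeasureTheory Set Filter
open scoped ENNReal ContDiff

noncomputable section

namespace BBMB

/-! ### Sobolev spaces on the unit interval -/

/-- Lebesgue measure on the open interval `I = (0,1)`. -/
abbrev volI : Measure ℝ := volume.restrict (Ioo (0 : ℝ) 1)

/-- The Lebesgue space `L²(0,1)`. -/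
abbrev L2 : Type := Lp ℝ 2 volI

/-- `g` is the weak derivative of `f` on `(0,1)`, tested against `C_c^∞(0,1)`. -/
def HasWeakDeriv (f g : L2) : Prop :=
  ∀ φ : ℝ → ℝ, ContDiff ℝ ∞ φ → HasCompactSupport φ → tsupport φ ⊆ Ioo (0 : ℝ) 1 →
    ∫ x, f x * deriv φ x ∂volI = -∫ x, g x * φ x ∂volI

theorem memLp_test {φ : ℝ → ℝ} (hc : Continuous φ) (hs : HasCompactSupport φ) :
    MemLp φ 2 volI :=
  (hc.memLp_of_hasCompactSupport hs).restrict _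

theorem integrable_mul_test (f : L2) {φ : ℝ → ℝ} (hc : Continuous φ) (hs : HasCompactSupport φ) :
    Integrable (fun x => f x * φ x) volI :=
  (Lp.memLp f).integrable_mul (memLp_test hc hs)

theorem integral_mul_test (f : L2) {φ : ℝ → ℝ} (hc : Continuous φ) (hs : HasCompactSupport φ) :
    ∫ x, f x * φ x ∂volI = inner ℝ ((memLp_test hc hs).toLp φ) f := by
  rw [L2.inner_def]
  refine integral_congr_ae ?_
  filter_upwards [(memLp_test hc hs).coeFn_toLp] with x hx
  rw [hx]
  rfl

theorem continuous_integral_mul_test {φ : ℝ → ℝ} (hc : Continuous φ) (hs : HasCompactSupport φ) :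
    Continuous fun f : L2 => ∫ x, f x * φ x ∂volI := by
  simp_rw [integral_mul_test _ hc hs]
  fun_prop

theorem continuous_deriv_test {φ : ℝ → ℝ} (h : ContDiff ℝ ∞ φ) : Continuous (deriv φ) :=
  h.continuous_deriv (by simp)

theorem hasWeakDeriv_iff_inner (f g : L2) : HasWeakDeriv f g ↔
    ∀ (φ : ℝ → ℝ) (h : ContDiff ℝ ∞ φ) (hs : HasCompactSupport φ), tsupport φ ⊆ Ioo (0 : ℝ) 1 →
      inner ℝ ((memLp_test (continuous_deriv_test h) hs.deriv).toLp (deriv φ)) f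
        = -inner ℝ ((memLp_test h.continuous hs).toLp φ) g := by
  refine forall_congr' fun φ => forall_congr' fun h => forall_congr' fun hs =>
    imp_congr_right fun _ => ?_
  rw [integral_mul_test f (continuous_deriv_test h) hs.deriv, integral_mul_test g h.continuous hs]

/-- `H¹(0,1)` as the set of pairs `(u, u')` in `L² × L²` with `u'` the weak derivative of `u`; the
inherited norm is `‖u‖₁ = (‖u‖² + ‖u'‖²)^{1/2}`. -/
def sobolev1 : Submodule ℝ (WithLp 2 (L2 × L2)) where
  carrier := {p | HasWeakDeriv p.fst p.snd}
  zero_mem' := by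
    simp only [mem_ofPred_eq, hasWeakDeriv_iff_inner]
    intro φ h hs _
    simp
  add_mem' := by
    simp only [mem_ofPred_eq, hasWeakDeriv_iff_inner]
    intro p q hp hq φ h hs hI
    simp only [WithLp.add_fst, WithLp.add_snd, inner_add_right, hp φ h hs hI, hq φ h hs hI]
    ring
  smul_mem' := by
    simp only [mem_ofPred_eq, hasWeakDeriv_iff_inner]
    intro c p hp φ h hs hI
    simp only [WithLp.smul_fst, WithLp.smul_snd, inner_smul_right, hp φ h hs hI]
    ring

/-- The Hilbert space `H¹(0,1)`. -/
abbrev H1 : Type := sobolev1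

theorem isClosed_sobolev1 : IsClosed (sobolev1 : Set (WithLp 2 (L2 × L2))) := by
  have : (sobolev1 : Set (WithLp 2 (L2 × L2))) =
      {p | HasWeakDeriv p.fst p.snd} := rfl
  rw [this]
  simp only [HasWeakDeriv, ofPred_forall]
  refine isClosed_iInter fun φ => isClosed_iInter fun h => isClosed_iInter fun hs =>
    isClosed_iInter fun _ => isClosed_eq ?_ ?_
  · exact (continuous_integral_mul_test (continuous_deriv_test h) hs.deriv).comp (by fun_prop)
  · exact ((continuous_integral_mul_test h.continuous hs).comp (by fun_prop)).neg

instance : CompleteSpace H1 := isClosed_sobolev1.completeSpace_coe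

/-- The `L²` class of `u ∈ H¹`. -/
def H1.fn (u : H1) : L2 := u.1.fst

/-- The weak derivative `u_x ∈ L²` of `u ∈ H¹`. -/
def H1.dx (u : H1) : L2 := u.1.snd

/-- The point value `u(x)`, `x ∈ [0,1]`, of the continuous representative of `u ∈ H¹(0,1)`, obtained
by averaging `u(x) = u(y) + ∫_y^x u_x` over `y ∈ (0,1)`. -/
def H1.val (u : H1) (x : ℝ) : ℝ :=
  ∫ y in (0 : ℝ)..1, (u.fn y + ∫ s in y..x, u.dx s)

theorem intervalIntegrable_volI {f : ℝ → ℝ} (hf : Integrable f volI) {a b : ℝ}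
    (ha : a ∈ Icc (0 : ℝ) 1) (hb : b ∈ Icc (0 : ℝ) 1) : IntervalIntegrable f volume a b := by
  have h : IntegrableOn f (Icc (0 : ℝ) 1) volume :=
    (integrableOn_Icc_iff_integrableOn_Ioo (a := (0 : ℝ)) (b := 1)).2 hf
  rw [intervalIntegrable_iff]
  refine h.mono_set (uIoc_subset_uIcc.trans ?_)
  exact (convex_Icc (0 : ℝ) 1).ordConnected.uIcc_subset ha hb

theorem integrable_L2 (f : L2) : Integrable f volI := (Lp.memLp f).integrable (by norm_num)

theorem intervalIntegral_volI (f : ℝ → ℝ) : ∫ x in (0 : ℝ)..1, f x = ∫ x, f x ∂volI := by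
  rw [intervalIntegral.integral_of_le zero_le_one, integral_Ioc_eq_integral_Ioo]

/-- Every smooth function with compact support in `(0,1)` and mean zero is the derivative of such a
function. -/
theorem exists_primitive {ψ : ℝ → ℝ} (h : ContDiff ℝ ∞ ψ) (hs : HasCompactSupport ψ)
    (hI : tsupport ψ ⊆ Ioo (0 : ℝ) 1) (h0 : ∫ x in (0 : ℝ)..1, ψ x = 0) :
    ∃ φ : ℝ → ℝ, ContDiff ℝ ∞ φ ∧ HasCompactSupport φ ∧ tsupport φ ⊆ Ioo (0 : ℝ) 1 ∧
      deriv φ = ψ := by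
  have hd : ∀ x, HasDerivAt (fun x => ∫ s in (0 : ℝ)..x, ψ s) (ψ x) x := fun x =>
    intervalIntegral.integral_hasDerivAt_right (h.continuous.intervalIntegrable _ _)
      (h.continuous.stronglyMeasurableAtFilter _ _) h.continuous.continuousAt
  have hderiv : deriv (fun x => ∫ s in (0 : ℝ)..x, ψ s) = ψ := funext fun x => (hd x).deriv
  obtain ⟨a, b, ha, hb, hab⟩ : ∃ a b : ℝ, 0 < a ∧ b < 1 ∧ tsupport ψ ⊆ Icc a b := by
    rcases (tsupport ψ).eq_empty_or_nonempty with he | hne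
    · exact ⟨1 / 2, 1 / 2, by norm_num, by norm_num, by simp [he]⟩
    · have hcpt : IsCompact (tsupport ψ) := hs
      exact ⟨sInf (tsupport ψ), sSup (tsupport ψ), (hI (hcpt.sInf_mem hne)).1,
        (hI (hcpt.sSup_mem hne)).2,
        fun x hx => ⟨csInf_le hcpt.bddBelow hx, le_csSup hcpt.bddAbove hx⟩⟩
  have hz : ∀ x, x ∉ Icc a b → ψ x = 0 := fun x hx => image_eq_zero_of_notMem_tsupport
    fun h' => hx (hab h')
  have hsub : Function.support (fun x => ∫ s in (0 : ℝ)..x, ψ s) ⊆ Icc a b := by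
    intro x hx
    by_contra hn
    refine hx ?_
    rw [mem_Icc, not_and_or, not_le, not_le] at hn
    rcases hn with hn | hn
    · refine intervalIntegral.integral_zero_ae (Eventually.of_forall fun y hy => hz y fun hy' => ?_)
      have := hy.2
      have : max 0 x < a := max_lt ha hn
      linarith [hy'.1]
    · have h1 : ∫ s in x..1, ψ s = 0 := by
        refine intervalIntegral.integral_zero_ae
          (Eventually.of_forall fun y hy => hz y fun hy' => ?_)
        have := hy.1
        have : b < min x 1 := lt_min hn hb
        linarith [hy'.2]
      have := intervalIntegral.integral_add_adjacent_intervals (μ := volume)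
        (h.continuous.intervalIntegrable 0 x) (h.continuous.intervalIntegrable x 1)
      rw [h1, h0, add_zero] at this
      exact this
  have hts : tsupport (fun x => ∫ s in (0 : ℝ)..x, ψ s) ⊆ Icc a b :=
    closure_minimal hsub isClosed_Icc
  refine ⟨fun x => ∫ s in (0 : ℝ)..x, ψ s, ?_, ?_, ?_, hderiv⟩
  · rw [contDiff_infty_iff_deriv, hderiv]
    exact ⟨fun x => (hd x).differentiableAt, h⟩
  · exact HasCompactSupport.of_support_subset_isCompact isCompact_Icc hsub
  · exact hts.trans (Icc_subset_Ioo ha hb)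

/-- A function whose weak derivative vanishes is a.e. constant. -/
theorem ae_const_of_weak_deriv_zero {F : ℝ → ℝ} (hF : Integrable F volI)
    (h : ∀ φ : ℝ → ℝ, ContDiff ℝ ∞ φ → HasCompactSupport φ → tsupport φ ⊆ Ioo (0 : ℝ) 1 →
      ∫ x, F x * deriv φ x ∂volI = 0) : ∃ c : ℝ, ∀ᵐ x ∂volI, F x = c := by
  let ρ : ContDiffBump (1 / 2 : ℝ) := ⟨1 / 8, 1 / 4, by norm_num, by norm_num⟩
  have hρI : tsupport (ρ.normed volume) ⊆ Ioo (0 : ℝ) 1 := by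
    rw [ρ.tsupport_normed_eq, Real.closedBall_eq_Icc]
    exact Icc_subset_Ioo (by norm_num [ρ]) (by norm_num [ρ])
  have hρc : ContDiff ℝ ∞ (ρ.normed volume) := ρ.contDiff_normed
  have hρs : HasCompactSupport (ρ.normed volume) := ρ.hasCompactSupport_normed
  have key : ∀ {ψ : ℝ → ℝ}, tsupport ψ ⊆ Ioo (0 : ℝ) 1 →
      ∫ x in (0 : ℝ)..1, ψ x = ∫ x, ψ x := by
    intro ψ hψ
    rw [intervalIntegral_volI]
    exact setIntegral_eq_integral_of_forall_compl_eq_zero fun x hx =>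
      image_eq_zero_of_notMem_tsupport fun h' => hx (hψ h')
  have hmul : ∀ {ψ : ℝ → ℝ}, Continuous ψ → HasCompactSupport ψ →
      Integrable (fun x => F x * ψ x) volI := by
    intro ψ hc hs
    obtain ⟨M, hM⟩ := hs.exists_bound_of_continuous hc
    exact hF.mul_bdd hc.aestronglyMeasurable (Eventually.of_forall hM)
  set c : ℝ := ∫ x, F x * ρ.normed volume x ∂volI with hc
  refine ⟨c, ?_⟩
  have hloc : LocallyIntegrableOn (fun x => F x - c) (Ioo (0 : ℝ) 1) volume := by
    refine IntegrableOn.locallyIntegrableOn ?_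
    exact hF.sub (integrable_const c)
  have := isOpen_Ioo.ae_eq_zero_of_integral_contDiff_smul_eq_zero (μ := volume) hloc ?_
  · rw [ae_restrict_iff' measurableSet_Ioo]
    filter_upwards [this] with x hx hxI
    linarith [hx hxI]
  · intro ψ hψ hψs hψI
    set m : ℝ := ∫ x, ψ x with hm
    have hcd : ContDiff ℝ ∞ (fun x => ψ x - m * ρ.normed volume x) :=
      hψ.sub (contDiff_const.mul hρc)
    have hts : tsupport (fun x => ψ x - m * ρ.normed volume x) ⊆
        tsupport ψ ∪ tsupport (ρ.normed volume) := by
      refine closure_minimal (fun x hx => ?_) ((isClosed_tsupport _).union (isClosed_tsupport _))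
      by_contra hn
      rw [mem_union, not_or] at hn
      refine hx ?_
      simp only [image_eq_zero_of_notMem_tsupport hn.1, image_eq_zero_of_notMem_tsupport hn.2]
      ring
    have hcs : HasCompactSupport (fun x => ψ x - m * ρ.normed volume x) :=
      IsCompact.of_isClosed_subset (hψs.isCompact.union hρs.isCompact) (isClosed_tsupport _) hts
    have hsI : tsupport (fun x => ψ x - m * ρ.normed volume x) ⊆ Ioo (0 : ℝ) 1 :=
      hts.trans (union_subset hψI hρI)
    obtain ⟨φ, h1, h2, h3, h4⟩ := exists_primitive hcd hcs hsI (by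
      rw [key hsI, integral_sub (hψ.continuous.integrable_of_hasCompactSupport hψs)
        ((hρc.continuous.integrable_of_hasCompactSupport hρs).const_mul m),
        integral_const_mul, ρ.integral_normed]
      ring)
    have h5 := h φ h1 h2 h3
    rw [h4] at h5
    have h6 : ∫ x, F x * (ψ x - m * ρ.normed volume x) ∂volI
        = ∫ x, F x * ψ x ∂volI - m * c := by
      rw [hc, ← integral_const_mul, ← integral_sub (hmul hψ.continuous hψs)
        ((hmul hρc.continuous hρs).const_mul m)]
      exact integral_congr_ae (Eventually.of_forall fun x => by ring)
    have h7 : ∫ x, ψ x • (F x - c) = ∫ x, ψ x * (F x - c) ∂volI := by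
      symm
      exact setIntegral_eq_integral_of_forall_compl_eq_zero fun x hx => by
        rw [image_eq_zero_of_notMem_tsupport fun h' => hx (hψI h'), zero_mul]
    have h8 : ∫ x, ψ x * (F x - c) ∂volI = ∫ x, F x * ψ x ∂volI - c * ∫ x, ψ x ∂volI := by
      rw [← integral_const_mul, ← integral_sub (hmul hψ.continuous hψs)
        (((hψ.continuous.integrable_of_hasCompactSupport hψs).restrict).const_mul c)]
      exact integral_congr_ae (Eventually.of_forall fun x => by ring)
    rw [h7, h8, ← intervalIntegral_volI ψ, key hψI, ← hm]
    linarith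

/-- Membership of `u` in `H¹(0,1)` gives the absolutely continuous representative. -/
theorem H1.exists_rep (u : H1) : ∃ c : ℝ, ∀ᵐ x ∂volI, u.fn x = c + ∫ s in (0 : ℝ)..x, u.dx s := by
  have hg : IntervalIntegrable u.dx volume 0 1 :=
    intervalIntegrable_volI (integrable_L2 _) (by simp) (by simp)
  have hac := hg.absolutelyContinuousOnInterval_intervalIntegral (c := 0) (by simp)
  have hcont : ContinuousOn (fun x => ∫ s in (0 : ℝ)..x, u.dx s) (Icc 0 1) := by
    simpa using hac.continuousOn
  have hint : Integrable (fun x => ∫ s in (0 : ℝ)..x, u.dx s) volI :=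
    (hcont.integrableOn_Icc).mono_set Ioo_subset_Icc_self
  obtain ⟨c, hc⟩ := ae_const_of_weak_deriv_zero ((integrable_L2 u.fn).sub hint) (by
    intro φ h hs hI
    obtain ⟨M, hM⟩ := hs.deriv.exists_bound_of_continuous (continuous_deriv_test h)
    have h0 : φ 0 = 0 := image_eq_zero_of_notMem_tsupport fun h' => by simpa using hI h'
    have h1 : φ 1 = 0 := image_eq_zero_of_notMem_tsupport fun h' => by simpa using hI h'
    have hφac : AbsolutelyContinuousOnInterval φ 0 1 :=
      ((h.of_le (by norm_num)).contDiffOn).absolutelyContinuousOnInterval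
    have ibp := hac.integral_mul_deriv_eq_deriv_mul hφac
    have hcongr : ∫ x in (0 : ℝ)..1, deriv (fun x => ∫ s in (0 : ℝ)..x, u.dx s) x * φ x
        = ∫ x in (0 : ℝ)..1, u.dx x * φ x := by
      refine intervalIntegral.integral_congr_ae ?_
      filter_upwards [hg.ae_hasDerivAt_integral] with x hx hxI
      rw [(hx (uIoc_subset_uIcc hxI) 0 (by simp)).deriv]
    rw [hcongr, h0, h1, intervalIntegral_volI, intervalIntegral_volI] at ibp
    have hw := u.2 φ h hs hI
    change ∫ x, u.fn x * deriv φ x ∂volI = -∫ x, u.dx x * φ x ∂volI at hw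
    simp only [Pi.sub_apply, sub_mul]
    rw [integral_sub (integrable_mul_test _ (continuous_deriv_test h) hs.deriv)
      (hint.mul_bdd (continuous_deriv_test h).aestronglyMeasurable (Eventually.of_forall hM)),
      hw, ibp, intervalIntegral_volI]
    ring)
  refine ⟨c, ?_⟩
  filter_upwards [hc] with x hx
  simp only [Pi.sub_apply] at hx
  linarith

theorem H1.val_eq_of_rep (u : H1) {c : ℝ}
    (hc : ∀ᵐ x ∂volI, u.fn x = c + ∫ s in (0 : ℝ)..x, u.dx s) {x : ℝ} (hx : x ∈ Icc (0 : ℝ) 1) :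
    u.val x = c + ∫ s in (0 : ℝ)..x, u.dx s := by
  have h1 : ∀ᵐ y ∂volI, u.fn y + ∫ s in y..x, u.dx s = c + ∫ s in (0 : ℝ)..x, u.dx s := by
    filter_upwards [hc, ae_restrict_mem measurableSet_Ioo] with y hy hyI
    rw [hy, add_assoc, intervalIntegral.integral_add_adjacent_intervals
      (intervalIntegrable_volI (integrable_L2 _) (by simp) (Ioo_subset_Icc_self hyI))
      (intervalIntegrable_volI (integrable_L2 _) (Ioo_subset_Icc_self hyI) hx)]
  rw [H1.val, intervalIntegral_volI, integral_congr_ae h1]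
  simp

/-- The fundamental theorem of calculus for the point values. -/
theorem H1.val_eq (u : H1) {x : ℝ} (hx : x ∈ Icc (0 : ℝ) 1) :
    u.val x = u.val 0 + ∫ s in (0 : ℝ)..x, u.dx s := by
  obtain ⟨c, hc⟩ := u.exists_rep
  rw [u.val_eq_of_rep hc hx, u.val_eq_of_rep hc (x := 0) (by simp)]
  simp

/-- The point values form a representative of the `L²` class. -/
theorem H1.fn_ae_eq_val (u : H1) : ∀ᵐ x ∂volI, u.fn x = u.val x := by
  obtain ⟨c, hc⟩ := u.exists_rep
  filter_upwards [hc, ae_restrict_mem measurableSet_Ioo] with x hx hxI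
  rw [hx, u.val_eq_of_rep hc (Ioo_subset_Icc_self hxI)]

/-- This representative is continuous on `[0,1]`. -/
theorem H1.continuousOn_val (u : H1) : ContinuousOn u.val (Icc 0 1) := by
  have hg : IntervalIntegrable u.dx volume 0 1 :=
    intervalIntegrable_volI (integrable_L2 _) (by simp) (by simp)
  have hac := hg.absolutelyContinuousOnInterval_intervalIntegral (c := 0) (by simp)
  have hcont : ContinuousOn (fun x => ∫ s in (0 : ℝ)..x, u.dx s) (Icc 0 1) := by
    simpa using hac.continuousOn
  exact (hcont.const_add (u.val 0)).congr fun x hx => u.val_eq hx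

theorem H1.val_add (u v : H1) {x : ℝ} (hx : x ∈ Icc (0 : ℝ) 1) :
    (u + v).val x = u.val x + v.val x := by
  obtain ⟨c, hc⟩ := u.exists_rep
  obtain ⟨c', hc'⟩ := v.exists_rep
  have hdx : ∀ x ∈ Icc (0 : ℝ) 1, ∫ s in (0 : ℝ)..x, (u + v).dx s
      = (∫ s in (0 : ℝ)..x, u.dx s) + ∫ s in (0 : ℝ)..x, v.dx s := by
    intro x hx
    rw [← intervalIntegral.integral_add
      (intervalIntegrable_volI (integrable_L2 _) (by simp) hx)
      (intervalIntegrable_volI (integrable_L2 _) (by simp) hx)]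
    refine intervalIntegral.integral_congr_ae ?_
    have h1 := (ae_restrict_iff' measurableSet_Ioo).1 (Lp.coeFn_add u.dx v.dx)
    filter_upwards [h1, (measure_eq_zero_iff_ae_notMem.1 (measure_singleton (μ := volume) (1 : ℝ)))]
      with s hs hs1 hsI
    rw [uIoc_of_le hx.1] at hsI
    exact hs ⟨hsI.1, lt_of_le_of_ne (hsI.2.trans hx.2) hs1⟩
  have hrep : ∀ᵐ x ∂volI, (u + v).fn x = (c + c') + ∫ s in (0 : ℝ)..x, (u + v).dx s := by
    filter_upwards [hc, hc', ae_restrict_mem measurableSet_Ioo, Lp.coeFn_add u.fn v.fn]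
      with x h1 h2 hxI h3
    rw [hdx x (Ioo_subset_Icc_self hxI)]
    change (u.fn + v.fn : L2) x = _
    rw [h3, Pi.add_apply, h1, h2]
    ring
  rw [H1.val_eq_of_rep _ hrep hx, hdx x hx, u.val_eq_of_rep hc hx, v.val_eq_of_rep hc' hx]
  ring

theorem H1.val_smul (r : ℝ) (u : H1) {x : ℝ} (hx : x ∈ Icc (0 : ℝ) 1) :
    (r • u).val x = r * u.val x := by
  obtain ⟨c, hc⟩ := u.exists_rep
  have hdx : ∀ x ∈ Icc (0 : ℝ) 1, ∫ s in (0 : ℝ)..x, (r • u).dx s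
      = r * ∫ s in (0 : ℝ)..x, u.dx s := by
    intro x hx
    rw [← intervalIntegral.integral_const_mul]
    refine intervalIntegral.integral_congr_ae ?_
    have h1 := (ae_restrict_iff' measurableSet_Ioo).1 (Lp.coeFn_smul r u.dx)
    filter_upwards [h1, (measure_eq_zero_iff_ae_notMem.1 (measure_singleton (μ := volume) (1 : ℝ)))]
      with s hs hs1 hsI
    rw [uIoc_of_le hx.1] at hsI
    exact hs ⟨hsI.1, lt_of_le_of_ne (hsI.2.trans hx.2) hs1⟩
  have hrep : ∀ᵐ x ∂volI, (r • u).fn x = (r * c) + ∫ s in (0 : ℝ)..x, (r • u).dx s := by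
    filter_upwards [hc, ae_restrict_mem measurableSet_Ioo, Lp.coeFn_smul r u.fn]
      with x h1 hxI h3
    rw [hdx x (Ioo_subset_Icc_self hxI)]
    change (r • u.fn : L2) x = _
    rw [h3, Pi.smul_apply, h1, smul_eq_mul]
    ring
  rw [H1.val_eq_of_rep _ hrep hx, hdx x hx, u.val_eq_of_rep hc hx]
  ring

/-- `u ∈ H²(0,1)`: the weak derivative of `u ∈ H¹` again belongs to `H¹`. -/
def IsH2 (u : H1) : Prop := ∃ v : H1, v.fn = u.dx

/-- `u ∈ W^{2,∞}(0,1)`: `u`, `u_x` and `u_xx` are essentially bounded. -/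
def IsW2Inf (u : H1) : Prop :=
  ∃ v : H1, v.fn = u.dx ∧ MemLp u.fn ∞ volI ∧ MemLp u.dx ∞ volI ∧ MemLp v.dx ∞ volI

/-! ### The continuous problem -/

/-- The constants of the problem: dispersion `μ`, dissipation `ν`, steady state `w_d` and the
feedback gains `c₀`, `c₁`. -/
structure Params where
  μ : ℝ
  ν : ℝ
  wd : ℝ
  c₀ : ℝ
  c₁ : ℝ

/-- The Neumann feedback law at `x = 0`. -/
def Params.K₀ (p : Params) (s : ℝ) : ℝ :=
  1 / p.ν * ((p.c₀ + 1 + p.wd) * s + 2 / (9 * p.c₀) * s ^ 3)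

/-- The Neumann feedback law at `x = 1`. -/
def Params.K₁ (p : Params) (s : ℝ) : ℝ :=
  -(1 / p.ν * ((p.c₁ + 1 + p.wd) * s + 2 / (9 * p.c₁) * s ^ 3))

/-- The largest admissible decay rate. -/
def Params.rateMax (p : Params) : ℝ :=
  1 / 2 * min (p.ν / (p.μ + 1)) (min (p.ν / (2 * p.μ + p.ν))
    (min (p.ν * (1 + p.c₀ + p.wd) / (p.ν + (1 + p.c₀ + p.wd) * p.μ))
      (p.ν * (1 + p.c₁ + p.wd) / (p.ν + (1 + p.c₁ + p.wd) * p.μ))))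

/-- The left-hand side of the weak formulation, for the state `u = w(t)`, its time derivative
`d = w_t(t)` and the test function `χ`:
`(d,χ) + μ(d_x,χ_x) + ν(u_x,χ_x) + (1+w_d)(u_x,χ) + (u u_x,χ)` plus the boundary terms. -/
def Params.weakForm (p : Params) (u d χ : H1) : ℝ :=
  inner ℝ d.fn χ.fn + p.μ * inner ℝ d.dx χ.dx + p.ν * inner ℝ u.dx χ.dx
    + (1 + p.wd) * inner ℝ u.dx χ.fn + (∫ x, u.fn x * u.dx x * χ.fn x ∂volI)
    + p.μ / p.ν *
      (((p.c₀ + 1 + p.wd) * d.val 0 + 2 / (3 * p.c₀) * u.val 0 ^ 2 * d.val 0) * χ.val 0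
        + ((p.c₁ + 1 + p.wd) * d.val 1 + 2 / (3 * p.c₁) * u.val 1 ^ 2 * d.val 1) * χ.val 1)
    + (((p.c₀ + 1 + p.wd) * u.val 0 + 2 / (9 * p.c₀) * u.val 0 ^ 3) * χ.val 0
        + ((p.c₁ + 1 + p.wd) * u.val 1 + 2 / (9 * p.c₁) * u.val 1 ^ 3) * χ.val 1)

/-- `w : [0,∞) → V` solves the weak formulation with test functions in the subspace `V` of `H¹`
and initial value `u₀`: `w` has a weak time derivative `d = w_t ∈ L²(0,T;H¹)` for every `T`, and the
equation holds for almost all `t > 0` and all `χ ∈ V`. -/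
def Params.Solves (p : Params) (V : Submodule ℝ H1) (u₀ : H1) (w : ℝ → H1) : Prop :=
  (∀ t, 0 ≤ t → w t ∈ V) ∧
  ∃ d : ℝ → H1,
    (∀ T, 0 < T → MemLp d 2 (volume.restrict (Ioo 0 T))) ∧
    (∀ t, 0 ≤ t → w t = u₀ + ∫ s in (0 : ℝ)..t, d s) ∧
    ∀ᵐ t ∂(volume.restrict (Ioi (0 : ℝ))), ∀ χ ∈ V, p.weakForm (w t) (d t) χ = 0

/-- Weak solutions of the closed-loop problem: test functions in all of `H¹`. -/
def Params.IsWeakSolution (p : Params) (w₀ : H1) (w : ℝ → H1) : Prop := p.Solves ⊤ w₀ w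

/-! ### The finite element problem -/

/-- A partition `0 = x_0 < x_1 < ⋯ < x_N = 1` of `[0,1]`. -/
structure Mesh where
  N : ℕ
  node : Fin (N + 1) → ℝ
  node_zero : node 0 = 0
  node_last : node (Fin.last N) = 1
  strictMono : StrictMono node

/-- The mesh parameter `h = max_j (x_j - x_{j-1})`. -/
def Mesh.h (P : Mesh) : ℝ := ⨆ j : Fin P.N, (P.node j.succ - P.node j.castSucc)

theorem Mesh.node_mem (P : Mesh) (j : Fin (P.N + 1)) : P.node j ∈ Icc (0 : ℝ) 1 := by
  refine ⟨?_, ?_⟩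
  · rw [← P.node_zero]
    exact P.strictMono.monotone (Fin.zero_le j)
  · rw [← P.node_last]
    exact P.strictMono.monotone (Fin.le_last j)

theorem Mesh.mem_of_mem_elem (P : Mesh) {j : Fin P.N} {x : ℝ}
    (hx : x ∈ Icc (P.node j.castSucc) (P.node j.succ)) : x ∈ Icc (0 : ℝ) 1 :=
  ⟨(P.node_mem _).1.trans hx.1, hx.2.trans (P.node_mem _).2⟩

/-- The space `V_h` of continuous functions on `[0,1]` that are affine on each mesh interval. -/
def Mesh.V (P : Mesh) : Submodule ℝ H1 where
  carrier := {u | ∀ j : Fin P.N, ∃ a b : ℝ,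
    ∀ x ∈ Icc (P.node j.castSucc) (P.node j.succ), u.val x = a + b * x}
  zero_mem' := fun j => ⟨0, 0, fun x hx => by
    have := H1.val_smul 0 0 (P.mem_of_mem_elem hx)
    simpa using this⟩
  add_mem' := by
    intro u v hu hv j
    obtain ⟨a, b, h⟩ := hu j
    obtain ⟨a', b', h'⟩ := hv j
    refine ⟨a + a', b + b', fun x hx => ?_⟩
    rw [H1.val_add _ _ (P.mem_of_mem_elem hx), h x hx, h' x hx]
    ring
  smul_mem' := by
    intro r u hu j
    obtain ⟨a, b, h⟩ := hu j
    refine ⟨r * a, r * b, fun x hx => ?_⟩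
    rw [H1.val_smul _ _ (P.mem_of_mem_elem hx), h x hx]
    ring

/-- `v` is the projection of `u` onto `V_h` for the form `(u_x,χ_x) + lam (u,χ)`; for `lam = 1` this
is the `H¹`-orthogonal projection. -/
def Mesh.IsProjection (P : Mesh) (lam : ℝ) (u v : H1) : Prop :=
  v ∈ P.V ∧ ∀ χ ∈ P.V, inner ℝ (u.dx - v.dx) χ.dx + lam * inner ℝ (u.fn - v.fn) χ.fn = 0

/-- Solutions of the semidiscrete Galerkin problem in `V_h`. -/
def Params.IsSemidiscrete (p : Params) (P : Mesh) (w₀h : H1) (wh : ℝ → H1) : Prop :=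
  p.Solves P.V w₀h wh

end BBMB

end

/-! The semidiscrete solution is compared with the nodal interpolant `I w` of the exact one. In one
dimension the error `η = w - I w` has two good properties. It vanishes at the nodes, so no boundary
term of the weak form sees it. Moreover `η_x` is orthogonal to `χ_x` for all `χ ∈ V_h`
(`Mesh.inner_dx_eq_zero`), since `χ_x` is a step function and pairs with `η_x` to differences of
nodal values. Once the derivative in the convection terms is moved onto `θ = w_h - I w`
(`conv_sub_conv`), only the `L²` norms of `η` and `η_t` remain as consistency errors. These are
`O(h²)`, and an energy estimate gives `θ = O(h²)` in the full `H¹` norm. At the end points `w - w_h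
= -θ`, which is (b) for `H²` data. For (a) the maximum norm of `η` is added, and this needs
`W^{2,∞}` data.

The bounds on `η` need no regularity theory for `w`. Testing with functions that vanish at the end
points shows that `(μ w_t + ν w)_xx` equals the lower order terms (`Params.IsC1Sol.inner_dx_eq`), so
`μ w_t + ν w` is interpolated with error `O(h² e^{-βt})`. Interpolation commutes with the time
derivative, hence `η` solves `μ η_t + ν η = O(h² e^{-βt})` with initial value determined by `w₀`,
and `norm_le_of_ode` finishes. This works in `L²` and, with a Lipschitz bound on `w`, pointwise.

Exponential decay comes from an energy with quartic boundary terms. The feedback laws are such that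
the cubic boundary terms produced by convection are absorbed into squares
(`Params.energy_le_dissipation`). A Poincaré inequality with a small boundary constant yields decay
at a rate `β` strictly above `α` (`Params.exists_rate`). The coefficients in the inequality for the
energy of `θ` are then `O(e^{-βt})` and stay integrable after weighting with `e^{αt}`, so Gronwall's
lemma (`le_of_energy_inequality`) loses nothing as `t → ∞`.

All this differentiates energies pointwise in time. That is legitimate because the form multiplying
`w_t` is coercive, so `w_t` is a continuous function of `w` and solutions are `C¹` with values in
`H¹`. -/

noncomputable section

namespace BBMB

/-! ### Basic facts on `H¹(0,1)` -/

theorem H1.norm_sq (u : H1) : ‖u‖ ^ 2 = ‖u.fn‖ ^ 2 + ‖u.dx‖ ^ 2 := by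
  change ‖u.1‖ ^ 2 = _
  rw [WithLp.prod_norm_sq_eq_of_L2]
  rfl

theorem H1.norm_fn_le (u : H1) : ‖u.fn‖ ≤ ‖u‖ :=
  abs_le_of_sq_le_sq' (by rw [u.norm_sq]; nlinarith [sq_nonneg ‖u.dx‖]) (norm_nonneg _) |>.2

theorem H1.norm_dx_le (u : H1) : ‖u.dx‖ ≤ ‖u‖ :=
  abs_le_of_sq_le_sq' (by rw [u.norm_sq]; nlinarith [sq_nonneg ‖u.fn‖]) (norm_nonneg _) |>.2

/-- `u ↦ u` as a bounded operator `H¹ → L²`. -/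
def fnL : H1 →L[ℝ] L2 := (WithLp.fstL 2 ℝ L2 L2).comp sobolev1.subtypeL

/-- `u ↦ u_x` as a bounded operator `H¹ → L²`. -/
def dxL : H1 →L[ℝ] L2 := (WithLp.sndL 2 ℝ L2 L2).comp sobolev1.subtypeL

@[simp] theorem fnL_apply (u : H1) : fnL u = u.fn := rfl
@[simp] theorem dxL_apply (u : H1) : dxL u = u.dx := rfl

theorem H1.fn_sub (u v : H1) : (u - v).fn = u.fn - v.fn := rfl
theorem H1.dx_add (u v : H1) : (u + v).dx = u.dx + v.dx := rfl
theorem H1.dx_sub (u v : H1) : (u - v).dx = u.dx - v.dx := rfl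
theorem H1.dx_smul (r : ℝ) (u : H1) : (r • u).dx = r • u.dx := rfl

theorem L2.norm_sq_eq (f : L2) : ‖f‖ ^ 2 = ∫ x, f x ^ 2 ∂volI := by
  rw [← real_inner_self_eq_norm_sq, L2.inner_def]
  refine integral_congr_ae (Eventually.of_forall fun x => ?_)
  simp [sq]

theorem L2.inner_eq (f g : L2) : inner ℝ f g = ∫ x, f x * g x ∂volI := by
  rw [L2.inner_def]
  refine integral_congr_ae (Eventually.of_forall fun x => ?_)
  simp [mul_comm]

theorem L2.integrable_sq (f : L2) : Integrable (fun x => f x ^ 2) volI :=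
  (Lp.memLp f).integrable_sq

theorem L2.integrable_mul (f g : L2) : Integrable (fun x => f x * g x) volI :=
  (Lp.memLp f).integrable_mul (Lp.memLp g)

/-- Integrating `((b - a) * f x - m) ^ 2 ≥ 0`, with `m` the integral of `f`, gives `b - a` times the
claim. -/
theorem sq_intervalIntegral_le {f : ℝ → ℝ} {a b : ℝ} (hab : a ≤ b)
    (hf : IntervalIntegrable f volume a b)
    (hf2 : IntervalIntegrable (fun x => f x ^ 2) volume a b) :
    (∫ x in a..b, f x) ^ 2 ≤ (b - a) * ∫ x in a..b, f x ^ 2 := by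
  rcases hab.eq_or_lt with rfl | hlt
  · simp
  set m := ∫ x in a..b, f x with hm
  have h0 : 0 ≤ ∫ x in a..b, ((b - a) * f x - m) ^ 2 :=
    intervalIntegral.integral_nonneg hab fun x _ => sq_nonneg _
  have h1 : ∫ x in a..b, ((b - a) * f x - m) ^ 2
      = (b - a) ^ 2 * (∫ x in a..b, f x ^ 2) - 2 * (b - a) * m * m + (b - a) * m ^ 2 := by
    have : ∀ x, ((b - a) * f x - m) ^ 2
        = (b - a) ^ 2 * f x ^ 2 - 2 * (b - a) * m * f x + m ^ 2 := fun x => by ring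
    simp_rw [this]
    rw [intervalIntegral.integral_add ((hf2.const_mul _).sub (hf.const_mul _)) (by simp),
      intervalIntegral.integral_sub (hf2.const_mul _) (hf.const_mul _),
      intervalIntegral.integral_const_mul, intervalIntegral.integral_const_mul, ← hm]
    simp
  rw [h1] at h0
  have h2 : 0 ≤ (b - a) * ((b - a) * (∫ x in a..b, f x ^ 2) - m ^ 2) := by nlinarith
  have := nonneg_of_mul_nonneg_right h2 (sub_pos.2 hlt)
  linarith

theorem L2.integral_sq_le (f : L2) {a b : ℝ} (ha : 0 ≤ a) (hab : a ≤ b) (hb : b ≤ 1) :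
    ∫ x in a..b, f x ^ 2 ≤ ‖f‖ ^ 2 := by
  rw [L2.norm_sq_eq, ← intervalIntegral_volI]
  exact intervalIntegral.integral_mono_interval ha hab hb
    (Eventually.of_forall fun x => sq_nonneg _)
    (intervalIntegrable_volI (L2.integrable_sq f) (by simp) (by simp))

theorem L2.sq_integral_le (f : L2) {a b : ℝ} (ha : 0 ≤ a) (hab : a ≤ b) (hb : b ≤ 1) :
    (∫ x in a..b, f x) ^ 2 ≤ (b - a) * ‖f‖ ^ 2 :=
  (sq_intervalIntegral_le hab
    (intervalIntegrable_volI (integrable_L2 f) ⟨ha, hab.trans hb⟩ ⟨ha.trans hab, hb⟩)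
    (intervalIntegrable_volI (L2.integrable_sq f) ⟨ha, hab.trans hb⟩ ⟨ha.trans hab, hb⟩)).trans
    (mul_le_mul_of_nonneg_left (L2.integral_sq_le f ha hab hb) (sub_nonneg.2 hab))

theorem H1.val_sub' (u : H1) {x y : ℝ} (hx : x ∈ Icc (0 : ℝ) 1) (hy : y ∈ Icc (0 : ℝ) 1) :
    u.val y - u.val x = ∫ s in x..y, u.dx s := by
  rw [u.val_eq hx, u.val_eq hy, add_sub_add_left_eq_sub, intervalIntegral.integral_interval_sub_left]
  · exact intervalIntegrable_volI (integrable_L2 _) (by simp) hy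
  · exact intervalIntegrable_volI (integrable_L2 _) (by simp) hx

theorem H1.sq_val_sub_le (u : H1) {x y : ℝ} (hx : 0 ≤ x) (hxy : x ≤ y) (hy : y ≤ 1) :
    (u.val y - u.val x) ^ 2 ≤ (y - x) * ‖u.dx‖ ^ 2 := by
  rw [u.val_sub' ⟨hx, hxy.trans hy⟩ ⟨hx.trans hxy, hy⟩]
  exact L2.sq_integral_le _ hx hxy hy

theorem memLp_val (u : H1) (q : ℝ≥0∞) : MemLp u.val q volI := by
  obtain ⟨C, hC⟩ := isCompact_Icc.exists_bound_of_continuousOn u.continuousOn_val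
  refine MemLp.of_bound ((u.continuousOn_val.mono Ioo_subset_Icc_self).aestronglyMeasurable
    measurableSet_Ioo) C ?_
  filter_upwards [ae_restrict_mem measurableSet_Ioo] with x hx
  exact hC x (Ioo_subset_Icc_self hx)

theorem H1.norm_fn_sq (u : H1) : ‖u.fn‖ ^ 2 = ∫ x, u.val x ^ 2 ∂volI := by
  rw [L2.norm_sq_eq]
  refine integral_congr_ae ?_
  filter_upwards [u.fn_ae_eq_val] with x hx
  rw [hx]

theorem integral_volI_le {f : ℝ → ℝ} {C : ℝ} (hf : Integrable f volI)
    (h : ∀ x ∈ Ioo (0 : ℝ) 1, f x ≤ C) : ∫ x, f x ∂volI ≤ C := by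
  have : ∫ x, f x ∂volI ≤ ∫ _, C ∂volI := by
    refine integral_mono_ae hf (integrable_const C) ?_
    filter_upwards [ae_restrict_mem measurableSet_Ioo] with x hx
    exact h x hx
  simpa using this

theorem le_integral_volI {f : ℝ → ℝ} {C : ℝ} (hf : Integrable f volI)
    (h : ∀ x ∈ Ioo (0 : ℝ) 1, C ≤ f x) : C ≤ ∫ x, f x ∂volI := by
  have : ∫ _, C ∂volI ≤ ∫ x, f x ∂volI := by
    refine integral_mono_ae (integrable_const C) hf ?_
    filter_upwards [ae_restrict_mem measurableSet_Ioo] with x hx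
    exact h x hx
  simpa using this

theorem H1.norm_fn_le_of_val (u : H1) {C : ℝ} (hC : 0 ≤ C)
    (h : ∀ x ∈ Icc (0 : ℝ) 1, |u.val x| ≤ C) : ‖u.fn‖ ≤ C := by
  refine abs_le_of_sq_le_sq' ?_ hC |>.2
  rw [u.norm_fn_sq]
  refine integral_volI_le (memLp_val u 2).integrable_sq fun x hx => ?_
  exact sq_le_sq' (by linarith [abs_le.1 (h x (Ioo_subset_Icc_self hx))])
    (abs_le.1 (h x (Ioo_subset_Icc_self hx))).2

/-- The embedding `H¹(0,1) ⊂ C[0,1]`. -/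
theorem H1.abs_val_le (u : H1) {x : ℝ} (hx : x ∈ Icc (0 : ℝ) 1) : |u.val x| ≤ 2 * ‖u‖ := by
  refine abs_le_of_sq_le_sq (a := u.val x) ?_ (by positivity)
  -- A bound for every `y`, so that averaging over `y` turns `u.val y ^ 2` into the squared `L²`
  -- norm.
  have h1 : ∀ y ∈ Ioo (0 : ℝ) 1, u.val x ^ 2 / 2 - ‖u.dx‖ ^ 2 ≤ u.val y ^ 2 := by
    intro y hy
    have h2 : (u.val x - u.val y) ^ 2 ≤ ‖u.dx‖ ^ 2 := by
      rcases le_total x y with h | h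
      · have := u.sq_val_sub_le hx.1 h hy.2.le
        nlinarith [sq_nonneg ‖u.dx‖, hx.1, hy.2]
      · have := u.sq_val_sub_le hy.1.le h hx.2
        nlinarith [sq_nonneg ‖u.dx‖, hx.2, hy.1]
    nlinarith [sq_nonneg (u.val x - 2 * u.val y)]
  have h3 := le_integral_volI (memLp_val u 2).integrable_sq h1
  rw [← u.norm_fn_sq] at h3
  nlinarith [u.norm_sq, sq_nonneg ‖u.fn‖, sq_nonneg ‖u.dx‖]

theorem H1.val_sub (u v : H1) {x : ℝ} (hx : x ∈ Icc (0 : ℝ) 1) :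
    (u - v).val x = u.val x - v.val x := by
  have := H1.val_add (u - v) v hx
  rw [sub_add_cancel] at this
  linarith

/-- Evaluation at a point of `[0,1]`. -/
def valL (x : ℝ) (hx : x ∈ Icc (0 : ℝ) 1) : H1 →L[ℝ] ℝ :=
  LinearMap.mkContinuous
    { toFun := fun u => u.val x
      map_add' := fun u v => H1.val_add u v hx
      map_smul' := fun r u => H1.val_smul r u hx } 2 fun u => u.abs_val_le hx

@[simp] theorem valL_apply {x : ℝ} (hx : x ∈ Icc (0 : ℝ) 1) (u : H1) : valL x hx u = u.val x := rfl

/-- A quantitative Poincaré inequality with boundary values. -/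
theorem H1.poincare (u : H1) :
    ‖u.fn‖ ^ 2 ≤ 3 / 4 * (u.val 0 ^ 2 + u.val 1 ^ 2) + 3 / 2 * ‖u.dx‖ ^ 2 := by
  rw [u.norm_fn_sq]
  refine integral_volI_le (memLp_val u 2).integrable_sq fun x hx => ?_
  have h0 := u.sq_val_sub_le le_rfl hx.1.le hx.2.le
  have h1 := u.sq_val_sub_le hx.1.le hx.2.le le_rfl
  -- Young's inequality with weights 3/2 and 3 from each end point; in the average the factors `x`
  -- and `1 - x` add up to one. Compared with weights 2 and 2, the boundary constant drops from 1 to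
  -- 3/4, which `Params.exists_rate` exploits.
  nlinarith [sq_nonneg (u.val x - 3 * u.val 0 + u.val 0 + u.val 0 / 2),
    sq_nonneg (u.val x - 3 / 2 * u.val 0), sq_nonneg (u.val x - 3 / 2 * u.val 1)]

/-! ### Absolute continuity and the integrated product rule -/

theorem H1.absolutelyContinuous_val (u : H1) : AbsolutelyContinuousOnInterval u.val 0 1 := by
  have hg : IntervalIntegrable u.dx volume 0 1 :=
    intervalIntegrable_volI (integrable_L2 _) (by simp) (by simp)
  have hac := hg.absolutelyContinuousOnInterval_intervalIntegral (c := 0) (by simp)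
  have hcst : AbsolutelyContinuousOnInterval (fun _ : ℝ => u.val 0) 0 1 :=
    (LipschitzWith.const (u.val 0)).lipschitzOnWith.absolutelyContinuousOnInterval
  have h := hcst.add hac
  rw [absolutelyContinuousOnInterval_iff] at h ⊢
  intro ε hε
  obtain ⟨δ, hδ, H⟩ := h ε hε
  refine ⟨δ, hδ, fun E hE hE' => ?_⟩
  refine lt_of_le_of_lt (le_of_eq ?_) (H E hE hE')
  refine Finset.sum_congr rfl fun i hi => ?_
  have := hE.1 i hi
  rw [uIcc_of_le zero_le_one] at this
  rw [u.val_eq this.1, u.val_eq this.2]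
  rfl

theorem H1.ae_hasDerivAt (u : H1) : ∀ᵐ x ∂volI, HasDerivAt u.val (u.dx x) x := by
  have hg : IntervalIntegrable u.dx volume 0 1 :=
    intervalIntegrable_volI (integrable_L2 _) (by simp) (by simp)
  rw [ae_restrict_iff' measurableSet_Ioo]
  filter_upwards [hg.ae_hasDerivAt_integral] with x hx hxI
  have hx' : x ∈ uIcc (0 : ℝ) 1 := by
    rw [uIcc_of_le zero_le_one]; exact Ioo_subset_Icc_self hxI
  refine ((hx hx' 0 (by simp)).const_add (u.val 0)).congr_of_eventuallyEq ?_
  filter_upwards [isOpen_Ioo.mem_nhds hxI] with y hy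
  exact u.val_eq (Ioo_subset_Icc_self hy)

theorem H1.integrable_dx_mul (u v w : H1) :
    Integrable (fun x => u.dx x * v.val x * w.val x) volI := by
  have h : MemLp (fun x => v.val x * w.val x) 2 volI :=
    (memLp_val w 2).mul' (memLp_val v ∞)
  have := (Lp.memLp u.dx).integrable_mul h
  refine this.congr (Eventually.of_forall fun x => ?_)
  simp only [Pi.mul_apply]
  ring

/-- The product rule, integrated. -/
theorem H1.integral_triple (u v w : H1) :
    ∫ x, u.dx x * v.val x * w.val x ∂volI + ∫ x, v.dx x * u.val x * w.val x ∂volI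
      + ∫ x, w.dx x * u.val x * v.val x ∂volI
      = u.val 1 * v.val 1 * w.val 1 - u.val 0 * v.val 0 * w.val 0 := by
  have hi := (H1.integrable_dx_mul u v w).add (H1.integrable_dx_mul v u w)
  rw [← integral_add (H1.integrable_dx_mul _ _ _) (H1.integrable_dx_mul _ _ _)]
  refine (integral_add hi (H1.integrable_dx_mul w u v)).symm.trans ?_
  have hac := (u.absolutelyContinuous_val.mul v.absolutelyContinuous_val).mul
    w.absolutelyContinuous_val
  have h := hac.integral_deriv_eq_sub
  rw [intervalIntegral_volI] at h
  simp only [Pi.mul_apply] at h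
  rw [← h]
  refine integral_congr_ae ?_
  filter_upwards [u.ae_hasDerivAt, v.ae_hasDerivAt, w.ae_hasDerivAt] with x h1 h2 h3
  rw [((h1.mul h2).mul h3).deriv]
  simp only [Pi.mul_apply, Pi.add_apply]
  ring

/-! ### Primitives, ramps and integration by parts -/

theorem H1.hasWeakDeriv_of_integral (c : ℝ) (f g : L2)
    (h : ∀ᵐ x ∂volI, f x = c + ∫ s in (0 : ℝ)..x, g s) : HasWeakDeriv f g := by
  intro φ hφ hs hI
  have hg : IntervalIntegrable g volume 0 1 :=
    intervalIntegrable_volI (integrable_L2 _) (by simp) (by simp)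
  have hac := (LipschitzWith.const (β := ℝ) c).lipschitzOnWith.absolutelyContinuousOnInterval.add
    (hg.absolutelyContinuousOnInterval_intervalIntegral (c := 0) (by simp))
  have h0 : φ 0 = 0 := image_eq_zero_of_notMem_tsupport fun h' => by simpa using hI h'
  have h1 : φ 1 = 0 := image_eq_zero_of_notMem_tsupport fun h' => by simpa using hI h'
  have hφac : AbsolutelyContinuousOnInterval φ 0 1 :=
    ((hφ.of_le (by norm_num)).contDiffOn).absolutelyContinuousOnInterval
  have ibp := hac.integral_mul_deriv_eq_deriv_mul hφac
  rw [h0, h1, intervalIntegral_volI, intervalIntegral_volI] at ibp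
  simp only [mul_zero, sub_zero, zero_sub] at ibp
  calc ∫ x, f x * deriv φ x ∂volI = _ := integral_congr_ae (by
        filter_upwards [h] with x hx
        rw [hx]; rfl)
    _ = _ := ibp
    _ = _ := by
      congr 1
      refine integral_congr_ae ?_
      have := hg.ae_hasDerivAt_integral
      filter_upwards [ae_restrict_of_ae this, ae_restrict_mem measurableSet_Ioo] with x hx hxI
      have hx' : x ∈ uIcc (0 : ℝ) 1 := by
        rw [uIcc_of_le zero_le_one]; exact Ioo_subset_Icc_self hxI
      congr 1
      exact ((hx hx' 0 (by simp)).const_add c).deriv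

theorem memLp_primitive (c : ℝ) (g : L2) : MemLp (fun x => c + ∫ s in (0 : ℝ)..x, g s) 2 volI := by
  have hg : IntervalIntegrable g volume 0 1 :=
    intervalIntegrable_volI (integrable_L2 _) (by simp) (by simp)
  have hac := hg.absolutelyContinuousOnInterval_intervalIntegral (c := 0) (by simp)
  have hcont : ContinuousOn (fun x => c + ∫ s in (0 : ℝ)..x, g s) (Icc 0 1) := by
    have := hac.continuousOn
    rw [uIcc_of_le zero_le_one] at this
    exact this.const_add c
  obtain ⟨C, hC⟩ := isCompact_Icc.exists_bound_of_continuousOn hcont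
  refine MemLp.of_bound ((hcont.mono Ioo_subset_Icc_self).aestronglyMeasurable
    measurableSet_Ioo) C ?_
  filter_upwards [ae_restrict_mem measurableSet_Ioo] with x hx
  exact hC x (Ioo_subset_Icc_self hx)

/-- The element `c + ∫₀ˣ g` of `H¹`. -/
def H1.prim (c : ℝ) (g : L2) : H1 :=
  ⟨WithLp.toLp 2 ((memLp_primitive c g).toLp _, g),
    H1.hasWeakDeriv_of_integral c _ _ (memLp_primitive c g).coeFn_toLp⟩

@[simp] theorem H1.prim_dx (c : ℝ) (g : L2) : (H1.prim c g).dx = g := rfl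

theorem H1.prim_val (c : ℝ) (g : L2) {x : ℝ} (hx : x ∈ Icc (0 : ℝ) 1) :
    (H1.prim c g).val x = c + ∫ s in (0 : ℝ)..x, g s :=
  (H1.prim c g).val_eq_of_rep (memLp_primitive c g).coeFn_toLp hx

/-- The representative determines the `L²` class, and its a.e. classical derivative determines the
weak one. -/
theorem H1.ext_val {u v : H1} (h : ∀ x ∈ Icc (0 : ℝ) 1, u.val x = v.val x) : u = v := by
  have hfn : u.fn = v.fn := by
    refine Lp.ext ?_
    filter_upwards [u.fn_ae_eq_val, v.fn_ae_eq_val, ae_restrict_mem measurableSet_Ioo]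
      with x h1 h2 h3
    rw [h1, h2, h x (Ioo_subset_Icc_self h3)]
  have hdx : u.dx = v.dx := by
    refine Lp.ext ?_
    filter_upwards [u.ae_hasDerivAt, v.ae_hasDerivAt, ae_restrict_mem measurableSet_Ioo]
      with x h1 h2 h3
    refine h1.unique (h2.congr_of_eventuallyEq ?_)
    filter_upwards [isOpen_Ioo.mem_nhds h3] with y hy
    exact h y (Ioo_subset_Icc_self hy)
  exact Subtype.ext (WithLp.ofLp_injective 2 (Prod.ext hfn hdx))

/-- The indicator of `(a,b]` in `L²(0,1)`. -/
def indIoc (a b : ℝ) : L2 := indicatorConstLp 2 (measurableSet_Ioc (a := a) (b := b))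
  (measure_ne_top volI _) 1

theorem inner_indIoc (f : L2) {a b : ℝ} (ha : 0 ≤ a) (hab : a ≤ b) (hb : b ≤ 1) :
    inner ℝ f (indIoc a b) = ∫ x in a..b, f x := by
  rw [real_inner_comm, indIoc, L2.inner_indicatorConstLp_one, intervalIntegral.integral_of_le hab,
    Measure.restrict_restrict measurableSet_Ioc]
  refine setIntegral_congr_set ?_
  have h1 : (Ioc a b ∩ Ioo 0 1 : Set ℝ) =ᵐ[volume] (Ioc a b ∩ Icc 0 1 : Set ℝ) :=
    (ae_eq_refl _).inter Ioo_ae_eq_Icc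
  have h2 : Ioc a b ⊆ Icc 0 1 := fun x hx => ⟨ha.trans hx.1.le, hx.2.trans hb⟩
  rwa [inter_eq_left.2 h2] at h1

theorem integral_indIoc {a b x : ℝ} (ha : 0 ≤ a) (hab : a ≤ b) (hx : x ∈ Icc (0 : ℝ) 1) :
    ∫ s in (0 : ℝ)..x, indIoc a b s = min x b - min x a := by
  rw [← inner_indIoc _ le_rfl hx.1 hx.2, indIoc, indIoc,
    L2.real_inner_indicatorConstLp_one_indicatorConstLp_one, Measure.real,
    Measure.restrict_apply' measurableSet_Ioo, Ioc_inter_Ioc]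
  have h1 : (Ioc (a ⊔ 0) (b ⊓ x) ∩ Ioo 0 1 : Set ℝ) =ᵐ[volume]
      (Ioc (a ⊔ 0) (b ⊓ x) ∩ Icc 0 1 : Set ℝ) := (ae_eq_refl _).inter Ioo_ae_eq_Icc
  have h2 : Ioc (a ⊔ 0) (b ⊓ x) ⊆ Icc 0 1 := fun y hy =>
    ⟨(le_max_right _ _).trans hy.1.le, (hy.2.trans (min_le_right _ _)).trans hx.2⟩
  rw [measure_congr h1, inter_eq_left.2 h2, Real.volume_Ioc, ENNReal.toReal_ofReal', max_eq_left ha]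
  rcases le_total x a with h | h
  · rw [min_eq_left h, min_eq_right (h.trans hab), min_eq_left (h.trans hab)]
    rw [max_eq_right (by linarith)]; ring
  · rw [min_eq_right h, min_comm b x, max_eq_left]
    exact sub_nonneg.2 (le_min h hab)

/-- The function `x ↦ min x b - min x a`, that is, `0` up to `a`, of slope one on `[a,b]`, and
constant from `b` on. -/
def ramp (a b : ℝ) : H1 := H1.prim 0 (indIoc a b)

theorem ramp_val {a b x : ℝ} (ha : 0 ≤ a) (hab : a ≤ b) (hx : x ∈ Icc (0 : ℝ) 1) :
    (ramp a b).val x = min x b - min x a := by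
  rw [ramp, H1.prim_val _ _ hx, integral_indIoc ha hab hx, zero_add]

/-- A ramp represents the increment over `[a,b]` in the `H¹` seminorm. This underlies the
orthogonality of the interpolation error, the Green's function in `Mesh.abs_err_le` and the
Lipschitz bound in `Params.exists_lipschitz`. -/
theorem inner_dx_ramp (u : H1) {a b : ℝ} (ha : 0 ≤ a) (hab : a ≤ b) (hb : b ≤ 1) :
    inner ℝ u.dx (ramp a b).dx = u.val b - u.val a := by
  rw [ramp, H1.prim_dx, inner_indIoc _ ha hab hb, u.val_sub' ⟨ha, hab.trans hb⟩ ⟨ha.trans hab, hb⟩]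

/-- The constant function one. -/
def H1.one : H1 := H1.prim 1 0

theorem H1.one_val {x : ℝ} (hx : x ∈ Icc (0 : ℝ) 1) : H1.one.val x = 1 := by
  rw [H1.one, H1.prim_val _ _ hx, add_eq_left]
  have := inner_indIoc 0 le_rfl hx.1 hx.2
  rw [← this, inner_zero_left]

theorem H1.inner_dx_fn (u v : H1) : inner ℝ u.dx v.fn = ∫ x, u.dx x * v.val x ∂volI := by
  rw [L2.inner_eq]
  refine integral_congr_ae ?_
  filter_upwards [v.fn_ae_eq_val] with x h
  rw [h]

/-- Integration by parts in `H¹`. -/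
theorem H1.inner_dx_fn_add (u v : H1) : inner ℝ u.dx v.fn + inner ℝ v.dx u.fn
    = u.val 1 * v.val 1 - u.val 0 * v.val 0 := by
  have h := H1.integral_triple u v H1.one
  have h1 : ∀ w z : H1, ∫ x, w.dx x * z.val x * H1.one.val x ∂volI
      = ∫ x, w.dx x * z.val x ∂volI := fun w z => by
    refine integral_congr_ae ?_
    filter_upwards [ae_restrict_mem measurableSet_Ioo] with x hx
    rw [H1.one_val (Ioo_subset_Icc_self hx), mul_one]
  have h2 : ∫ x, H1.one.dx x * u.val x * v.val x ∂volI = 0 := by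
    rw [← integral_zero (α := ℝ) (μ := volI) ℝ]
    refine integral_congr_ae ?_
    filter_upwards [Lp.coeFn_zero ℝ 2 volI] with x hx
    have : H1.one.dx = 0 := rfl
    rw [this, hx]
    simp
  rw [h1, h1, h2, H1.one_val (by simp), H1.one_val (by simp)] at h
  rw [H1.inner_dx_fn, H1.inner_dx_fn]
  linarith

/-! ### Solutions are continuously differentiable in time -/

theorem memLp_val_mul (u : H1) (g : L2) : MemLp (fun x => u.val x * g x) 2 volI :=
  (Lp.memLp g).mul' (memLp_val u ∞)

theorem norm_toLp_val_mul_le (u : H1) (g : L2) {C : ℝ}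
    (h : ∀ x ∈ Icc (0 : ℝ) 1, |u.val x| ≤ C) : ‖(memLp_val_mul u g).toLp _‖ ≤ C * ‖g‖ := by
  refine Lp.norm_le_mul_norm_of_ae_le_mul ?_
  filter_upwards [(memLp_val_mul u g).coeFn_toLp, ae_restrict_mem measurableSet_Ioo] with x hx hI
  rw [hx, norm_mul]
  exact mul_le_mul_of_nonneg_right (h x (Ioo_subset_Icc_self hI)) (norm_nonneg _)

/-- Multiplication `H¹ × L² → L²`. -/
def mulL : H1 →L[ℝ] L2 →L[ℝ] L2 :=
  LinearMap.mkContinuous₂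
    (LinearMap.mk₂ ℝ (fun u g => (memLp_val_mul u g).toLp _)
      (fun u v g => by
        refine Lp.ext ?_
        filter_upwards [(memLp_val_mul (u + v) g).coeFn_toLp, (memLp_val_mul u g).coeFn_toLp,
          (memLp_val_mul v g).coeFn_toLp, ae_restrict_mem measurableSet_Ioo,
          Lp.coeFn_add ((memLp_val_mul u g).toLp _) ((memLp_val_mul v g).toLp _)]
          with x h1 h2 h3 hI h4
        rw [h1, h4, Pi.add_apply, h2, h3, H1.val_add _ _ (Ioo_subset_Icc_self hI), add_mul])
      (fun r u g => by
        refine Lp.ext ?_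
        filter_upwards [(memLp_val_mul (r • u) g).coeFn_toLp, (memLp_val_mul u g).coeFn_toLp,
          ae_restrict_mem measurableSet_Ioo,
          Lp.coeFn_smul r ((memLp_val_mul u g).toLp _)] with x h1 h2 hI h4
        rw [h1, h4, Pi.smul_apply, h2, H1.val_smul _ _ (Ioo_subset_Icc_self hI), smul_eq_mul,
          mul_assoc])
      (fun u g k => by
        refine Lp.ext ?_
        filter_upwards [(memLp_val_mul u (g + k)).coeFn_toLp, (memLp_val_mul u g).coeFn_toLp,
          (memLp_val_mul u k).coeFn_toLp, Lp.coeFn_add g k,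
          Lp.coeFn_add ((memLp_val_mul u g).toLp _) ((memLp_val_mul u k).toLp _)]
          with x h1 h2 h3 hI h4
        rw [h1, h4, Pi.add_apply, h2, h3, hI, Pi.add_apply, mul_add])
      (fun r u g => by
        refine Lp.ext ?_
        filter_upwards [(memLp_val_mul u (r • g)).coeFn_toLp, (memLp_val_mul u g).coeFn_toLp,
          Lp.coeFn_smul r g,
          Lp.coeFn_smul r ((memLp_val_mul u g).toLp _)] with x h1 h2 hI h4
        rw [h1, h4, Pi.smul_apply, h2, hI, Pi.smul_apply, smul_eq_mul, smul_eq_mul]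
        ring))
    2 (fun u g => norm_toLp_val_mul_le u g fun _ hx => u.abs_val_le hx)

theorem mulL_ae (u : H1) (g : L2) : ∀ᵐ x ∂volI, mulL u g x = u.val x * g x :=
  (memLp_val_mul u g).coeFn_toLp

theorem norm_mulL_le (u : H1) (g : L2) {C : ℝ}
    (h : ∀ x ∈ Icc (0 : ℝ) 1, |u.val x| ≤ C) : ‖mulL u g‖ ≤ C * ‖g‖ :=
  norm_toLp_val_mul_le u g h

theorem inner_mulL (u v χ : H1) :
    inner ℝ (mulL u v.dx) χ.fn = ∫ x, v.dx x * u.val x * χ.val x ∂volI := by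
  rw [L2.inner_eq]
  refine integral_congr_ae ?_
  filter_upwards [mulL_ae u v.dx, χ.fn_ae_eq_val] with x h1 h2
  rw [h1, h2]
  ring

theorem integral_conv (u χ : H1) :
    ∫ x, u.fn x * u.dx x * χ.fn x ∂volI = inner ℝ (mulL u u.dx) χ.fn := by
  rw [L2.inner_eq]
  refine integral_congr_ae ?_
  filter_upwards [mulL_ae u u.dx, u.fn_ae_eq_val] with x h1 h2
  rw [h1, h2]

theorem zero_mem_I : (0 : ℝ) ∈ Icc (0 : ℝ) 1 := by simp
theorem one_mem_I : (1 : ℝ) ∈ Icc (0 : ℝ) 1 := by simp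

/-! ### Implicit evolution equations with a coercive form in a Hilbert space -/

section Abstract

variable {E F : Type*} [NormedAddCommGroup E] [InnerProductSpace ℝ E]
  [NormedAddCommGroup F] [InnerProductSpace ℝ F]

/-- The real inner product as a bounded bilinear form. -/
def innerB (F : Type*) [NormedAddCommGroup F] [InnerProductSpace ℝ F] : F →L[ℝ] F →L[ℝ] ℝ :=
  LinearMap.mkContinuous₂ (innerₗ F) 1 fun x y => by
    rw [one_mul]
    exact norm_inner_le_norm x y

@[simp] theorem innerB_apply (x y : F) : innerB F x y = inner ℝ x y := rfl

/-- The bilinear form `(f d, f χ) + μ (g d, g χ) + k a(d) a(χ) + l b(d) b(χ)`. -/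
def bilForm (f g : E →L[ℝ] F) (a b : E →L[ℝ] ℝ) (μ k l : ℝ) : E →L[ℝ] E →L[ℝ] ℝ :=
  (innerB F).bilinearComp f f
    + μ • (innerB F).bilinearComp g g
    + k • (ContinuousLinearMap.mul ℝ ℝ).bilinearComp a a
    + l • (ContinuousLinearMap.mul ℝ ℝ).bilinearComp b b

theorem bilForm_apply (f g : E →L[ℝ] F) (a b : E →L[ℝ] ℝ) (μ k l : ℝ) (d χ : E) :
    bilForm f g a b μ k l d χ
      = inner ℝ (f d) (f χ) + μ * inner ℝ (g d) (g χ) + k * (a d * a χ) + l * (b d * b χ) := by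
  simp [bilForm]

theorem continuous_bilForm (f g : E →L[ℝ] F) (a b : E →L[ℝ] ℝ) (μ : ℝ) {k l : E → ℝ}
    (hk : Continuous k) (hl : Continuous l) :
    Continuous fun u => bilForm f g a b μ (k u) (l u) := by
  unfold bilForm
  have h1 : Continuous fun u => k u • (ContinuousLinearMap.mul ℝ ℝ).bilinearComp a a :=
    hk.smul continuous_const
  have h2 : Continuous fun u => l u • (ContinuousLinearMap.mul ℝ ℝ).bilinearComp b b :=
    hl.smul continuous_const
  exact (h1.const_add _).add h2

/-- The functional `(q, f χ) + ν (s, g χ) + k a(χ) + l b(χ)`. -/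
def linForm (f g : E →L[ℝ] F) (a b : E →L[ℝ] ℝ) (q s : F) (k l : ℝ) : E →L[ℝ] ℝ :=
  (innerB F q).comp f + (innerB F s).comp g + k • a + l • b

theorem linForm_apply (f g : E →L[ℝ] F) (a b : E →L[ℝ] ℝ) (q s : F) (k l : ℝ) (χ : E) :
    linForm f g a b q s k l χ = inner ℝ q (f χ) + inner ℝ s (g χ) + k * a χ + l * b χ := by
  simp [linForm]

theorem continuous_linForm (f g : E →L[ℝ] F) (a b : E →L[ℝ] ℝ) {q s : E → F} {k l : E → ℝ}
    (hq : Continuous q) (hs : Continuous s) (hk : Continuous k) (hl : Continuous l) :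
    Continuous fun u => linForm f g a b (q u) (s u) (k u) (l u) := by
  unfold linForm
  have h1 : Continuous fun u => (innerB F (q u)).comp f :=
    ((innerB F).continuous.comp hq).clm_comp continuous_const
  have h2 : Continuous fun u => (innerB F (s u)).comp g :=
    ((innerB F).continuous.comp hs).clm_comp continuous_const
  exact ((h1.add h2).add (hk.smul continuous_const)).add (hl.smul continuous_const)

/-- An implicit evolution equation `B(w; w_t, χ) + r(w; χ) = 0`, `χ ∈ V`, with coercive `B`. -/
structure CoerciveEvolution (E : Type*) [NormedAddCommGroup E] [InnerProductSpace ℝ E] where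
  B : E → E →L[ℝ] E →L[ℝ] ℝ
  r : E → E →L[ℝ] ℝ
  m : ℝ
  pos : 0 < m
  continuous_B : Continuous B
  continuous_r : Continuous r
  coercive : ∀ u d, m * ‖d‖ ^ 2 ≤ B u d d

/-- Difference quotients stay in `V`. This is needed because the weak time derivative of a solution
is not assumed to take values in `V`. -/
theorem hasDerivAt_mem_of_isClosed {V : Submodule ℝ E} (hV : IsClosed (V : Set E))
    {w : ℝ → E} {d : E} {t : ℝ} (h : HasDerivAt w d t) (hm : ∀ᶠ s in nhds t, w s ∈ V) :
    d ∈ V := by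
  rw [hasDerivAt_iff_tendsto_slope] at h
  refine hV.mem_of_tendsto h ?_
  filter_upwards [hm.filter_mono nhdsWithin_le_nhds] with s hs
  exact V.smul_mem _ (V.sub_mem hs hm.self_of_nhds)

namespace CoerciveEvolution

variable [CompleteSpace E] (Q : CoerciveEvolution E) {V : Submodule ℝ E}

/-- Lax–Milgram for the form restricted to `V`, which is complete because it is closed. -/
theorem exists_velocity (hV : IsClosed (V : Set E)) (u : E) : ∃ d ∈ V, ∀ χ ∈ V, Q.B u d χ + Q.r u χ = 0 := by
  have : CompleteSpace V := hV.completeSpace_coe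
  let B : V →L[ℝ] V →L[ℝ] ℝ := (Q.B u).bilinearComp V.subtypeL V.subtypeL
  have hB : IsCoercive B := ⟨Q.m, Q.pos, fun v => by
    rw [mul_assoc, ← sq]
    exact Q.coercive u v⟩
  let f : V := (InnerProductSpace.toDual ℝ V).symm (-(Q.r u).comp V.subtypeL)
  refine ⟨(hB.continuousLinearEquivOfBilin.symm f : V), Subtype.coe_prop _, fun χ hχ => ?_⟩
  have h1 := hB.continuousLinearEquivOfBilin_apply (hB.continuousLinearEquivOfBilin.symm f) ⟨χ, hχ⟩
  rw [ContinuousLinearEquiv.apply_symm_apply, InnerProductSpace.toDual_symm_apply] at h1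
  have h2 : -(Q.r u χ) = Q.B u (hB.continuousLinearEquivOfBilin.symm f : V) χ := h1
  linarith

variable (hV : IsClosed (V : Set E))

/-- The right-hand side `u ↦ u_t` of the evolution equation in `V`. -/
def velocity (u : E) : E := (Q.exists_velocity hV u).choose

theorem velocity_mem (u : E) : Q.velocity hV u ∈ V :=
  (Q.exists_velocity hV u).choose_spec.1

theorem velocity_eq (u : E) {χ : E} (hχ : χ ∈ V) :
    Q.B u (Q.velocity hV u) χ + Q.r u χ = 0 :=
  (Q.exists_velocity hV u).choose_spec.2 χ hχ

/-- The difference of two solutions is an admissible test function, and coercivity makes it vanish.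
-/
theorem eq_velocity {u d : E} (hd : d ∈ V)
    (h : ∀ χ ∈ V, Q.B u d χ + Q.r u χ = 0) : d = Q.velocity hV u := by
  have hm := V.sub_mem hd (Q.velocity_mem hV u)
  have h1 := h _ hm
  have h2 := Q.velocity_eq hV u hm
  have h3 := Q.coercive u (d - Q.velocity hV u)
  rw [map_sub (Q.B u), sub_apply] at h3
  have h4 : ‖d - Q.velocity hV u‖ ^ 2 ≤ 0 := by
    by_contra hn
    have := mul_pos Q.pos (not_le.1 hn)
    linarith
  rw [← sub_eq_zero, ← norm_eq_zero]
  exact pow_eq_zero_iff (two_ne_zero) |>.1 (le_antisymm h4 (sq_nonneg _))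

/-- If `a` and `b` are the velocities at `u` and `v`, then `B(u)(a - b, a - b) = -(B(u) - B(v))(b, a
- b) - (r(u) - r(v))(a - b)`. By coercivity `‖a - b‖` is bounded by the perturbations of `B` and
`r`, with `b` fixed. -/
theorem continuous_velocity : Continuous (Q.velocity hV) := by
  rw [continuous_iff_continuousAt]
  intro v
  have hpos := Q.pos
  have key : ∀ u, ‖Q.velocity hV u - Q.velocity hV v‖ ≤
      (‖Q.B u - Q.B v‖ * ‖Q.velocity hV v‖ + ‖Q.r u - Q.r v‖) / Q.m := by
    intro u
    set a := Q.velocity hV u with ha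
    set b := Q.velocity hV v with hb
    have hm := V.sub_mem (Q.velocity_mem hV u) (Q.velocity_mem hV v)
    rw [← ha, ← hb] at hm
    have h1 := Q.velocity_eq hV u hm
    have h2 := Q.velocity_eq hV v hm
    rw [← ha] at h1
    rw [← hb] at h2
    have h3 := Q.coercive u (a - b)
    rw [map_sub (Q.B u), sub_apply] at h3
    have h4 : -((Q.B u - Q.B v) b (a - b)) ≤ ‖Q.B u - Q.B v‖ * ‖b‖ * ‖a - b‖ :=
      (neg_le_abs _).trans ((Q.B u - Q.B v).le_opNorm₂ b (a - b))
    have h5 : -((Q.r u - Q.r v) (a - b)) ≤ ‖Q.r u - Q.r v‖ * ‖a - b‖ :=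
      (neg_le_abs _).trans ((Q.r u - Q.r v).le_opNorm (a - b))
    rw [sub_apply, sub_apply] at h4
    rw [sub_apply] at h5
    rw [le_div_iff₀ hpos]
    rcases (norm_nonneg (a - b)).eq_or_lt with h0 | h0
    · rw [← h0, zero_mul]; positivity
    · refine le_of_mul_le_mul_right ?_ h0
      nlinarith
  rw [ContinuousAt, tendsto_iff_norm_sub_tendsto_zero]
  refine squeeze_zero (fun _ => norm_nonneg _) key ?_
  have c1 := (tendsto_iff_norm_sub_tendsto_zero (E := E →L[ℝ] E →L[ℝ] ℝ)).1 (Q.continuous_B.tendsto v)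
  have c2 := tendsto_iff_norm_sub_tendsto_zero.1 (Q.continuous_r.tendsto v)
  simpa using ((c1.mul_const ‖Q.velocity hV v‖).add c2).div_const Q.m

/-- By uniqueness the weak derivative agrees a.e. with the velocity at `w t`, which is continuous in
`t`. So `w` is the integral of a continuous function. -/
theorem exists_hasDerivAt (hV : IsClosed (V : Set E)) {u₀ : E} {w d : ℝ → E} (hm : ∀ t, 0 ≤ t → w t ∈ V)
    (hd : ∀ T, 0 < T → IntegrableOn d (Ioo 0 T))
    (hw : ∀ t, 0 ≤ t → w t = u₀ + ∫ s in (0 : ℝ)..t, d s)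
    (he : ∀ᵐ t ∂(volume.restrict (Ioi (0 : ℝ))), ∀ χ ∈ V, Q.B (w t) (d t) χ + Q.r (w t) χ = 0) :
    ∃ w' D : ℝ → E, (∀ t, HasDerivAt w' (D t) t) ∧
      (∀ t, 0 ≤ t → w' t = w t ∧ D t ∈ V ∧ ∀ χ ∈ V, Q.B (w t) (D t) χ + Q.r (w t) χ = 0) := by
  -- Extension by zero makes the derivative integrable on every bounded interval, as Lebesgue
  -- differentiation on the line requires.
  set f : ℝ → E := (Ioi 0).indicator d with hf
  have hfi : ∀ a b, IntervalIntegrable f volume a b := by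
    intro a b
    set T := max (max a b) 1 with hT
    have hT0 : 0 < T := lt_of_lt_of_le one_pos (le_max_right _ _)
    have h1 : IntegrableOn f (Iic T) := by
      rw [hf, IntegrableOn, integrable_indicator_iff measurableSet_Ioi, IntegrableOn,
        Measure.restrict_restrict measurableSet_Ioi, Ioi_inter_Iic]
      exact (integrableOn_Ioc_iff_integrableOn_Ioo).2 (hd T hT0)
    rw [intervalIntegrable_iff]
    exact h1.mono_set fun x hx => hx.2.trans (le_max_left _ _)
  have hwf : ∀ t, 0 ≤ t → w t = u₀ + ∫ s in (0 : ℝ)..t, f s := by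
    intro t ht
    rw [hw t ht]
    congr 1
    refine intervalIntegral.integral_congr_ae (Eventually.of_forall fun s hs => ?_)
    rw [uIoc_of_le ht] at hs
    rw [hf, indicator_of_mem (show s ∈ Ioi 0 from hs.1)]
  have hfc : Continuous fun t => u₀ + ∫ s in (0 : ℝ)..t, f s :=
    continuous_const.add (intervalIntegral.continuous_primitive hfi 0)
  have hloc : LocallyIntegrable f volume := by
    rw [MeasureTheory.locallyIntegrable_iff]
    intro K hK
    obtain ⟨a, ha⟩ := hK.bddBelow
    obtain ⟨b, hb⟩ := hK.bddAbove
    rcases K.eq_empty_or_nonempty with rfl | ⟨x, hx⟩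
    · simp
    · have := (intervalIntegrable_iff_integrableOn_Icc_of_le ((ha hx).trans (hb hx))).1 (hfi a b)
      exact this.mono_set fun y hy => ⟨ha hy, hb hy⟩
  have hder := _root_.LocallyIntegrable.ae_hasDerivAt_integral hloc
  -- Freezing the state for negative times makes `D` continuous on the whole line, so that its
  -- primitive has a two-sided derivative also at time zero.
  set D : ℝ → E := fun s => Q.velocity hV (w (max s 0)) with hD
  have hDc : Continuous D := by
    refine (Q.continuous_velocity hV).comp ?_
    have : (fun s : ℝ => w (max s 0)) = fun s => u₀ + ∫ r in (0 : ℝ)..(max s 0), f r := by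
      funext s
      exact hwf _ (le_max_right _ _)
    rw [this]
    exact hfc.comp (by fun_prop)
  have hfD : ∀ᵐ t ∂(volume : Measure ℝ), 0 < t → f t = D t := by
    have he' := (ae_restrict_iff' measurableSet_Ioi).1 he
    filter_upwards [hder, he'] with t h1 h2 ht
    have h3 : HasDerivAt w (f t) t := by
      refine ((h1 0).const_add u₀).congr_of_eventuallyEq ?_
      filter_upwards [lt_mem_nhds ht] with s hs
      exact hwf s hs.le
    have h4 : d t = f t := by
      rw [hf, indicator_of_mem (show t ∈ Ioi 0 from ht)]
    have h5 : f t ∈ V := hasDerivAt_mem_of_isClosed hV h3 (by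
      filter_upwards [lt_mem_nhds ht] with s hs
      exact hm s hs.le)
    rw [hD]
    simp only [max_eq_left ht.le]
    refine Q.eq_velocity hV h5 fun χ hχ => ?_
    rw [← h4]
    exact h2 ht χ hχ
  refine ⟨fun t => u₀ + ∫ s in (0 : ℝ)..t, D s, D, fun t => ?_, fun t ht =>
    ⟨?_, Q.velocity_mem hV _, fun χ hχ => ?_⟩⟩
  · exact (intervalIntegral.integral_hasDerivAt_right (hDc.intervalIntegrable _ _)
      (hDc.stronglyMeasurableAtFilter _ _) hDc.continuousAt).const_add u₀
  · rw [hwf t ht]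
    refine congrArg (u₀ + ·) ?_
    refine intervalIntegral.integral_congr_ae ?_
    filter_upwards [hfD] with s hs hsI
    rw [uIoc_of_le ht] at hsI
    exact (hs hsI.1).symm
  · rw [hD]
    simp only [max_eq_left ht]
    exact Q.velocity_eq hV _ hχ

end CoerciveEvolution

end Abstract

/-! ### The closed-loop problem as a coercive evolution equation -/

/-- Positivity of the constants. -/
structure Params.Pos (p : Params) : Prop where
  μ : 0 < p.μ
  ν : 0 < p.ν
  wd : 0 ≤ p.wd
  c₀ : 0 < p.c₀
  c₁ : 0 < p.c₁

/-- The closed-loop problem as an implicit evolution equation. -/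
def Params.evolution (p : Params) (hp : p.Pos) : CoerciveEvolution H1 where
  B u := bilForm fnL dxL (valL 0 zero_mem_I) (valL 1 one_mem_I) p.μ
    (p.μ / p.ν * (p.c₀ + 1 + p.wd + 2 / (3 * p.c₀) * (valL 0 zero_mem_I u) ^ 2))
    (p.μ / p.ν * (p.c₁ + 1 + p.wd + 2 / (3 * p.c₁) * (valL 1 one_mem_I u) ^ 2))
  r u := linForm fnL dxL (valL 0 zero_mem_I) (valL 1 one_mem_I)
    ((1 + p.wd) • dxL u + mulL u (dxL u)) (p.ν • dxL u)
    ((p.c₀ + 1 + p.wd) * valL 0 zero_mem_I u + 2 / (9 * p.c₀) * (valL 0 zero_mem_I u) ^ 3)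
    ((p.c₁ + 1 + p.wd) * valL 1 one_mem_I u + 2 / (9 * p.c₁) * (valL 1 one_mem_I u) ^ 3)
  m := min 1 p.μ
  pos := lt_min one_pos hp.μ
  continuous_B := by
    have h4 := (valL 0 zero_mem_I).continuous
    have h5 := (valL 1 one_mem_I).continuous
    exact continuous_bilForm _ _ _ _ _
      ((continuous_const.add ((h4.pow 2).const_mul _)).const_mul _)
      ((continuous_const.add ((h5.pow 2).const_mul _)).const_mul _)
  continuous_r := by
    have h4 := (valL 0 zero_mem_I).continuous
    have h5 := (valL 1 one_mem_I).continuous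
    have h1 (c : ℝ) : Continuous fun u => c • dxL u := dxL.continuous.const_smul c
    exact continuous_linForm _ _ _ _
      ((h1 _).add (mulL.continuous.clm_apply dxL.continuous))
      (h1 _)
      ((h4.const_mul _).add ((h4.pow 3).const_mul _))
      ((h5.const_mul _).add ((h5.pow 3).const_mul _))
  coercive u d := by
    obtain ⟨hμ, hν, hwd, hc₀, hc₁⟩ := hp
    rw [bilForm_apply, d.norm_sq, real_inner_self_eq_norm_sq, real_inner_self_eq_norm_sq, ← sq,
      ← sq, fnL_apply, dxL_apply]
    -- The boundary coefficients are nonnegative for every state, so coercivity is uniform in `u`.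
    have h1 : 0 ≤ p.μ / p.ν * (p.c₀ + 1 + p.wd + 2 / (3 * p.c₀) * (valL 0 zero_mem_I u) ^ 2) *
      (valL 0 zero_mem_I d) ^ 2 := by positivity
    have h2 : 0 ≤ p.μ / p.ν * (p.c₁ + 1 + p.wd + 2 / (3 * p.c₁) * (valL 1 one_mem_I u) ^ 2) *
      (valL 1 one_mem_I d) ^ 2 := by positivity
    nlinarith [mul_le_mul_of_nonneg_right (min_le_left 1 p.μ) (sq_nonneg ‖d.fn‖),
      mul_le_mul_of_nonneg_right (min_le_right 1 p.μ) (sq_nonneg ‖d.dx‖)]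

theorem Params.weakForm_eq (p : Params) (hp : p.Pos) (u d χ : H1) :
    p.weakForm u d χ = (p.evolution hp).B u d χ + (p.evolution hp).r u χ := by
  rw [Params.weakForm, integral_conv]
  change _ = bilForm fnL dxL (valL 0 zero_mem_I) (valL 1 one_mem_I) _ _ _ d χ
    + linForm fnL dxL (valL 0 zero_mem_I) (valL 1 one_mem_I) _ _ _ _ χ
  rw [bilForm_apply, linForm_apply, inner_add_left, inner_smul_left, inner_smul_left]
  simp only [fnL_apply, dxL_apply, valL_apply, conj_trivial]
  ring

/-- Classical solutions in time: `D` is the time derivative of `w`, everywhere. -/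
structure Params.IsC1Sol (p : Params) (V : Submodule ℝ H1) (w D : ℝ → H1) : Prop where
  hasDerivAt : ∀ t, HasDerivAt w (D t) t
  mem : ∀ t, 0 ≤ t → w t ∈ V
  mem_deriv : ∀ t, 0 ≤ t → D t ∈ V
  eq : ∀ t, 0 ≤ t → ∀ χ ∈ V, p.weakForm (w t) (D t) χ = 0

theorem Params.Solves.exists_isC1Sol {p : Params} (hp : p.Pos) {V : Submodule ℝ H1}
    (hV : IsClosed (V : Set H1)) {u₀ : H1} {w : ℝ → H1} (h : p.Solves V u₀ w) :
    ∃ w' D : ℝ → H1, p.IsC1Sol V w' D ∧ (∀ t, 0 ≤ t → w' t = w t) ∧ w' 0 = u₀ := by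
  obtain ⟨hm, d, hd, hw, he⟩ := h
  obtain ⟨w', D, h1, h2⟩ := (p.evolution hp).exists_hasDerivAt hV hm
    (fun T hT => (hd T hT).integrable (by norm_num)) hw (by
      filter_upwards [he] with t ht χ hχ
      rw [← p.weakForm_eq]
      exact ht χ hχ)
  refine ⟨w', D, ⟨h1, fun t ht => ?_, fun t ht => (h2 t ht).2.1, fun t ht χ hχ => ?_⟩,
    fun t ht => (h2 t ht).1, ?_⟩
  · rw [(h2 t ht).1]; exact hm t ht
  · rw [p.weakForm_eq hp, (h2 t ht).1]; exact (h2 t ht).2.2 χ hχ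
  · rw [(h2 0 le_rfl).1, hw 0 le_rfl]; simp

/-! ### Exponential decay of solutions -/

/-- Integrating factor: `f s * exp (-A s)` is antitone on `[0,∞)`. -/
theorem le_mul_exp_of_deriv_le {f f' A a : ℝ → ℝ} (hf : ∀ t, HasDerivAt f (f' t) t)
    (hA : ∀ t, HasDerivAt A (a t) t) (h : ∀ t, 0 ≤ t → f' t ≤ a t * f t) {t : ℝ} (ht : 0 ≤ t) :
    f t ≤ f 0 * Real.exp (A t - A 0) := by
  have hd : ∀ s, HasDerivAt (fun s => f s * Real.exp (-A s))
      (f' s * Real.exp (-A s) + f s * (Real.exp (-A s) * (-a s))) s := fun s =>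
    (hf s).mul ((hA s).neg.exp)
  have hanti : AntitoneOn (fun s => f s * Real.exp (-A s)) (Ici 0) := by
    refine antitoneOn_of_deriv_nonpos (convex_Ici 0)
      (fun s _ => (hd s).continuousAt.continuousWithinAt)
      (fun s _ => (hd s).differentiableAt.differentiableWithinAt) fun s hs => ?_
    rw [interior_Ici] at hs
    rw [(hd s).deriv]
    nlinarith [Real.exp_pos (-A s), h s (le_of_lt hs)]
  have := hanti (mem_Ici.2 le_rfl) (mem_Ici.2 ht) ht
  simp only at this
  have h2 : f t = f t * Real.exp (-A t) * Real.exp (A t) := by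
    rw [mul_assoc, ← Real.exp_add]; simp
  rw [h2, sub_eq_neg_add, Real.exp_add, ← mul_assoc]
  exact mul_le_mul_of_nonneg_right this (Real.exp_pos _).le

/-- Decay rates covered by the energy estimate. -/
structure Params.Rate (p : Params) (β : ℝ) : Prop where
  nonneg : 0 ≤ β
  interior : β * (p.μ + 3 / 2) ≤ p.ν
  ode : 2 * β * p.μ ≤ p.ν
  left : 2 * β * (p.μ / p.ν * (p.c₀ + 1 + p.wd) + 3 / 4) ≤ p.c₀ + 1 + p.wd
  right : 2 * β * (p.μ / p.ν * (p.c₁ + 1 + p.wd) + 3 / 4) ≤ p.c₁ + 1 + p.wd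

/-- The upper bounds in `Params.Rate` are all strict at `α`: `rateMax` carries a 1 where `left` and
`right` carry 3/4, and `ν / (μ + 1)` leaves room in the other two. Strict inequalities survive
slightly above `α`, and the gap `β - α` later keeps the Gronwall factor bounded in time. -/
theorem Params.exists_rate {p : Params} (hp : p.Pos) {α : ℝ} (hα : 0 ≤ α) (hα' : α ≤ p.rateMax) :
    ∃ β, α < β ∧ p.Rate β := by
  obtain ⟨hμ, hν, hwd, hc₀, hc₁⟩ := hp
  rw [Params.rateMax] at hα'
  have h2 : 2 * α ≤ min (p.ν / (p.μ + 1)) (min (p.ν / (2 * p.μ + p.ν))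
    (min (p.ν * (1 + p.c₀ + p.wd) / (p.ν + (1 + p.c₀ + p.wd) * p.μ))
      (p.ν * (1 + p.c₁ + p.wd) / (p.ν + (1 + p.c₁ + p.wd) * p.μ)))) := by linarith
  simp only [le_min_iff] at h2
  obtain ⟨a1, a2, a3, a4⟩ := h2
  rw [le_div_iff₀ (by positivity)] at a1 a2 a3 a4
  have aux : ∀ k : ℝ, 0 < k → 2 * α * (p.ν + k * p.μ) ≤ p.ν * k →
      2 * α * (p.μ / p.ν * k + 3 / 4) < k := by
    intro k hk h
    rcases hα.eq_or_lt with h0 | h0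
    · rw [← h0]; simpa using hk
    · have : 2 * α * (p.μ / p.ν * k + 1) ≤ k := by
        refine le_of_mul_le_mul_left ?_ hν
        calc p.ν * (2 * α * (p.μ / p.ν * k + 1)) = 2 * α * (p.ν + k * p.μ) := by
              field_simp; ring
          _ ≤ _ := h
      nlinarith
  have e1 : α * (p.μ + 3 / 2) < p.ν := by nlinarith
  have e2 : 2 * α * p.μ < p.ν := by nlinarith
  have e3 := aux (p.c₀ + 1 + p.wd) (by positivity) (by linarith)
  have e4 := aux (p.c₁ + 1 + p.wd) (by positivity) (by linarith)
  have ev : ∀ (c d : ℝ), α * c < d → ∀ᶠ β in nhdsWithin α (Ioi α), β * c < d := fun c d h =>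
    (((continuous_id.mul continuous_const).tendsto α).eventually_lt_const h).filter_mono
      nhdsWithin_le_nhds
  have f3 := ev (2 * (p.μ / p.ν * (p.c₀ + 1 + p.wd) + 3 / 4)) (p.c₀ + 1 + p.wd) (by linarith)
  have f4 := ev (2 * (p.μ / p.ν * (p.c₁ + 1 + p.wd) + 3 / 4)) (p.c₁ + 1 + p.wd) (by linarith)
  obtain ⟨β, g1, g2, g3, g4, g5⟩ := ((ev _ _ e1).and ((ev (2 * p.μ) p.ν (by linarith)).and
    (f3.and (f4.and self_mem_nhdsWithin)))).exists
  exact ⟨β, g5, hα.trans (le_of_lt g5), g1.le, by linarith, by linarith, by linarith⟩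

/-- The energy `‖u‖² + μ‖u_x‖² + (μ/ν) Σ (k_i u(i)² + u(i)⁴/(3c_i))`. -/
def Params.energy (p : Params) (u : H1) : ℝ :=
  ‖u.fn‖ ^ 2 + p.μ * ‖u.dx‖ ^ 2
    + p.μ / p.ν * ((p.c₀ + 1 + p.wd) * u.val 0 ^ 2 + u.val 0 ^ 4 / (3 * p.c₀)
      + ((p.c₁ + 1 + p.wd) * u.val 1 ^ 2 + u.val 1 ^ 4 / (3 * p.c₁)))

theorem Params.le_energy {p : Params} (hp : p.Pos) (u : H1) :
    min 1 p.μ * ‖u‖ ^ 2 ≤ p.energy u := by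
  obtain ⟨hμ, hν, hwd, hc₀, hc₁⟩ := hp
  rw [energy, u.norm_sq]
  have h1 : 0 ≤ p.μ / p.ν * ((p.c₀ + 1 + p.wd) * u.val 0 ^ 2 + u.val 0 ^ 4 / (3 * p.c₀)
      + ((p.c₁ + 1 + p.wd) * u.val 1 ^ 2 + u.val 1 ^ 4 / (3 * p.c₁))) := by
    positivity
  nlinarith [mul_le_mul_of_nonneg_right (min_le_left 1 p.μ) (sq_nonneg ‖u.fn‖),
    mul_le_mul_of_nonneg_right (min_le_right 1 p.μ) (sq_nonneg ‖u.dx‖)]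

theorem sq_val_le (u : H1) {x : ℝ} (hx : x ∈ Icc (0 : ℝ) 1) : u.val x ^ 2 ≤ 4 * ‖u‖ ^ 2 := by
  have := pow_le_pow_left₀ (abs_nonneg _) (u.abs_val_le hx) 2
  rw [sq_abs] at this
  linarith

theorem Params.energy_le {p : Params} (hp : p.Pos) (u : H1) :
    p.energy u ≤ (1 + p.μ + p.μ / p.ν * (4 * (p.c₀ + 1 + p.wd) + 4 * (p.c₁ + 1 + p.wd)
      + (16 / (3 * p.c₀) + 16 / (3 * p.c₁)) * ‖u‖ ^ 2)) * ‖u‖ ^ 2 := by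
  obtain ⟨hμ, hν, hwd, hc₀, hc₁⟩ := hp
  have h0 := sq_val_le u zero_mem_I
  have h1 := sq_val_le u one_mem_I
  have q : ∀ s : ℝ, s ^ 2 ≤ 4 * ‖u‖ ^ 2 → s ^ 4 ≤ 16 * (‖u‖ ^ 2 * ‖u‖ ^ 2) := fun s hs => by
    nlinarith [sq_nonneg s, sq_nonneg ‖u‖]
  have hb : (p.c₀ + 1 + p.wd) * u.val 0 ^ 2 + u.val 0 ^ 4 / (3 * p.c₀)
      + ((p.c₁ + 1 + p.wd) * u.val 1 ^ 2 + u.val 1 ^ 4 / (3 * p.c₁))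
      ≤ (p.c₀ + 1 + p.wd) * (4 * ‖u‖ ^ 2) + (16 * (‖u‖ ^ 2 * ‖u‖ ^ 2)) / (3 * p.c₀)
      + ((p.c₁ + 1 + p.wd) * (4 * ‖u‖ ^ 2) + (16 * (‖u‖ ^ 2 * ‖u‖ ^ 2)) / (3 * p.c₁)) := by
    have := q _ h0
    have := q _ h1
    gcongr
  have hμν : 0 ≤ p.μ / p.ν := by positivity
  have h3 := mul_le_mul_of_nonneg_left hb hμν
  have h4 : p.μ * ‖u.dx‖ ^ 2 ≤ p.μ * ‖u‖ ^ 2 := by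
    have := u.norm_dx_le
    gcongr
  have h5 : ‖u.fn‖ ^ 2 ≤ ‖u‖ ^ 2 := by
    have := u.norm_fn_le
    gcongr
  rw [energy]
  refine (add_le_add (add_le_add h5 h4) h3).trans (le_of_eq ?_)
  ring

section Deriv

variable {w : ℝ → H1} {d : H1} {t : ℝ}

theorem hasDerivAt_val (h : HasDerivAt w d t) {x : ℝ} (hx : x ∈ Icc (0 : ℝ) 1) :
    HasDerivAt (fun s => (w s).val x) (d.val x) t :=
  (valL x hx).hasFDerivAt.comp_hasDerivAt t h

theorem hasDerivAt_norm_fn_sq (h : HasDerivAt w d t) :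
    HasDerivAt (fun s => ‖(w s).fn‖ ^ 2) (2 * inner ℝ d.fn (w t).fn) t := by
  have := (fnL.hasFDerivAt.comp_hasDerivAt t h).norm_sq
  rw [real_inner_comm] at this
  exact this

theorem hasDerivAt_norm_dx_sq (h : HasDerivAt w d t) :
    HasDerivAt (fun s => ‖(w s).dx‖ ^ 2) (2 * inner ℝ d.dx (w t).dx) t := by
  have := (dxL.hasFDerivAt.comp_hasDerivAt t h).norm_sq
  rw [real_inner_comm] at this
  exact this

theorem Params.hasDerivAt_energy (p : Params) (h : HasDerivAt w d t) :
    HasDerivAt (fun s => p.energy (w s)) (2 * (inner ℝ d.fn (w t).fn + p.μ * inner ℝ d.dx (w t).dx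
      + p.μ / p.ν * (((p.c₀ + 1 + p.wd) * d.val 0 + 2 / (3 * p.c₀) * (w t).val 0 ^ 2 * d.val 0)
          * (w t).val 0
        + ((p.c₁ + 1 + p.wd) * d.val 1 + 2 / (3 * p.c₁) * (w t).val 1 ^ 2 * d.val 1)
          * (w t).val 1))) t := by
  have h0 := hasDerivAt_val h zero_mem_I
  have h1 := hasDerivAt_val h one_mem_I
  have := ((hasDerivAt_norm_fn_sq h).add ((hasDerivAt_norm_dx_sq h).const_mul p.μ)).add
    (((((h0.pow 2).const_mul (p.c₀ + 1 + p.wd)).add ((h0.pow 4).div_const (3 * p.c₀))).add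
      (((h1.pow 2).const_mul (p.c₁ + 1 + p.wd)).add ((h1.pow 4).div_const (3 * p.c₁)))).const_mul
        (p.μ / p.ν))
  refine this.congr_deriv ?_
  field_simp
  push_cast
  ring

end Deriv

theorem inner_mulL_self (u : H1) :
    inner ℝ (mulL u u.dx) u.fn = (u.val 1 ^ 3 - u.val 0 ^ 3) / 3 := by
  have := H1.integral_triple u u u
  rw [inner_mulL]
  linarith

theorem inner_dx_fn_self (u : H1) : inner ℝ u.dx u.fn = (u.val 1 ^ 2 - u.val 0 ^ 2) / 2 := by
  have := H1.inner_dx_fn_add u u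
  linarith

/-- The part of the dissipation that controls the quadratic part of the energy. -/
theorem Params.Rate.coercive {p : Params} {β : ℝ} (hβ : p.Rate β) (u : H1) :
    2 * β * (‖u.fn‖ ^ 2 + p.μ * ‖u.dx‖ ^ 2
      + p.μ / p.ν * ((p.c₀ + 1 + p.wd) * u.val 0 ^ 2 + (p.c₁ + 1 + p.wd) * u.val 1 ^ 2))
    ≤ 2 * p.ν * ‖u.dx‖ ^ 2 + (p.c₀ + 1 + p.wd) * u.val 0 ^ 2
      + (p.c₁ + 1 + p.wd) * u.val 1 ^ 2 := by
  have h1 := mul_le_mul_of_nonneg_left u.poincare (mul_nonneg zero_le_two hβ.nonneg)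
  have h2 := mul_le_mul_of_nonneg_right hβ.interior (sq_nonneg ‖u.dx‖)
  have h3 := mul_le_mul_of_nonneg_right hβ.left (sq_nonneg (u.val 0))
  have h4 := mul_le_mul_of_nonneg_right hβ.right (sq_nonneg (u.val 1))
  linarith

/-- Here the form of the feedback matters. Convection contributes `(u(1)³ - u(0)³)/3`; with `c_i
u(i)²` and one quarter of the quartic dissipation this completes the squares `c_i u(i)² (1 ∓
u(i)/(3c_i))²`. The other three quarters, `u(i)⁴/(3c_i)`, dominate the quartic part of the energy by
`Rate.ode`. -/
theorem Params.energy_le_dissipation {p : Params} (hp : p.Pos) {β : ℝ} (hβ : p.Rate β) (u : H1) :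
    2 * β * p.energy u ≤ 2 * (p.ν * inner ℝ u.dx u.dx
    + (1 + p.wd) * inner ℝ u.dx u.fn + (∫ x, u.fn x * u.dx x * u.fn x ∂volI)
    + (((p.c₀ + 1 + p.wd) * u.val 0 + 2 / (9 * p.c₀) * u.val 0 ^ 3) * u.val 0
        + ((p.c₁ + 1 + p.wd) * u.val 1 + 2 / (9 * p.c₁) * u.val 1 ^ 3) * u.val 1)) := by
  obtain ⟨hμ, hν, hwd, hc₀, hc₁⟩ := hp
  rw [integral_conv, inner_mulL_self, inner_dx_fn_self, real_inner_self_eq_norm_sq, energy]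
  have h1 := hβ.coercive u
  have h2 : 2 * β * (p.μ / p.ν) ≤ 1 := by
    rw [← mul_div_assoc, div_le_one hν]; exact hβ.ode
  have h0 : 0 ≤ u.val 0 ^ 4 / (3 * p.c₀) + u.val 1 ^ 4 / (3 * p.c₁) := by positivity
  have h3 := mul_le_mul_of_nonneg_right h2 h0
  have s0 : 0 ≤ p.c₀ * u.val 0 ^ 2 - 2 / 3 * u.val 0 ^ 3 + u.val 0 ^ 4 / (9 * p.c₀) := by
    have : p.c₀ * u.val 0 ^ 2 - 2 / 3 * u.val 0 ^ 3 + u.val 0 ^ 4 / (9 * p.c₀)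
      = p.c₀ * u.val 0 ^ 2 * (1 - u.val 0 / (3 * p.c₀)) ^ 2 := by field_simp; ring
    rw [this]; positivity
  have s1 : 0 ≤ p.c₁ * u.val 1 ^ 2 + 2 / 3 * u.val 1 ^ 3 + u.val 1 ^ 4 / (9 * p.c₁) := by
    have : p.c₁ * u.val 1 ^ 2 + 2 / 3 * u.val 1 ^ 3 + u.val 1 ^ 4 / (9 * p.c₁)
      = p.c₁ * u.val 1 ^ 2 * (1 + u.val 1 / (3 * p.c₁)) ^ 2 := by field_simp; ring
    rw [this]; positivity
  have t1 : 0 ≤ (1 + p.wd) * u.val 1 ^ 2 := by positivity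
  have e0 : ∀ c s : ℝ, 0 < c → 2 * (2 / (9 * c) * s ^ 3 * s) = s ^ 4 / (9 * c) + s ^ 4 / (3 * c) :=
    fun c s hc => by field_simp; ring
  have e1 := e0 p.c₀ (u.val 0) hc₀
  have e2 := e0 p.c₁ (u.val 1) hc₁
  linarith

/-- Test with `w t` itself. Nothing depends on `V`, so Galerkin solutions decay like the exact one.
-/
theorem Params.IsC1Sol.energy_le {p : Params} (hp : p.Pos) {β : ℝ} (hβ : p.Rate β)
    {V : Submodule ℝ H1} {w D : ℝ → H1} (h : p.IsC1Sol V w D) {t : ℝ} (ht : 0 ≤ t) :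
    p.energy (w t) ≤ p.energy (w 0) * Real.exp (-(2 * β) * t) := by
  have := le_mul_exp_of_deriv_le (fun t => p.hasDerivAt_energy (h.hasDerivAt t))
    (A := fun t => -(2 * β) * t) (a := fun _ => -(2 * β))
    (fun t => by simpa using (hasDerivAt_id t).const_mul (-(2 * β))) (fun t ht => ?_) ht
  · simpa using this
  · have h1 := h.eq t ht _ (h.mem t ht)
    have h2 := p.energy_le_dissipation hp hβ (w t)
    rw [weakForm] at h1
    linarith

/-- Test with `D t`, which is admissible since it lies in `V`, and use coercivity. -/
theorem Params.IsC1Sol.norm_deriv_le {p : Params} (hp : p.Pos)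
    {V : Submodule ℝ H1} {w D : ℝ → H1} (h : p.IsC1Sol V w D) {t : ℝ} (ht : 0 ≤ t) :
    min 1 p.μ * ‖D t‖ ≤ (p.ν + (1 + p.wd) + 4 * (p.c₀ + 1 + p.wd) + 4 * (p.c₁ + 1 + p.wd)
      + 2 * ‖w t‖ + (32 / (9 * p.c₀) + 32 / (9 * p.c₁)) * ‖w t‖ ^ 2) * ‖w t‖ := by
  have h1 := h.eq t ht _ (h.mem_deriv t ht)
  rw [p.weakForm_eq hp] at h1
  have h2 := (p.evolution hp).coercive (w t) (D t)
  have h3 : (p.evolution hp).r (w t) (D t) = _ := linForm_apply _ _ _ _ _ _ _ _ _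
  rw [inner_add_left, inner_smul_left, inner_smul_left] at h3
  simp only [fnL_apply, dxL_apply, valL_apply, conj_trivial] at h3
  change min 1 p.μ * ‖D t‖ ^ 2 ≤ _ at h2
  obtain ⟨hμ, hν, hwd, hc₀, hc₁⟩ := hp
  set u := w t
  set d := D t
  have i1 : |inner ℝ u.dx d.fn| ≤ ‖u‖ * ‖d‖ :=
    (abs_real_inner_le_norm _ _).trans (mul_le_mul u.norm_dx_le d.norm_fn_le (norm_nonneg _)
      (norm_nonneg _))
  have i2 : |inner ℝ u.dx d.dx| ≤ ‖u‖ * ‖d‖ :=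
    (abs_real_inner_le_norm _ _).trans (mul_le_mul u.norm_dx_le d.norm_dx_le (norm_nonneg _)
      (norm_nonneg _))
  have i3 : |inner ℝ (mulL u u.dx) d.fn| ≤ 2 * ‖u‖ * ‖u‖ * ‖d‖ := by
    refine (abs_real_inner_le_norm _ _).trans (mul_le_mul ?_ d.norm_fn_le (norm_nonneg _)
      (by positivity))
    exact (norm_mulL_le u u.dx fun x hx => u.abs_val_le hx).trans
      (mul_le_mul_of_nonneg_left u.norm_dx_le (by positivity))
  have i4 : ∀ (k c x : ℝ), 0 < k → 0 < c → x ∈ Icc (0 : ℝ) 1 →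
      |(k * u.val x + 2 / (9 * c) * u.val x ^ 3) * d.val x|
        ≤ (4 * k + 32 / (9 * c) * ‖u‖ ^ 2) * ‖u‖ * ‖d‖ := by
    intro k c x hk hc hx
    have a1 := u.abs_val_le hx
    have a2 := d.abs_val_le hx
    rw [abs_mul]
    have a3 : |k * u.val x + 2 / (9 * c) * u.val x ^ 3|
        ≤ k * (2 * ‖u‖) + 2 / (9 * c) * (2 * ‖u‖) ^ 3 := by
      refine (abs_add_le _ _).trans ?_
      rw [abs_mul, abs_mul, abs_pow, abs_of_pos hk, abs_of_pos (by positivity : 0 < 2 / (9 * c))]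
      gcongr
    refine (mul_le_mul a3 a2 (abs_nonneg _) (by positivity)).trans (le_of_eq ?_)
    ring
  have i5 := i4 _ p.c₀ 0 (by positivity : 0 < p.c₀ + 1 + p.wd) hc₀ zero_mem_I
  have i6 := i4 _ p.c₁ 1 (by positivity : 0 < p.c₁ + 1 + p.wd) hc₁ one_mem_I
  have j1 := mul_le_mul_of_nonneg_left (abs_le.1 i1).1 (by positivity : 0 ≤ 1 + p.wd)
  have j2 := mul_le_mul_of_nonneg_left (abs_le.1 i2).1 hν.le
  have hfin : min 1 p.μ * ‖d‖ * ‖d‖ ≤ (p.ν + (1 + p.wd) + 4 * (p.c₀ + 1 + p.wd)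
      + 4 * (p.c₁ + 1 + p.wd) + 2 * ‖u‖ + (32 / (9 * p.c₀) + 32 / (9 * p.c₁)) * ‖u‖ ^ 2) * ‖u‖
      * ‖d‖ := by
    have := (abs_le.1 i3).1
    have := (abs_le.1 i5).1
    have := (abs_le.1 i6).1
    linarith
  rcases (norm_nonneg d).eq_or_lt with h0 | h0
  · rw [← h0, mul_zero]; positivity
  · exact le_of_mul_le_mul_right hfin h0

/-- Solutions and their time derivatives decay at any rate covered by the energy estimate. -/
theorem Params.exists_decay {p : Params} (hp : p.Pos) {β : ℝ} (hβ : p.Rate β) (R : ℝ) :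
    ∃ C, 0 < C ∧ ∀ (V : Submodule ℝ H1) (w D : ℝ → H1), p.IsC1Sol V w D → ‖w 0‖ ≤ R →
      ∀ t, 0 ≤ t → ‖w t‖ ≤ C * Real.exp (-β * t) ∧ ‖D t‖ ≤ C * Real.exp (-β * t) := by
  have hm : 0 < min 1 p.μ := lt_min one_pos hp.μ
  set m := min 1 p.μ with hm'
  -- `M` bounds the initial energy, `S` the solution and `K` its time derivative; none of them
  -- involves `V`.
  set M : ℝ := (1 + p.μ + p.μ / p.ν * (4 * (p.c₀ + 1 + p.wd) + 4 * (p.c₁ + 1 + p.wd)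
      + (16 / (3 * p.c₀) + 16 / (3 * p.c₁)) * R ^ 2)) * R ^ 2 with hM
  set S : ℝ := Real.sqrt (M / m) with hS
  set K : ℝ := (p.ν + (1 + p.wd) + 4 * (p.c₀ + 1 + p.wd) + 4 * (p.c₁ + 1 + p.wd)
      + 2 * S + (32 / (9 * p.c₀) + 32 / (9 * p.c₁)) * S ^ 2) * S / m with hK
  have hp' := hp
  obtain ⟨hμ, hν, hwd, hc₀, hc₁⟩ := hp'
  have hS0 : 0 ≤ S := Real.sqrt_nonneg _
  have hK0 : 0 ≤ K := by positivity
  refine ⟨S + K + 1, by positivity, fun V w D h h0 t ht => ?_⟩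
  have hR : 0 ≤ R := (norm_nonneg _).trans h0
  have e1 := h.energy_le hp hβ ht
  have e2 : p.energy (w 0) ≤ M := by
    refine (Params.energy_le hp (w 0)).trans ?_
    rw [hM]
    gcongr
  have e3 := Params.le_energy hp (w t)
  have hexp := Real.exp_pos (-β * t)
  have hexp1 : Real.exp (-β * t) ≤ 1 := by
    rw [Real.exp_le_one_iff]; nlinarith [hβ.nonneg]
  have e4 : ‖w t‖ ≤ S * Real.exp (-β * t) := by
    refine abs_le_of_sq_le_sq' ?_ (by positivity) |>.2
    rw [mul_pow, hS, Real.sq_sqrt (by positivity), ← Real.exp_nat_mul, div_mul_eq_mul_div,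
      le_div_iff₀ hm]
    have : Real.exp ((2 : ℕ) * (-β * t)) = Real.exp (-(2 * β) * t) := by
      congr 1; push_cast; ring
    rw [this]
    have := mul_le_mul_of_nonneg_right e2 (Real.exp_pos (-(2 * β) * t)).le
    linarith
  have e5 : ‖D t‖ ≤ K * Real.exp (-β * t) := by
    have g := h.norm_deriv_le hp ht
    rw [hK, div_mul_eq_mul_div, le_div_iff₀ hm, mul_comm]
    refine g.trans ?_
    have hwS : ‖w t‖ ≤ S := e4.trans (by nlinarith)
    rw [mul_assoc _ S]
    gcongr
  constructor <;> nlinarith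

/-! ### The finite element space and nodal interpolation -/

namespace Mesh

variable (P : Mesh)

theorem castSucc_lt (j : Fin P.N) : P.node j.castSucc < P.node j.succ :=
  P.strictMono j.castSucc_lt_succ

theorem gap_le_h (j : Fin P.N) : P.node j.succ - P.node j.castSucc ≤ P.h :=
  le_ciSup (f := fun j : Fin P.N => P.node j.succ - P.node j.castSucc)
    (Set.finite_range _).bddAbove j

theorem h_nonneg : 0 ≤ P.h := Real.iSup_nonneg fun j => (sub_pos.2 (P.castSucc_lt j)).le

/-- The case `x = 0` is the base of the induction over the nodes; it spares a proof that the mesh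
has an element. -/
theorem eq_zero_or_exists_mem {x : ℝ} (hx : x ∈ Icc (0 : ℝ) 1) :
    x = 0 ∨ ∃ j : Fin P.N, x ∈ Icc (P.node j.castSucc) (P.node j.succ) := by
  have key : ∀ i : Fin (P.N + 1), x ≤ P.node i →
      x = 0 ∨ ∃ j : Fin P.N, x ∈ Icc (P.node j.castSucc) (P.node j.succ) := by
    intro i
    induction i using Fin.induction with
    | zero =>
      intro h
      rw [P.node_zero] at h
      exact Or.inl (le_antisymm h hx.1)
    | succ i ih =>
      intro h
      rcases le_total x (P.node i.castSucc) with h' | h'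
      · exact ih h'
      · exact Or.inr ⟨i, h', h⟩
  exact key (Fin.last _) (by rw [P.node_last]; exact hx.2)

/-- The nodal interpolation operator. -/
def interp : H1 →L[ℝ] H1 :=
  (valL 0 zero_mem_I).smulRight H1.one
    + ∑ j : Fin P.N, ((P.node j.succ - P.node j.castSucc)⁻¹ •
      (valL (P.node j.succ) (P.node_mem _) - valL (P.node j.castSucc) (P.node_mem _))).smulRight
        (ramp (P.node j.castSucc) (P.node j.succ))

/-- The slope of the nodal interpolant of `u` on the element `j`. -/
def slope (u : H1) (j : Fin P.N) : ℝ :=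
  (P.node j.succ - P.node j.castSucc)⁻¹ * (u.val (P.node j.succ) - u.val (P.node j.castSucc))

theorem interp_eq (u : H1) : P.interp u = u.val 0 • H1.one
    + ∑ j : Fin P.N, P.slope u j • ramp (P.node j.castSucc) (P.node j.succ) := by
  rw [interp, add_apply, ContinuousLinearMap.smulRight_apply, valL_apply,
    sum_apply]
  rfl

theorem interp_val (u : H1) {x : ℝ} (hx : x ∈ Icc (0 : ℝ) 1) : (P.interp u).val x = u.val 0
    + ∑ j : Fin P.N, P.slope u j * (min x (P.node j.succ) - min x (P.node j.castSucc)) := by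
  rw [← valL_apply hx, interp_eq, map_add, map_sum, map_smul, valL_apply, H1.one_val hx]
  congr 1
  · simp
  · refine Finset.sum_congr rfl fun j _ => ?_
    rw [map_smul, valL_apply, ramp_val (P.node_mem _).1 (P.castSucc_lt j).le hx, smul_eq_mul]

/-- Over the element `k` the ramps of all other elements are constant. -/
theorem interp_val_of_mem (u : H1) {k : Fin P.N} {x : ℝ}
    (hx : x ∈ Icc (P.node k.castSucc) (P.node k.succ)) :
    (P.interp u).val x = (P.interp u).val (P.node k.castSucc)
      + P.slope u k * (x - P.node k.castSucc) := by
  rw [P.interp_val u (P.mem_of_mem_elem hx), P.interp_val u (P.node_mem _), add_assoc]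
  congr 1
  rw [← sub_eq_iff_eq_add', ← Finset.sum_sub_distrib, Finset.sum_eq_single k]
  · rw [min_eq_left hx.2, min_eq_right hx.1, min_eq_left (P.castSucc_lt k).le, min_self]
    ring
  · intro j _ hj
    rcases lt_or_gt_of_ne hj with h | h
    · have h1 : P.node j.succ ≤ P.node k.castSucc :=
        P.strictMono.monotone (Fin.le_def.2 (by simpa using h))
      have h2 := (P.castSucc_lt j).le
      rw [min_eq_right h1, min_eq_right (h2.trans h1), min_eq_right (h1.trans hx.1),
        min_eq_right (h2.trans (h1.trans hx.1))]
      ring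
    · have h1 : P.node k.succ ≤ P.node j.castSucc :=
        P.strictMono.monotone (Fin.le_def.2 (by simpa using h))
      have h2 := (P.castSucc_lt j).le
      have h3 := hx.2.trans h1
      have h4 := (P.castSucc_lt k).le.trans h1
      rw [min_eq_left h3, min_eq_left (h3.trans h2), min_eq_left h4, min_eq_left (h4.trans h2)]
      ring
  · simp

theorem interp_mem (u : H1) : P.interp u ∈ P.V := fun k =>
  ⟨(P.interp u).val (P.node k.castSucc) - P.slope u k * P.node k.castSucc, P.slope u k,
    fun x hx => by rw [P.interp_val_of_mem u hx]; ring⟩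

theorem interp_node (u : H1) (i : Fin (P.N + 1)) :
    (P.interp u).val (P.node i) = u.val (P.node i) := by
  induction i using Fin.induction with
  | zero =>
    rw [P.node_zero, P.interp_val u zero_mem_I, add_eq_left]
    refine Finset.sum_eq_zero fun j _ => ?_
    rw [min_eq_left (P.node_mem _).1, min_eq_left (P.node_mem _).1, sub_self, mul_zero]
  | succ k ih =>
    have h := P.castSucc_lt k
    rw [P.interp_val_of_mem u (k := k) ⟨h.le, le_rfl⟩, ih, slope]
    have : P.node k.succ - P.node k.castSucc ≠ 0 := (sub_pos.2 h).ne'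
    field_simp
    ring

/-- The error of nodal interpolation. -/
def err : H1 →L[ℝ] H1 := ContinuousLinearMap.id ℝ H1 - P.interp

theorem err_apply (u : H1) : P.err u = u - P.interp u := rfl

theorem err_node (u : H1) (i : Fin (P.N + 1)) : (P.err u).val (P.node i) = 0 := by
  rw [err_apply, H1.val_sub _ _ (P.node_mem i), interp_node, sub_self]

theorem err_zero (u : H1) : (P.err u).val 0 = 0 := by
  have := P.err_node u 0
  rwa [P.node_zero] at this

theorem err_one (u : H1) : (P.err u).val 1 = 0 := by
  have := P.err_node u (Fin.last _)
  rwa [P.node_last] at this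

theorem interp_of_mem {χ : H1} (hχ : χ ∈ P.V) : P.interp χ = χ := by
  refine H1.ext_val fun x hx => ?_
  rcases P.eq_zero_or_exists_mem hx with rfl | ⟨j, hj⟩
  · have := P.interp_node χ 0
    rwa [P.node_zero] at this
  · obtain ⟨a, b, h⟩ := hχ j
    have hlt := P.castSucc_lt j
    rw [P.interp_val_of_mem χ hj, P.interp_node, h x hj, slope, h _ ⟨le_rfl, hlt.le⟩,
      h _ ⟨hlt.le, le_rfl⟩]
    have : P.node j.succ - P.node j.castSucc ≠ 0 := (sub_pos.2 hlt).ne'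
    field_simp
    ring

/-- `V_h` is the fixed point set of the bounded operator `interp`. -/
theorem isClosed_V : IsClosed (P.V : Set H1) := by
  have : (P.V : Set H1) = {u | P.interp u = u} :=
    Set.ext fun u => ⟨fun h => P.interp_of_mem h, fun h => by
      rw [SetLike.mem_coe, ← show P.interp u = u from h]; exact P.interp_mem u⟩
  rw [this]
  exact isClosed_eq P.interp.continuous continuous_id

/-- Write `χ` as a constant plus ramps over the elements: each ramp pairs with `v_x` to a difference
of nodal values of `v`. Hence interpolation is the orthogonal projection in the `H¹` seminorm, which
makes it a substitute for the elliptic projection. -/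
theorem inner_dx_eq_zero {v χ : H1} (hv : ∀ i, v.val (P.node i) = 0) (hχ : χ ∈ P.V) :
    inner ℝ v.dx χ.dx = 0 := by
  have h1 : inner ℝ v.dx χ.dx = innerB L2 v.dx (dxL (P.interp χ)) := by
    rw [P.interp_of_mem hχ]; rfl
  rw [h1, interp_eq, map_add, map_add, map_sum, map_sum, map_smul, map_smul]
  have h2 : dxL H1.one = 0 := rfl
  rw [h2, map_zero, smul_zero, zero_add]
  refine Finset.sum_eq_zero fun j _ => ?_
  rw [map_smul, map_smul, innerB_apply, dxL_apply, inner_dx_ramp v (P.node_mem _).1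
    (P.castSucc_lt j).le (P.node_mem _).2, hv, hv]
  simp

/-- Poincaré's inequality on each element, where `v` vanishes at the left node, summed by induction
over the nodes. -/
theorem norm_fn_le_of_node {v : H1} (hv : ∀ i, v.val (P.node i) = 0) :
    ‖v.fn‖ ≤ P.h * ‖v.dx‖ := by
  have hi1 : ∀ {a b : ℝ}, a ∈ Icc (0 : ℝ) 1 → b ∈ Icc (0 : ℝ) 1 →
      IntervalIntegrable (fun x => v.val x ^ 2) volume a b := fun ha hb =>
    intervalIntegrable_volI (memLp_val v 2).integrable_sq ha hb
  have hi2 : ∀ {a b : ℝ}, a ∈ Icc (0 : ℝ) 1 → b ∈ Icc (0 : ℝ) 1 →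
      IntervalIntegrable (fun x => v.dx x ^ 2) volume a b := fun ha hb =>
    intervalIntegrable_volI (L2.integrable_sq v.dx) ha hb
  have key : ∀ i : Fin (P.N + 1), ∫ x in (0 : ℝ)..P.node i, v.val x ^ 2
      ≤ P.h ^ 2 * ∫ x in (0 : ℝ)..P.node i, v.dx x ^ 2 := by
    intro i
    induction i using Fin.induction with
    | zero => simp [P.node_zero]
    | succ k ih =>
      have hl := P.node_mem k.castSucc
      have hr := P.node_mem k.succ
      have hlt := P.castSucc_lt k
      rw [← intervalIntegral.integral_add_adjacent_intervals (hi1 zero_mem_I hl) (hi1 hl hr),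
        ← intervalIntegral.integral_add_adjacent_intervals (hi2 zero_mem_I hl) (hi2 hl hr), mul_add]
      refine add_le_add ih ?_
      set A := ∫ x in P.node k.castSucc..P.node k.succ, v.dx x ^ 2 with hA
      have hA0 : 0 ≤ A := intervalIntegral.integral_nonneg hlt.le fun _ _ => sq_nonneg _
      have hb : ∀ x ∈ Icc (P.node k.castSucc) (P.node k.succ), v.val x ^ 2 ≤ P.h * A := by
        intro x hx
        have hxI := P.mem_of_mem_elem hx
        have h1 := v.val_sub' hl hxI
        rw [hv, sub_zero] at h1
        rw [h1]
        refine (sq_intervalIntegral_le hx.1 (intervalIntegrable_volI (integrable_L2 _) hl hxI)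
          (hi2 hl hxI)).trans (mul_le_mul ?_ ?_
          (intervalIntegral.integral_nonneg hx.1 fun _ _ => sq_nonneg _) P.h_nonneg)
        · linarith [P.gap_le_h k, hx.2]
        · exact intervalIntegral.integral_mono_interval le_rfl hx.1 hx.2
            (Eventually.of_forall fun _ => sq_nonneg _) (hi2 hl hr)
      calc _ ≤ ∫ _ in P.node k.castSucc..P.node k.succ, P.h * A :=
            intervalIntegral.integral_mono_on hlt.le (hi1 hl hr) (by simp) hb
        _ = (P.node k.succ - P.node k.castSucc) * (P.h * A) := by
          rw [intervalIntegral.integral_const, smul_eq_mul]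
        _ ≤ P.h * (P.h * A) :=
            mul_le_mul_of_nonneg_right (P.gap_le_h k) (mul_nonneg P.h_nonneg hA0)
        _ = _ := by ring
  have := key (Fin.last _)
  rw [P.node_last, intervalIntegral_volI, intervalIntegral_volI, ← v.norm_fn_sq,
    ← L2.norm_sq_eq, ← mul_pow] at this
  exact abs_le_of_sq_le_sq' this (mul_nonneg P.h_nonneg (norm_nonneg _)) |>.2

/-- `L²` error of interpolation, for functions whose second derivative is at most `M` in `L²`. -/
theorem norm_err_le {y : H1} {M : ℝ} (hM : 0 ≤ M)
    (h : ∀ χ : H1, χ.val 0 = 0 → χ.val 1 = 0 → |inner ℝ y.dx χ.dx| ≤ M * ‖χ.fn‖) :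
    ‖(P.err y).fn‖ ≤ P.h ^ 2 * M := by
  set e := P.err y with he
  have hn : ∀ i, e.val (P.node i) = 0 := P.err_node y
  -- By orthogonality `‖e_x‖² = (y_x, e_x) ≤ M ‖e‖ ≤ M h ‖e_x‖`. Only the duality bound on `y`
  -- enters, so `y` need not be known to lie in `H²`.
  have h1 : ‖e.dx‖ * ‖e.dx‖ = inner ℝ y.dx e.dx := by
    have h2 : e.dx = y.dx - (P.interp y).dx := rfl
    have h3 := P.inner_dx_eq_zero hn (P.interp_mem y)
    rw [real_inner_comm] at h3
    rw [← real_inner_self_eq_norm_mul_norm]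
    nth_rewrite 1 [h2]
    rw [inner_sub_left, h3, sub_zero]
  have h4 := (le_abs_self _).trans (h e (P.err_zero y) (P.err_one y))
  have h5 := P.norm_fn_le_of_node hn
  have h6 : ‖e.dx‖ ≤ M * P.h := by
    rcases (norm_nonneg e.dx).eq_or_lt with h0 | h0
    · rw [← h0]; exact mul_nonneg hM P.h_nonneg
    · refine le_of_mul_le_mul_right ?_ h0
      nlinarith
  calc _ ≤ _ := h5
    _ ≤ P.h * (M * P.h) := mul_le_mul_of_nonneg_left h6 P.h_nonneg
    _ = _ := by ring

/-- Pointwise error of interpolation, for functions whose second derivative is at most `M`. -/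
theorem abs_err_le {y : H1} {M : ℝ} (hM : 0 ≤ M)
    (h : ∀ χ : H1, χ.val 0 = 0 → χ.val 1 = 0 →
      |inner ℝ y.dx χ.dx| ≤ M * ∫ x, |χ.val x| ∂volI) {x : ℝ} (hx : x ∈ Icc (0 : ℝ) 1) :
    |(P.err y).val x| ≤ P.h ^ 2 * M := by
  rcases P.eq_zero_or_exists_mem hx with rfl | ⟨j, hj⟩
  · rw [P.err_zero, abs_zero]; exact mul_nonneg (sq_nonneg _) hM
  have hl := P.node_mem j.castSucc
  have hr := P.node_mem j.succ
  have hlt := P.castSucc_lt j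
  have hgap := P.gap_le_h j
  have hval : (P.err y).val x = y.val x - (y.val (P.node j.castSucc)
      + P.slope y j * (x - P.node j.castSucc)) := by
    rw [err_apply, H1.val_sub _ _ hx, P.interp_val_of_mem y hj, P.interp_node]
  rw [slope] at hval
  set a := P.node j.castSucc with ha
  set b := P.node j.succ with hb
  have hba : 0 < b - a := sub_pos.2 hlt
  set s := (b - a)⁻¹ * (x - a) with hs
  have hs0 : 0 ≤ s := mul_nonneg (inv_nonneg.2 hba.le) (sub_nonneg.2 hj.1)
  have hsx : s * (b - a) = x - a := by rw [hs]; field_simp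
  have hs1 : s ≤ 1 := by
    by_contra hn
    nlinarith [hj.2]
  -- The Green's function of the element with pole `x`: slope `1 - s` on `[a,x]`, slope `-s` on
  -- `[x,b]`, zero outside. Its pairing with `y_x` is `y(x) - (1 - s) y(a) - s y(b)`, the
  -- interpolation error at `x`.
  set G : H1 := (1 - s) • ramp a x - s • ramp x b with hG
  have hG1 : inner ℝ y.dx G.dx = (P.err y).val x := by
    rw [hG, H1.dx_sub, H1.dx_smul, H1.dx_smul, inner_sub_right, inner_smul_right, inner_smul_right,
      inner_dx_ramp y hl.1 hj.1 hx.2, inner_dx_ramp y hx.1 hj.2 hr.2, hval, hs]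
    ring
  have hGv : ∀ z ∈ Icc (0 : ℝ) 1, G.val z
      = (1 - s) * (min z x - min z a) - s * (min z b - min z x) := by
    intro z hz
    rw [hG, H1.val_sub _ _ hz, H1.val_smul _ _ hz, H1.val_smul _ _ hz,
      ramp_val hl.1 hj.1 hz, ramp_val hx.1 hj.2 hz]
  have hGleft : ∀ z ∈ Icc (0 : ℝ) 1, z ≤ a → G.val z = 0 := by
    intro z hz hza
    rw [hGv z hz, min_eq_left hza, min_eq_left (hza.trans hj.1), min_eq_left (hza.trans hlt.le)]
    ring
  have hGright : ∀ z ∈ Icc (0 : ℝ) 1, b ≤ z → G.val z = 0 := by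
    intro z hz hza
    rw [hGv z hz, min_eq_right hza, min_eq_right (hj.2.trans hza), min_eq_right (hlt.le.trans hza)]
    linarith
  have hGb : ∀ z ∈ Icc (0 : ℝ) 1, |G.val z| ≤ (Ioc a b).indicator (fun _ => b - a) z := by
    intro z hz
    by_cases hzI : z ∈ Ioc a b
    · rw [indicator_of_mem hzI, hGv z hz, min_eq_right hzI.1.le, min_eq_left hzI.2]
      rcases le_total z x with hzx | hzx
      · rw [min_eq_left hzx, abs_le]
        constructor <;> nlinarith [hzI.1, hzI.2]
      · rw [min_eq_right hzx, abs_le]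
        constructor <;> nlinarith [hzI.1, hzI.2, hj.1]
    · rw [indicator_of_notMem hzI]
      rw [mem_Ioc, not_and_or, not_lt, not_le] at hzI
      rcases hzI with hz' | hz'
      · rw [hGleft z hz hz', abs_zero]
      · rw [hGright z hz hz'.le, abs_zero]
  have hint : ∫ z, |G.val z| ∂volI ≤ (b - a) * (b - a) := by
    have h1 : ∫ z, |G.val z| ∂volI ≤ ∫ z, (Ioc a b).indicator (fun _ => b - a) z ∂volI := by
      refine integral_mono_ae ((memLp_val G 2).integrable (by norm_num)).abs
        ((integrable_const _).indicator measurableSet_Ioc) ?_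
      filter_upwards [ae_restrict_mem measurableSet_Ioo] with z hz
      exact hGb z (Ioo_subset_Icc_self hz)
    refine h1.trans ?_
    rw [integral_indicator_const _ measurableSet_Ioc, smul_eq_mul]
    refine mul_le_mul_of_nonneg_right ?_ hba.le
    rw [Measure.real]
    refine ENNReal.toReal_le_of_le_ofReal hba.le ?_
    rw [← Real.volume_Ioc]
    exact Measure.restrict_apply_le _ _
  rw [← hG1]
  refine (h G (hGleft 0 zero_mem_I hl.1) (hGright 1 one_mem_I hr.2)).trans ?_
  rw [mul_comm]
  refine mul_le_mul_of_nonneg_right (hint.trans ?_) hM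
  nlinarith

end Mesh

/-! ### Consistency: the interpolation error along a solution -/

/-- Decay for `μ z' + ν z = g` with decaying `g`. -/
theorem norm_le_of_ode {E : Type*} [NormedAddCommGroup E] [NormedSpace ℝ E] {z z' : ℝ → E}
    {μ ν β A : ℝ} (hμ : 0 < μ) (hν : 0 < ν) (hβ : 2 * β * μ ≤ ν) (hA : 0 ≤ A)
    (hz : ∀ t, HasDerivAt z (z' t) t)
    (h : ∀ t, 0 ≤ t → ‖μ • z' t + ν • z t‖ ≤ A * Real.exp (-β * t)) {t : ℝ} (ht : 0 ≤ t) :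
    ‖z t‖ ≤ (‖z 0‖ + 2 * A / ν) * Real.exp (-β * t) := by
  set κ := ν / μ with hκ
  -- The relaxation rate `κ` exceeds the decay rate `β` by at least `κ / 2`; this is the source of
  -- the 2 in `2 * A / ν`.
  have hκβ : κ / 2 ≤ κ - β := by
    have : 2 * β ≤ κ := by rw [hκ, le_div_iff₀ hμ]; exact hβ
    linarith
  have hexp : ∀ (c s : ℝ), HasDerivAt (fun s => Real.exp (c * s)) (Real.exp (c * s) * c) s :=
    fun c s => by simpa using ((hasDerivAt_id s).const_mul c).exp
  have hφ : ∀ s, HasDerivAt (fun s => Real.exp (κ * s) • z s)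
      (Real.exp (κ * s) • z' s + (Real.exp (κ * s) * κ) • z s) s := fun s =>
    (hexp κ s).smul (hz s)
  set K := ‖z 0‖ + 2 * A / ν with hK
  have hB : ∀ s, HasDerivAt (fun s => K * Real.exp ((κ - β) * s))
      (K * (Real.exp ((κ - β) * s) * (κ - β))) s := fun s => (hexp _ s).const_mul K
  -- The function `e^{κs} z(s)` has derivative `e^{κs} (μ z' + ν z) / μ` and is compared with `K
  -- e^{(κ-β)s}`.
  have hmain := image_norm_le_of_norm_deriv_right_le_deriv_boundary (a := 0) (b := t)
    (fun s _ => (hφ s).continuousAt.continuousWithinAt)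
    (fun s _ => (hφ s).hasDerivWithinAt) (B := fun s => K * Real.exp ((κ - β) * s)) (by
      simp only [mul_zero, Real.exp_zero, one_smul, mul_one, hK]
      have : 0 ≤ 2 * A / ν := by positivity
      linarith) (fun s => hB s) (fun s hs => ?_) ⟨ht, le_rfl⟩
  · rw [norm_smul, Real.norm_eq_abs, abs_of_pos (Real.exp_pos _)] at hmain
    refine le_of_mul_le_mul_left (hmain.trans (le_of_eq ?_)) (Real.exp_pos (κ * t))
    rw [← mul_assoc, mul_comm (Real.exp (κ * t)), mul_assoc, ← Real.exp_add]
    ring_nf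
  · have h1 : Real.exp (κ * s) • z' s + (Real.exp (κ * s) * κ) • z s
        = (Real.exp (κ * s) / μ) • (μ • z' s + ν • z s) := by
      rw [smul_add, smul_smul, smul_smul, div_mul_cancel₀ _ hμ.ne', hκ]
      congr 2
      ring
    rw [h1, norm_smul, Real.norm_eq_abs, abs_of_pos (div_pos (Real.exp_pos _) hμ)]
    have h2 : Real.exp ((κ - β) * s) = Real.exp (κ * s) * Real.exp (-β * s) := by
      rw [← Real.exp_add]; ring_nf
    have h3 : A / μ ≤ K * (κ - β) := by
      have : A / μ = 2 * A / ν * (κ / 2) := by rw [hκ]; field_simp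
      rw [this, hK]
      have : 0 ≤ 2 * A / ν := by positivity
      have hκ0 : 0 < κ := div_pos hν hμ
      exact mul_le_mul (by linarith [norm_nonneg (z 0)]) hκβ (by positivity) (by positivity)
    calc _ ≤ Real.exp (κ * s) / μ * (A * Real.exp (-β * s)) :=
          mul_le_mul_of_nonneg_left (h s hs.1) (by positivity)
      _ = A / μ * (Real.exp (κ * s) * Real.exp (-β * s)) := by ring
      _ ≤ K * (κ - β) * (Real.exp (κ * s) * Real.exp (-β * s)) :=
          mul_le_mul_of_nonneg_right h3 (by positivity)
      _ = _ := by rw [h2]; ring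

/-- The lower order terms `u_t + (1+w_d) u_x + u u_x`. -/
def Params.force (p : Params) (u d : H1) : L2 := d.fn + (1 + p.wd) • u.dx + mulL u u.dx

/-- The derivative of the test function meets only `μ w_t + ν w`, so this is the combination whose
second derivative the equation controls. -/
theorem Params.weakForm_eq_force (p : Params) (u d χ : H1) : p.weakForm u d χ
    = inner ℝ (p.force u d) χ.fn + inner ℝ (p.μ • d + p.ν • u).dx χ.dx
    + (p.μ / p.ν * ((p.c₀ + 1 + p.wd) * d.val 0 + 2 / (3 * p.c₀) * u.val 0 ^ 2 * d.val 0)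
        + ((p.c₀ + 1 + p.wd) * u.val 0 + 2 / (9 * p.c₀) * u.val 0 ^ 3)) * χ.val 0
    + (p.μ / p.ν * ((p.c₁ + 1 + p.wd) * d.val 1 + 2 / (3 * p.c₁) * u.val 1 ^ 2 * d.val 1)
        + ((p.c₁ + 1 + p.wd) * u.val 1 + 2 / (9 * p.c₁) * u.val 1 ^ 3)) * χ.val 1 := by
  rw [weakForm, integral_conv, force, H1.dx_add, H1.dx_smul, H1.dx_smul, inner_add_left,
    inner_add_left, inner_add_left, inner_smul_left, inner_smul_left, inner_smul_left]
  simp only [conj_trivial]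
  ring

theorem Params.norm_force_le (p : Params) (hp : p.Pos) (u d : H1) :
    ‖p.force u d‖ ≤ ‖d‖ + (1 + p.wd) * ‖u‖ + 2 * ‖u‖ * ‖u‖ := by
  have hwd := hp.wd
  refine (norm_add_le _ _).trans (add_le_add ((norm_add_le _ _).trans
    (add_le_add d.norm_fn_le ?_)) ?_)
  · rw [norm_smul, Real.norm_eq_abs, abs_of_nonneg (by linarith)]
    exact mul_le_mul_of_nonneg_left u.norm_dx_le (by linarith)
  · exact (norm_mulL_le u u.dx fun x hx => u.abs_val_le hx).trans
      (mul_le_mul_of_nonneg_left u.norm_dx_le (by positivity))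

/-- The weak form of `(μ w_t + ν w)_xx = force`, free of boundary terms. It replaces a proof of
spatial regularity. -/
theorem Params.IsC1Sol.inner_dx_eq {p : Params} {w D : ℝ → H1} (h : p.IsC1Sol ⊤ w D)
    {t : ℝ} (ht : 0 ≤ t) {χ : H1} (h0 : χ.val 0 = 0) (h1 : χ.val 1 = 0) :
    inner ℝ (p.μ • D t + p.ν • w t).dx χ.dx = -inner ℝ (p.force (w t) (D t)) χ.fn := by
  have := h.eq t ht χ trivial
  rw [p.weakForm_eq_force, h0, h1] at this
  linarith

theorem IsH2.exists_inner_dx_eq {u : H1} (hu : IsH2 u) : ∃ v : H1, v.fn = u.dx ∧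
    ∀ χ : H1, χ.val 0 = 0 → χ.val 1 = 0 → inner ℝ u.dx χ.dx = -inner ℝ v.dx χ.fn := by
  obtain ⟨v, hv⟩ := hu
  refine ⟨v, hv, fun χ h0 h1 => ?_⟩
  have := v.inner_dx_fn_add χ
  rw [h0, h1, hv, real_inner_comm (u.dx)] at this
  linarith

theorem hasDerivAt_err_fn {w D : ℝ → H1} (h : ∀ t, HasDerivAt w (D t) t) (P : Mesh) (t : ℝ) :
    HasDerivAt (fun s => (P.err (w s)).fn) (P.err (D t)).fn t :=
  (fnL.comp P.err).hasFDerivAt.comp_hasDerivAt t (h t)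

/-- The interpolation error of the solution and of its time derivative, in `L²`. -/
theorem Params.exists_norm_err_le {p : Params} (hp : p.Pos) {β : ℝ} (hβ : p.Rate β) {w₀ : H1}
    (hw₀ : IsH2 w₀) :
    ∃ C, 0 < C ∧ ∀ (w D : ℝ → H1), p.IsC1Sol ⊤ w D → w 0 = w₀ → ∀ (P : Mesh) (t : ℝ), 0 ≤ t →
      ‖(P.err (w t)).fn‖ ≤ C * (P.h ^ 2 * Real.exp (-β * t)) ∧
      ‖(P.err (D t)).fn‖ ≤ C * (P.h ^ 2 * Real.exp (-β * t)) := by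
  obtain ⟨C, hC, hdec⟩ := Params.exists_decay hp hβ ‖w₀‖
  obtain ⟨v, -, hv⟩ := hw₀.exists_inner_dx_eq
  have hp' := hp
  obtain ⟨hμ, hν, hwd, -, -⟩ := hp'
  set A := C + (1 + p.wd) * C + 2 * C * C with hA
  have hA0 : 0 ≤ A := by positivity
  set K := ‖v.dx‖ + 2 * A / p.ν with hK
  have hK0 : 0 ≤ K := by positivity
  refine ⟨K + (A + p.ν * K) / p.μ + 1, by positivity, fun w D h h0 P t ht => ?_⟩
  -- Interpolation commutes with the time derivative, so this estimate is an ODE in time for the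
  -- interpolation error of `w`.
  have herr : ∀ s, 0 ≤ s → ‖p.μ • (P.err (D s)).fn + p.ν • (P.err (w s)).fn‖
      ≤ P.h ^ 2 * A * Real.exp (-β * s) := by
    intro s hs
    have h1 : p.μ • (P.err (D s)).fn + p.ν • (P.err (w s)).fn
        = (P.err (p.μ • D s + p.ν • w s)).fn := by
      rw [map_add, map_smul, map_smul]; rfl
    obtain ⟨d1, d2⟩ := hdec ⊤ w D h (by rw [h0]) s hs
    rw [h1, mul_assoc]
    have he1 : Real.exp (-β * s) ≤ 1 := by
      rw [Real.exp_le_one_iff]; nlinarith [hβ.nonneg]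
    refine P.norm_err_le (by positivity) fun χ c0 c1 => ?_
    rw [h.inner_dx_eq hs c0 c1, abs_neg]
    refine (abs_real_inner_le_norm _ _).trans (mul_le_mul_of_nonneg_right
      ((p.norm_force_le hp _ _).trans ?_) (norm_nonneg _))
    have hwC : ‖w s‖ ≤ C := d1.trans (by nlinarith)
    calc ‖D s‖ + (1 + p.wd) * ‖w s‖ + 2 * ‖w s‖ * ‖w s‖
        ≤ C * Real.exp (-β * s) + (1 + p.wd) * (C * Real.exp (-β * s))
          + 2 * C * (C * Real.exp (-β * s)) := by gcongr
      _ = _ := by rw [hA]; ring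
  have hinit : ‖(P.err (w 0)).fn‖ ≤ P.h ^ 2 * ‖v.dx‖ := by
    rw [h0]
    refine P.norm_err_le (norm_nonneg _) fun χ c0 c1 => ?_
    rw [hv χ c0 c1, abs_neg]
    exact abs_real_inner_le_norm _ _
  have e0 := Real.exp_pos (-β * t)
  have e1 : ‖(P.err (w t)).fn‖ ≤ K * (P.h ^ 2 * Real.exp (-β * t)) := by
    refine (norm_le_of_ode hμ hν hβ.ode (by positivity)
      (fun s => hasDerivAt_err_fn h.hasDerivAt P s) herr ht).trans ?_
    rw [← mul_assoc K]
    refine mul_le_mul_of_nonneg_right ?_ e0.le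
    rw [hK, add_mul]
    refine add_le_add (by linarith) (le_of_eq ?_)
    ring
  -- The bound for the time derivative is read off the ODE, without differentiating it.
  have e2 : ‖(P.err (D t)).fn‖ ≤ (A + p.ν * K) / p.μ * (P.h ^ 2 * Real.exp (-β * t)) := by
    have h1 : p.μ • (P.err (D t)).fn = (p.μ • (P.err (D t)).fn + p.ν • (P.err (w t)).fn)
        - p.ν • (P.err (w t)).fn := by abel
    have h2 : p.μ * ‖(P.err (D t)).fn‖ ≤ P.h ^ 2 * A * Real.exp (-β * t)
        + p.ν * (K * (P.h ^ 2 * Real.exp (-β * t))) := by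
      calc p.μ * ‖(P.err (D t)).fn‖ = ‖p.μ • (P.err (D t)).fn‖ := by
            rw [norm_smul, Real.norm_eq_abs, abs_of_pos hμ]
        _ ≤ _ := by
          rw [h1]
          refine (norm_sub_le _ _).trans (add_le_add (herr t ht) ?_)
          rw [norm_smul, Real.norm_eq_abs, abs_of_pos hν]
          exact mul_le_mul_of_nonneg_left e1 hν.le
    rw [div_mul_eq_mul_div, le_div_iff₀ hμ]
    linarith
  have hq : 0 ≤ P.h ^ 2 * Real.exp (-β * t) := by positivity
  have hr : 0 ≤ (A + p.ν * K) / p.μ := by positivity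
  constructor <;> nlinarith

/-! ### The initial value -/

namespace Mesh

variable {P : Mesh} {lam : ℝ} {w₀ v : H1}

theorem min_mul_norm_sq_le (lam : ℝ) (u : H1) :
    min 1 lam * ‖u‖ ^ 2 ≤ ‖u.dx‖ ^ 2 + lam * ‖u.fn‖ ^ 2 := by
  rw [u.norm_sq]
  nlinarith [mul_le_mul_of_nonneg_right (min_le_left 1 lam) (sq_nonneg ‖u.dx‖),
    mul_le_mul_of_nonneg_right (min_le_right 1 lam) (sq_nonneg ‖u.fn‖)]

/-- Test with `v`. The bound is free of the partition, so the decay constants of the semidiscrete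
solutions are as well. -/
theorem IsProjection.norm_le (h : P.IsProjection lam w₀ v) (hlam : 0 < lam) :
    ‖v‖ ≤ (1 + lam) / min 1 lam * ‖w₀‖ := by
  have h1 := h.2 v h.1
  rw [inner_sub_left, inner_sub_left, real_inner_self_eq_norm_sq, real_inner_self_eq_norm_sq] at h1
  have h2 := min_mul_norm_sq_le lam v
  have h3 : inner ℝ w₀.dx v.dx ≤ ‖w₀‖ * ‖v‖ :=
    (real_inner_le_norm _ _).trans (mul_le_mul w₀.norm_dx_le v.norm_dx_le (norm_nonneg _)
      (norm_nonneg _))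
  have h4 : inner ℝ w₀.fn v.fn ≤ ‖w₀‖ * ‖v‖ :=
    (real_inner_le_norm _ _).trans (mul_le_mul w₀.norm_fn_le v.norm_fn_le (norm_nonneg _)
      (norm_nonneg _))
  have h5 := mul_le_mul_of_nonneg_left h4 hlam.le
  have hm : 0 < min 1 lam := lt_min one_pos hlam
  rw [div_mul_eq_mul_div, le_div_iff₀ hm]
  rcases (norm_nonneg v).eq_or_lt with h0 | h0
  · rw [← h0, zero_mul]; positivity
  · refine le_of_mul_le_mul_right ?_ h0
    linarith

/-- Test with the difference itself: orthogonality removes the gradient of the interpolation error.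
Initially the two discrete functions are therefore `O(h²)` close in `H¹`. -/
theorem IsProjection.norm_sub_interp_le (h : P.IsProjection lam w₀ v) (hlam : 0 < lam) :
    ‖v - P.interp w₀‖ ≤ lam / min 1 lam * ‖(P.err w₀).fn‖ := by
  set θ := v - P.interp w₀ with hθ
  have hm : θ ∈ P.V := P.V.sub_mem h.1 (P.interp_mem _)
  have h1 := h.2 θ hm
  have e1 : w₀.dx - v.dx = (P.err w₀).dx - θ.dx := by
    rw [hθ, Mesh.err_apply, H1.dx_sub, H1.dx_sub]; abel
  have e2 : w₀.fn - v.fn = (P.err w₀).fn - θ.fn := by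
    rw [hθ, Mesh.err_apply, H1.fn_sub, H1.fn_sub]; abel
  rw [e1, e2, inner_sub_left, inner_sub_left, real_inner_self_eq_norm_sq,
    real_inner_self_eq_norm_sq, P.inner_dx_eq_zero (P.err_node w₀) hm] at h1
  have h2 := min_mul_norm_sq_le lam θ
  have h4 : inner ℝ (P.err w₀).fn θ.fn ≤ ‖(P.err w₀).fn‖ * ‖θ‖ :=
    (real_inner_le_norm _ _).trans (mul_le_mul_of_nonneg_left θ.norm_fn_le (norm_nonneg _))
  have h5 := mul_le_mul_of_nonneg_left h4 hlam.le
  have hmm : 0 < min 1 lam := lt_min one_pos hlam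
  rw [div_mul_eq_mul_div, le_div_iff₀ hmm]
  rcases (norm_nonneg θ).eq_or_lt with h0 | h0
  · rw [← h0, zero_mul]; positivity
  · refine le_of_mul_le_mul_right ?_ h0
    linarith

end Mesh

/-! ### Stability: the difference of the semidiscrete solution and the interpolant -/

/-- Integration by parts moves the derivative from `v² - w²` to `θ`. Only the `L²` norm of `v - w`
is then needed; in `H¹` the interpolation error would cost a power of `h`. -/
theorem conv_sub_conv (v w θ : H1) :
    inner ℝ (mulL v v.dx) θ.fn - inner ℝ (mulL w w.dx) θ.fn
      = ((v.val 1 ^ 2 - w.val 1 ^ 2) * θ.val 1 - (v.val 0 ^ 2 - w.val 0 ^ 2) * θ.val 0) / 2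
        - inner ℝ (mulL (v + w) θ.dx) (v - w).fn / 2 := by
  have h1 := H1.integral_triple v v θ
  have h2 := H1.integral_triple w w θ
  have h3 : inner ℝ (mulL (v + w) θ.dx) (v - w).fn
      = ∫ x, θ.dx x * v.val x * v.val x ∂volI - ∫ x, θ.dx x * w.val x * w.val x ∂volI := by
    rw [inner_mulL, ← integral_sub (H1.integrable_dx_mul _ _ _) (H1.integrable_dx_mul _ _ _)]
    refine integral_congr_ae ?_
    filter_upwards [ae_restrict_mem measurableSet_Ioo] with x hx
    rw [H1.val_add _ _ (Ioo_subset_Icc_self hx), H1.val_sub _ _ (Ioo_subset_Icc_self hx)]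
    ring
  rw [h3, inner_mulL, inner_mulL]
  linarith

/-- The energy of the error: a quadratic form in `θ` with coefficients depending on the state `v`. -/
def Params.errorEnergy (p : Params) (v θ : H1) : ℝ :=
  ‖θ.fn‖ ^ 2 + p.μ * ‖θ.dx‖ ^ 2
    + p.μ / p.ν * ((p.c₀ + 1 + p.wd) * θ.val 0 ^ 2 + 2 / (3 * p.c₀) * (v.val 0 * θ.val 0) ^ 2
      + ((p.c₁ + 1 + p.wd) * θ.val 1 ^ 2 + 2 / (3 * p.c₁) * (v.val 1 * θ.val 1) ^ 2))

/-- The time derivative of `errorEnergy`, if `e` and `ϑ` are the time derivatives of `v` and `θ`. -/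
def Params.errorEnergyDeriv (p : Params) (v θ e ϑ : H1) : ℝ :=
  2 * (inner ℝ ϑ.fn θ.fn + p.μ * inner ℝ ϑ.dx θ.dx
    + p.μ / p.ν * ((p.c₀ + 1 + p.wd) * (ϑ.val 0 * θ.val 0)
        + 2 / (3 * p.c₀) * (v.val 0 ^ 2 * ϑ.val 0 * θ.val 0 + v.val 0 * e.val 0 * θ.val 0 ^ 2)
      + ((p.c₁ + 1 + p.wd) * (ϑ.val 1 * θ.val 1)
        + 2 / (3 * p.c₁) * (v.val 1 ^ 2 * ϑ.val 1 * θ.val 1 + v.val 1 * e.val 1 * θ.val 1 ^ 2))))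

theorem Params.hasDerivAt_errorEnergy (p : Params) {v θ : ℝ → H1} {e ϑ : H1} {t : ℝ}
    (hv : HasDerivAt v e t) (hθ : HasDerivAt θ ϑ t) :
    HasDerivAt (fun s => p.errorEnergy (v s) (θ s)) (p.errorEnergyDeriv (v t) (θ t) e ϑ) t := by
  have h0 := hasDerivAt_val hθ zero_mem_I
  have h1 := hasDerivAt_val hθ one_mem_I
  have g0 := hasDerivAt_val hv zero_mem_I
  have g1 := hasDerivAt_val hv one_mem_I
  have := ((hasDerivAt_norm_fn_sq hθ).add ((hasDerivAt_norm_dx_sq hθ).const_mul p.μ)).add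
    (((((h0.pow 2).const_mul (p.c₀ + 1 + p.wd)).add
      (((g0.mul h0).pow 2).const_mul (2 / (3 * p.c₀)))).add
      (((h1.pow 2).const_mul (p.c₁ + 1 + p.wd)).add
      (((g1.mul h1).pow 2).const_mul (2 / (3 * p.c₁))))).const_mul (p.μ / p.ν))
  refine this.congr_deriv ?_
  rw [errorEnergyDeriv]
  simp only [Pi.mul_apply]
  push_cast
  ring

theorem Params.le_errorEnergy {p : Params} (hp : p.Pos) (v θ : H1) :
    min 1 p.μ * ‖θ‖ ^ 2 ≤ p.errorEnergy v θ := by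
  obtain ⟨hμ, hν, hwd, hc₀, hc₁⟩ := hp
  rw [errorEnergy, θ.norm_sq]
  have h1 : 0 ≤ p.μ / p.ν * ((p.c₀ + 1 + p.wd) * θ.val 0 ^ 2
      + 2 / (3 * p.c₀) * (v.val 0 * θ.val 0) ^ 2
      + ((p.c₁ + 1 + p.wd) * θ.val 1 ^ 2 + 2 / (3 * p.c₁) * (v.val 1 * θ.val 1) ^ 2)) := by
    positivity
  nlinarith [mul_le_mul_of_nonneg_right (min_le_left 1 p.μ) (sq_nonneg ‖θ.fn‖),
    mul_le_mul_of_nonneg_right (min_le_right 1 p.μ) (sq_nonneg ‖θ.dx‖)]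

theorem Params.errorEnergy_le {p : Params} (hp : p.Pos) {C : ℝ} {v : H1} (hv : ‖v‖ ≤ C) (θ : H1) :
    p.errorEnergy v θ ≤ (1 + p.μ + p.μ / p.ν * (4 * (p.c₀ + 1 + p.wd) + 4 * (p.c₁ + 1 + p.wd)
      + (2 / (3 * p.c₀) + 2 / (3 * p.c₁)) * (16 * C ^ 2))) * ‖θ‖ ^ 2 := by
  obtain ⟨hμ, hν, hwd, hc₀, hc₁⟩ := hp
  have h0 := sq_val_le θ zero_mem_I
  have h1 := sq_val_le θ one_mem_I
  have hvC : ‖v‖ ^ 2 ≤ C ^ 2 := pow_le_pow_left₀ (norm_nonneg _) hv 2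
  have g0 : (v.val 0 * θ.val 0) ^ 2 ≤ (4 * C ^ 2) * (4 * ‖θ‖ ^ 2) := by
    rw [mul_pow]
    exact mul_le_mul ((sq_val_le v zero_mem_I).trans (by linarith)) h0 (sq_nonneg _) (by positivity)
  have g1 : (v.val 1 * θ.val 1) ^ 2 ≤ (4 * C ^ 2) * (4 * ‖θ‖ ^ 2) := by
    rw [mul_pow]
    exact mul_le_mul ((sq_val_le v one_mem_I).trans (by linarith)) h1 (sq_nonneg _) (by positivity)
  have h4 := θ.norm_dx_le
  have h5 := θ.norm_fn_le
  calc p.errorEnergy v θ ≤ ‖θ‖ ^ 2 + p.μ * ‖θ‖ ^ 2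
    + p.μ / p.ν * ((p.c₀ + 1 + p.wd) * (4 * ‖θ‖ ^ 2)
        + 2 / (3 * p.c₀) * ((4 * C ^ 2) * (4 * ‖θ‖ ^ 2))
      + ((p.c₁ + 1 + p.wd) * (4 * ‖θ‖ ^ 2)
        + 2 / (3 * p.c₁) * ((4 * C ^ 2) * (4 * ‖θ‖ ^ 2)))) := by
        rw [errorEnergy]; gcongr
    _ = _ := by ring

/-- A scalar form of the boundary estimate, for one end point. -/
theorem abs_mul_mul_sq_le {a b s A B n : ℝ} (ha : |a| ≤ A) (hb : |b| ≤ B) (hs : s ^ 2 ≤ 4 * n ^ 2) :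
    |a * b * s ^ 2| ≤ A * B * (4 * n ^ 2) := by
  rw [abs_mul, abs_mul, abs_of_nonneg (sq_nonneg s)]
  exact mul_le_mul (mul_le_mul ha hb (abs_nonneg _) ((abs_nonneg _).trans ha)) hs (sq_nonneg _)
    (mul_nonneg ((abs_nonneg _).trans ha) ((abs_nonneg _).trans hb))

/-- The energy identity for the error. -/
theorem Params.errorEnergyDeriv_eq {p : Params} (P : Mesh) {w d v e : H1} (hv : v ∈ P.V)
    (h1 : ∀ χ, p.weakForm w d χ = 0) (h2 : ∀ χ ∈ P.V, p.weakForm v e χ = 0) {θ : H1}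
    (hθ : θ = v - P.interp w) : p.errorEnergyDeriv v θ e (e - P.interp d)
      = 2 * inner ℝ (P.err d).fn θ.fn - 2 * p.ν * ‖θ.dx‖ ^ 2
        - (1 + p.wd) * (θ.val 1 ^ 2 - θ.val 0 ^ 2) - 2 * (1 + p.wd) * inner ℝ θ.dx (P.err w).fn
        - ((v.val 1 + w.val 1) * θ.val 1 ^ 2 - (v.val 0 + w.val 0) * θ.val 0 ^ 2)
        + inner ℝ (mulL (v + w) θ.dx) (v - w).fn
        - 2 * ((p.c₀ + 1 + p.wd) * θ.val 0 ^ 2 + (p.c₁ + 1 + p.wd) * θ.val 1 ^ 2)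
        - 2 * (2 / (9 * p.c₀) * ((v.val 0 ^ 3 - w.val 0 ^ 3) * (v.val 0 - w.val 0)))
        - 2 * (2 / (9 * p.c₁) * ((v.val 1 ^ 3 - w.val 1 ^ 3) * (v.val 1 - w.val 1)))
        + 2 * (p.μ / p.ν * (2 / (3 * p.c₀)) * (-((v.val 0 + w.val 0) * d.val 0 * θ.val 0 ^ 2)
          + v.val 0 * e.val 0 * θ.val 0 ^ 2))
        + 2 * (p.μ / p.ν * (2 / (3 * p.c₁)) * (-((v.val 1 + w.val 1) * d.val 1 * θ.val 1 ^ 2)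
          + v.val 1 * e.val 1 * θ.val 1 ^ 2)) := by
  set ϑ := e - P.interp d with hϑ
  have hm : θ ∈ P.V := by rw [hθ]; exact P.V.sub_mem hv (P.interp_mem _)
  have ev : v - w = θ - P.err w := by rw [hθ, Mesh.err_apply]; abel
  have ee : e - d = ϑ - P.err d := by rw [hϑ, Mesh.err_apply]; abel
  have hdiff : p.weakForm v e θ - p.weakForm w d θ = 0 := by rw [h1, h2 θ hm, sub_zero]
  -- The gradients of the interpolation errors disappear here.
  have o1 := P.inner_dx_eq_zero (P.err_node w) hm
  have o2 := P.inner_dx_eq_zero (P.err_node d) hm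
  have t0 : θ.val 0 = v.val 0 - w.val 0 := by
    have := P.interp_node w 0
    rw [P.node_zero] at this
    rw [hθ, H1.val_sub _ _ zero_mem_I, this]
  have t1 : θ.val 1 = v.val 1 - w.val 1 := by
    have := P.interp_node w (Fin.last _)
    rw [P.node_last] at this
    rw [hθ, H1.val_sub _ _ one_mem_I, this]
  have s0 : ϑ.val 0 = e.val 0 - d.val 0 := by
    have := P.interp_node d 0
    rw [P.node_zero] at this
    rw [hϑ, H1.val_sub _ _ zero_mem_I, this]
  have s1 : ϑ.val 1 = e.val 1 - d.val 1 := by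
    have := P.interp_node d (Fin.last _)
    rw [P.node_last] at this
    rw [hϑ, H1.val_sub _ _ one_mem_I, this]
  have f1 : inner ℝ e.fn θ.fn - inner ℝ d.fn θ.fn
      = inner ℝ ϑ.fn θ.fn - inner ℝ (P.err d).fn θ.fn := by
    rw [← inner_sub_left, ← inner_sub_left, ← H1.fn_sub, ← H1.fn_sub, ee]
  have f2 : inner ℝ e.dx θ.dx - inner ℝ d.dx θ.dx = inner ℝ ϑ.dx θ.dx := by
    rw [← inner_sub_left, ← H1.dx_sub, ee, H1.dx_sub, inner_sub_left, o2, sub_zero]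
  have f3 : inner ℝ v.dx θ.dx - inner ℝ w.dx θ.dx = ‖θ.dx‖ ^ 2 := by
    rw [← inner_sub_left, ← H1.dx_sub, ev, H1.dx_sub, inner_sub_left, o1, sub_zero,
      real_inner_self_eq_norm_sq]
  have f4 : inner ℝ v.dx θ.fn - inner ℝ w.dx θ.fn
      = (θ.val 1 ^ 2 - θ.val 0 ^ 2) / 2 + inner ℝ θ.dx (P.err w).fn := by
    rw [← inner_sub_left, ← H1.dx_sub, ev, H1.dx_sub, inner_sub_left, inner_dx_fn_self]
    have := (P.err w).inner_dx_fn_add θ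
    rw [P.err_zero, P.err_one] at this
    linarith only [this]
  have f5 := conv_sub_conv v w θ
  -- Since interpolation is exact at the end points, the boundary terms become polynomials in the
  -- end point values of `v`, `θ`, `e`, `ϑ`.
  have w0 : w.val 0 = v.val 0 - θ.val 0 := by linarith only [t0]
  have w1 : w.val 1 = v.val 1 - θ.val 1 := by linarith only [t1]
  have d0 : d.val 0 = e.val 0 - ϑ.val 0 := by linarith only [s0]
  have d1 : d.val 1 = e.val 1 - ϑ.val 1 := by linarith only [s1]
  rw [weakForm, weakForm, integral_conv, integral_conv, w0, w1, d0, d1] at hdiff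
  rw [w0, w1] at f5
  rw [errorEnergyDeriv, w0, w1, d0, d1]
  linear_combination 2 * hdiff - 2 * f1 - 2 * p.μ * f2 - 2 * p.ν * f3 - 2 * (1 + p.wd) * f4
    - 2 * f5

/-- The differential inequality for the error energy. -/
theorem Params.errorEnergyDeriv_add_le {p : Params} (hp : p.Pos) {α : ℝ} (hα : p.Rate α)
    (P : Mesh) {w d v e : H1} (hv : v ∈ P.V)
    (h1 : ∀ χ, p.weakForm w d χ = 0) (h2 : ∀ χ ∈ P.V, p.weakForm v e χ = 0)
    {C q : ℝ} (hC : 0 ≤ C) (hq : 0 ≤ q) (hq1 : q ≤ 1) (bw : ‖w‖ ≤ C * q) (bd : ‖d‖ ≤ C * q)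
    (bv : ‖v‖ ≤ C * q) (be : ‖e‖ ≤ C * q) (bη : ‖(P.err w).fn‖ ≤ C * (P.h ^ 2 * q))
    (bη' : ‖(P.err d).fn‖ ≤ C * (P.h ^ 2 * q)) :
    p.errorEnergyDeriv v (v - P.interp w) e (e - P.interp d)
        + 2 * α * p.errorEnergy v (v - P.interp w)
      ≤ (38 * C + (96 + 32 * α) * (p.μ / p.ν * (2 / (3 * p.c₀) + 2 / (3 * p.c₁))) * C ^ 2
        + 2 * (1 + p.wd) * C + 4 * C ^ 2) * q
        * (‖v - P.interp w‖ ^ 2 + P.h ^ 2 * ‖v - P.interp w‖) := by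
  have hid := Params.errorEnergyDeriv_eq P hv h1 h2 rfl
  set θ := v - P.interp w with hθ
  set n := ‖θ‖ with hn
  obtain ⟨hμ, hν, hwd, hc₀, hc₁⟩ := hp
  have hn0 : 0 ≤ n := norm_nonneg _
  have hCq : 0 ≤ C * q := mul_nonneg hC hq
  have hh : 0 ≤ P.h ^ 2 := sq_nonneg _
  have b1 : inner ℝ (P.err d).fn θ.fn ≤ C * (P.h ^ 2 * q) * n :=
    (real_inner_le_norm _ _).trans (mul_le_mul bη' θ.norm_fn_le (norm_nonneg _) (by positivity))
  have b2 : -(C * (P.h ^ 2 * q) * n) ≤ inner ℝ θ.dx (P.err w).fn := by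
    refine (abs_le.1 ((abs_real_inner_le_norm _ _).trans ?_)).1
    rw [mul_comm (C * _)]
    exact mul_le_mul θ.norm_dx_le bη (norm_nonneg _) hn0
  have vv : ∀ (u : H1) (x : ℝ), x ∈ Icc (0 : ℝ) 1 → ‖u‖ ≤ C * q → |u.val x| ≤ 2 * (C * q) :=
    fun u x hx hu => (u.abs_val_le hx).trans (by linarith only [hu])
  have vw : ∀ x : ℝ, x ∈ Icc (0 : ℝ) 1 → |v.val x + w.val x| ≤ 4 * (C * q) := fun x hx =>
    (abs_add_le _ _).trans (by linarith only [vv v x hx bv, vv w x hx bw])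
  have b3 : inner ℝ (mulL (v + w) θ.dx) (v - w).fn ≤ 4 * (C * q) * n * (n + C * (P.h ^ 2 * q)) := by
    refine (real_inner_le_norm _ _).trans (mul_le_mul ?_ ?_ (norm_nonneg _) (by positivity))
    · refine (norm_mulL_le (v + w) θ.dx (C := 4 * (C * q)) fun x hx => ?_).trans
        (mul_le_mul_of_nonneg_left θ.norm_dx_le (by positivity))
      rw [H1.val_add _ _ hx]
      exact vw x hx
    · rw [show v - w = θ - P.err w by rw [hθ, Mesh.err_apply]; abel, H1.fn_sub]
      exact (norm_sub_le _ _).trans (add_le_add θ.norm_fn_le bη)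
  -- Products of two decaying factors are estimated by a single one.
  have q2 : q * q ≤ q := by nlinarith
  have b3' : inner ℝ (mulL (v + w) θ.dx) (v - w).fn
      ≤ 4 * C * q * n ^ 2 + 4 * C ^ 2 * q * (P.h ^ 2 * n) := by
    refine b3.trans ?_
    have := mul_le_mul_of_nonneg_left q2 (by positivity : 0 ≤ 4 * C ^ 2 * (P.h ^ 2 * n))
    linarith only [this]
  have sq0 := sq_val_le θ zero_mem_I
  have sq1 := sq_val_le θ one_mem_I
  rw [← hn] at sq0 sq1
  have b4 : ∀ x : ℝ, x ∈ Icc (0 : ℝ) 1 → θ.val x ^ 2 ≤ 4 * n ^ 2 →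
      |(v.val x + w.val x) * θ.val x ^ 2| ≤ 16 * C * q * n ^ 2 := by
    intro x hx hs
    have := abs_mul_mul_sq_le (vw x hx) (abs_one (α := ℝ)).le hs
    rw [mul_one] at this
    linarith only [this]
  have b40 := abs_le.1 (b4 0 zero_mem_I sq0)
  have b41 := abs_le.1 (b4 1 one_mem_I sq1)
  -- The first two terms come from the state-dependent boundary coefficients, the one with `α` from
  -- `2 * α * errorEnergy`.
  have b5 : ∀ x : ℝ, x ∈ Icc (0 : ℝ) 1 → θ.val x ^ 2 ≤ 4 * n ^ 2 →
      -((v.val x + w.val x) * d.val x * θ.val x ^ 2) + v.val x * e.val x * θ.val x ^ 2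
        + α * (v.val x * v.val x * θ.val x ^ 2)
      ≤ (48 + 16 * α) * C ^ 2 * q * n ^ 2 := by
    intro x hx hs
    have c1 := (abs_le.1 (abs_mul_mul_sq_le (vw x hx) (vv d x hx bd) hs)).1
    have c2 := (abs_le.1 (abs_mul_mul_sq_le (vv v x hx bv) (vv e x hx be) hs)).2
    have c3 := mul_le_mul_of_nonneg_left
      (abs_le.1 (abs_mul_mul_sq_le (vv v x hx bv) (vv v x hx bv) hs)).2 hα.nonneg
    have hα0 := hα.nonneg
    have := mul_le_mul_of_nonneg_left q2 (by positivity : 0 ≤ (48 + 16 * α) * C ^ 2 * n ^ 2)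
    linarith only [c1, c2, c3, this]
  have hk0 : 0 ≤ p.μ / p.ν * (2 / (3 * p.c₀)) := by positivity
  have hk1 : 0 ≤ p.μ / p.ν * (2 / (3 * p.c₁)) := by positivity
  have b50 := mul_le_mul_of_nonneg_left (b5 0 zero_mem_I sq0) hk0
  have b51 := mul_le_mul_of_nonneg_left (b5 1 one_mem_I sq1) hk1
  -- The cubic feedback is monotone, so its contribution has the favourable sign and is dropped.
  have mono : ∀ a b : ℝ, 0 ≤ (a ^ 3 - b ^ 3) * (a - b) := fun a b => by
    have : (a ^ 3 - b ^ 3) * (a - b) = (a - b) ^ 2 * ((a + b / 2) ^ 2 + 3 / 4 * b ^ 2) := by ring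
    rw [this]; positivity
  have m0 := mul_nonneg (by positivity : 0 ≤ 2 / (9 * p.c₀)) (mono (v.val 0) (w.val 0))
  have m1 := mul_nonneg (by positivity : 0 ≤ 2 / (9 * p.c₁)) (mono (v.val 1) (w.val 1))
  have coer := hα.coercive θ
  have z1 : 0 ≤ (1 + p.wd) * θ.val 1 ^ 2 := by positivity
  have z2 : 0 ≤ p.c₀ * θ.val 0 ^ 2 := by positivity
  have z3 : 0 ≤ p.c₁ * θ.val 1 ^ 2 := by positivity
  have b2' := mul_le_mul_of_nonneg_left b2 (by positivity : 0 ≤ 1 + p.wd)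
  have hfinal : p.errorEnergyDeriv v θ e (e - P.interp d) + 2 * α * p.errorEnergy v θ ≤
      2 * (C * (P.h ^ 2 * q) * n) + 2 * ((1 + p.wd) * (C * (P.h ^ 2 * q) * n))
      + (4 * C * q * n ^ 2 + 4 * C ^ 2 * q * (P.h ^ 2 * n)) + 32 * C * q * n ^ 2
      + 2 * (p.μ / p.ν * (2 / (3 * p.c₀)) * ((48 + 16 * α) * C ^ 2 * q * n ^ 2))
      + 2 * (p.μ / p.ν * (2 / (3 * p.c₁)) * ((48 + 16 * α) * C ^ 2 * q * n ^ 2)) := by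
    rw [hid, errorEnergy]
    linarith only [b1, b2', b3', b40.1, b40.2, b41.1, b41.2, b50, b51, m0, m1, coer, z1, z2, z3]
  -- Both `n²` and `h² n` get the sum of all coefficients as factor; `38 = 4 + 32 + 2` collects the
  -- convection integral, the boundary terms and the error of the time derivative.
  have y0 : 0 ≤ C * q * n ^ 2 := by positivity
  have y1 : 0 ≤ C * q * (P.h ^ 2 * n) := by positivity
  have y2 : 0 ≤ C ^ 2 * q * n ^ 2 := by positivity
  have y3 : 0 ≤ p.wd * (C * q * n ^ 2) := by positivity
  have y4 : 0 ≤ (96 + 32 * α) * (p.μ / p.ν * (2 / (3 * p.c₀) + 2 / (3 * p.c₁))) * C ^ 2 * q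
    * (P.h ^ 2 * n) := by have := hα.nonneg; positivity
  linarith only [hfinal, y0, y1, y2, y3, y4]

/-- Gronwall's inequality for the error energy. -/
theorem le_of_energy_inequality {E E' n : ℝ → ℝ} {α β K H m : ℝ} (hα : 0 ≤ α) (hαβ : α < β)
    (hK : 0 ≤ K) (hm : 0 < m) (hE : ∀ t, HasDerivAt E (E' t) t)
    (hn : ∀ t, m * n t ^ 2 ≤ E t)
    (h : ∀ t, 0 ≤ t → E' t + 2 * α * E t ≤ K * Real.exp (-β * t) * (n t ^ 2 + H * n t))
    {t : ℝ} (ht : 0 ≤ t) :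
    E t ≤ (E 0 + H ^ 2) * Real.exp (K * (2 / m + 1) / (β - α)) * Real.exp (-(2 * α) * t) := by
  have hδ : 0 < β - α := sub_pos.2 hαβ
  have hexp : ∀ (c s : ℝ), HasDerivAt (fun s => Real.exp (c * s)) (Real.exp (c * s) * c) s :=
    fun c s => by simpa using ((hasDerivAt_id s).const_mul c).exp
  set L := K * (2 / m + 1) with hL
  have hL0 : 0 ≤ L := by positivity
  -- The weight absorbs the damping, and adding `H²` makes the inequality homogeneous. The remaining
  -- coefficient `L e^{-(β-α)s}` has integral `L / (β - α)` over `[0,∞)`.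
  have key := le_mul_exp_of_deriv_le (f := fun s => Real.exp (2 * α * s) * E s + H ^ 2)
    (f' := fun s => Real.exp (2 * α * s) * (2 * α) * E s + Real.exp (2 * α * s) * E' s)
    (A := fun s => -(L / (β - α)) * Real.exp (-(β - α) * s))
    (a := fun s => L * Real.exp (-(β - α) * s))
    (fun s => ((hexp _ s).mul (hE s)).add_const _)
    (fun s => ((hexp _ s).const_mul _).congr_deriv (by field_simp)) (fun s hs => ?_) ht
  · simp only [mul_zero, Real.exp_zero, one_mul, mul_one] at key
    have h0 : 0 ≤ E 0 + H ^ 2 := by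
      have := hn 0
      have : 0 ≤ m * n 0 ^ 2 := by positivity
      nlinarith [sq_nonneg H]
    have h1 : Real.exp (-(L / (β - α)) * Real.exp (-(β - α) * t) - -(L / (β - α)))
        ≤ Real.exp (L / (β - α)) := by
      rw [Real.exp_le_exp]
      have : 0 ≤ L / (β - α) * Real.exp (-(β - α) * t) := by positivity
      linarith
    have h2 := key.trans (mul_le_mul_of_nonneg_left h1 h0)
    have h3 : E t = Real.exp (2 * α * t) * E t * Real.exp (-(2 * α) * t) := by
      rw [mul_comm (Real.exp _), mul_assoc, ← Real.exp_add]; simp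
    rw [h3]
    refine mul_le_mul_of_nonneg_right ?_ (Real.exp_pos _).le
    linarith [sq_nonneg H]
  · have h1 := mul_le_mul_of_nonneg_left (h s hs) (Real.exp_pos (2 * α * s)).le
    set N := Real.exp (α * s) * n s with hN
    set δ := Real.exp (-(β - α) * s) with hδ'
    have e1 : Real.exp (2 * α * s) = Real.exp (α * s) * Real.exp (α * s) := by
      rw [← Real.exp_add]; ring_nf
    have e2 : δ = Real.exp (α * s) * Real.exp (-β * s) := by
      rw [hδ', ← Real.exp_add]; ring_nf
    have e3 : Real.exp (-β * s) ≤ δ := by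
      rw [hδ', Real.exp_le_exp]; nlinarith
    have hδ0 : 0 < δ := Real.exp_pos _
    -- In the term linear in `n`, one factor `e^{αs}` goes into `N` and the other is left against
    -- `e^{-βs}`; integrability of the rest is what `α < β` provides.
    have h2 : Real.exp (2 * α * s) * (K * Real.exp (-β * s) * (n s ^ 2 + H * n s))
        ≤ K * δ * (N ^ 2 + H * N) := by
      have a1 : Real.exp (2 * α * s) * (K * Real.exp (-β * s) * (n s ^ 2 + H * n s))
        = K * (Real.exp (-β * s) * N ^ 2) + K * (δ * (H * N)) := by
        rw [e1, e2, hN]; ring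
      have a2 : K * (Real.exp (-β * s) * N ^ 2) ≤ K * (δ * N ^ 2) := by gcongr
      linarith
    have h3 : N ^ 2 + H * N ≤ 2 * N ^ 2 + H ^ 2 := by nlinarith [sq_nonneg (N - H)]
    have h4 : m * N ^ 2 ≤ Real.exp (2 * α * s) * E s := by
      rw [e1, hN]
      have := mul_le_mul_of_nonneg_left (hn s) (mul_self_nonneg (Real.exp (α * s)))
      linarith
    have h5 : 2 * N ^ 2 + H ^ 2 ≤ (2 / m + 1) * (Real.exp (2 * α * s) * E s + H ^ 2) := by
      have b1 : N ^ 2 ≤ Real.exp (2 * α * s) * E s / m := by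
        rw [le_div_iff₀ hm]; linarith
      have b2 : 0 ≤ Real.exp (2 * α * s) * E s := le_trans (by positivity) h4
      have b3 : 0 ≤ 2 / m * H ^ 2 := by positivity
      have b4 : 2 / m * (Real.exp (2 * α * s) * E s) = 2 * (Real.exp (2 * α * s) * E s / m) := by
        ring
      linarith
    have h6 := mul_le_mul_of_nonneg_left (h3.trans h5) (by positivity : 0 ≤ K * δ)
    rw [hL]
    linarith

theorem Params.Rate.mono {p : Params} (hp : p.Pos) {α β : ℝ} (hβ : p.Rate β) (hα : 0 ≤ α)
    (hαβ : α ≤ β) : p.Rate α := by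
  obtain ⟨hμ, hν, hwd, hc₀, hc₁⟩ := hp
  have aux : ∀ c d : ℝ, 0 ≤ c → β * c ≤ d → α * c ≤ d := fun c d hc h =>
    (mul_le_mul_of_nonneg_right hαβ hc).trans h
  refine ⟨hα, aux _ _ (by positivity) hβ.interior, ?_, ?_, ?_⟩
  · have := aux (2 * p.μ) p.ν (by positivity) (by linarith [hβ.ode])
    linarith
  · have := aux (2 * (p.μ / p.ν * (p.c₀ + 1 + p.wd) + 3 / 4)) _ (by positivity)
      (by linarith [hβ.left] : β * (2 * (p.μ / p.ν * (p.c₀ + 1 + p.wd) + 3 / 4)) ≤ p.c₀ + 1 + p.wd)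
    linarith
  · have := aux (2 * (p.μ / p.ν * (p.c₁ + 1 + p.wd) + 3 / 4)) _ (by positivity)
      (by linarith [hβ.right] : β * (2 * (p.μ / p.ν * (p.c₁ + 1 + p.wd) + 3 / 4)) ≤ p.c₁ + 1 + p.wd)
    linarith

/-- The distance of the semidiscrete solution to the interpolant of the solution is `O(h²)` in
`H¹`. -/
theorem Params.exists_norm_sub_interp_le {p : Params} (hp : p.Pos) {α β : ℝ} (hα : 0 ≤ α)
    (hαβ : α < β) (hβ : p.Rate β) {lam : ℝ} (hlam : 0 < lam) {w₀ : H1} (hw₀ : IsH2 w₀) :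
    ∃ C, 0 < C ∧ ∀ (w D : ℝ → H1), p.IsC1Sol ⊤ w D → w 0 = w₀ →
      ∀ (P : Mesh) (v e : ℝ → H1), p.IsC1Sol P.V v e → P.IsProjection lam w₀ (v 0) →
      ∀ t, 0 ≤ t → ‖w t‖ ≤ C ∧ ‖v t‖ ≤ C ∧
        ‖v t - P.interp (w t)‖ ≤ C * (P.h ^ 2 * Real.exp (-α * t)) := by
  have hm : 0 < min 1 p.μ := lt_min one_pos hp.μ
  have hl : 0 < min 1 lam := lt_min one_pos hlam
  obtain ⟨C₁, hC₁, dec₁⟩ := Params.exists_decay hp hβ ‖w₀‖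
  obtain ⟨C₂, hC₂, dec₂⟩ := Params.exists_decay hp hβ ((1 + lam) / min 1 lam * ‖w₀‖)
  obtain ⟨C₃, hC₃, con⟩ := Params.exists_norm_err_le hp hβ hw₀
  -- One constant for the exact solution, the semidiscrete solution and the interpolation errors.
  set C := C₁ + C₂ + C₃ with hC
  have hC0 : 0 < C := by positivity
  set K := 38 * C + (96 + 32 * α) * (p.μ / p.ν * (2 / (3 * p.c₀) + 2 / (3 * p.c₁))) * C ^ 2
        + 2 * (1 + p.wd) * C + 4 * C ^ 2 with hK
  have hK0 : 0 ≤ K := by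
    obtain ⟨hμ, hν, hwd, hc₀, hc₁⟩ := hp
    positivity
  set M := 1 + p.μ + p.μ / p.ν * (4 * (p.c₀ + 1 + p.wd) + 4 * (p.c₁ + 1 + p.wd)
      + (2 / (3 * p.c₀) + 2 / (3 * p.c₁)) * (16 * C ^ 2)) with hM
  have hM0 : 0 ≤ M := by
    obtain ⟨hμ, hν, hwd, hc₀, hc₁⟩ := hp
    positivity
  -- `L` bounds `θ(0)` in units of `h²`, `X` is the Gronwall factor, and `S` converts the energy
  -- bound into an `H¹` bound.
  set L := lam / min 1 lam * C₃ with hL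
  have hL0 : 0 ≤ L := by positivity
  set X := Real.exp (K * (2 / min 1 p.μ + 1) / (β - α)) with hX
  have hX0 : 0 < X := Real.exp_pos _
  set S := Real.sqrt ((M * L ^ 2 + 1) * X / min 1 p.μ) with hS
  have hS0 : 0 ≤ S := Real.sqrt_nonneg _
  refine ⟨C + S, by positivity, fun w D hw hw0 P v e hv hproj => ?_⟩
  have hexp1 : ∀ s : ℝ, 0 ≤ s → Real.exp (-β * s) ≤ 1 := fun s hs => by
    rw [Real.exp_le_one_iff]; nlinarith
  have lift : ∀ (c x s : ℝ), c ≤ C → x ≤ c * Real.exp (-β * s) → x ≤ C * Real.exp (-β * s) :=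
    fun c x s hc hx => hx.trans (mul_le_mul_of_nonneg_right hc (Real.exp_pos _).le)
  have bw : ∀ s, 0 ≤ s → ‖w s‖ ≤ C * Real.exp (-β * s) ∧ ‖D s‖ ≤ C * Real.exp (-β * s) :=
    fun s hs => by
      have := dec₁ ⊤ w D hw (by rw [hw0]) s hs
      exact ⟨lift C₁ _ s (by linarith) this.1, lift C₁ _ s (by linarith) this.2⟩
  have bv : ∀ s, 0 ≤ s → ‖v s‖ ≤ C * Real.exp (-β * s) ∧ ‖e s‖ ≤ C * Real.exp (-β * s) :=
    fun s hs => by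
      have := dec₂ P.V v e hv (hproj.norm_le hlam) s hs
      exact ⟨lift C₂ _ s (by linarith) this.1, lift C₂ _ s (by linarith) this.2⟩
  have bC : ∀ s x : ℝ, 0 ≤ s → x ≤ C * Real.exp (-β * s) → x ≤ C := fun s x hs hx =>
    hx.trans (by nlinarith [hexp1 s hs])
  have berr : ∀ s, 0 ≤ s → ‖(P.err (w s)).fn‖ ≤ C * (P.h ^ 2 * Real.exp (-β * s)) ∧
      ‖(P.err (D s)).fn‖ ≤ C * (P.h ^ 2 * Real.exp (-β * s)) := fun s hs => by
    have h1 := con w D hw hw0 P s hs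
    have h2 : C₃ * (P.h ^ 2 * Real.exp (-β * s)) ≤ C * (P.h ^ 2 * Real.exp (-β * s)) :=
      mul_le_mul_of_nonneg_right (by linarith) (by positivity)
    exact ⟨h1.1.trans h2, h1.2.trans h2⟩
  set θ : ℝ → H1 := fun s => v s - P.interp (w s) with hθ
  have hdθ : ∀ s, HasDerivAt θ (e s - P.interp (D s)) s := fun s =>
    (hv.hasDerivAt s).sub (P.interp.hasFDerivAt.comp_hasDerivAt s (hw.hasDerivAt s))
  have hα' := hβ.mono hp hα hαβ.le
  intro t ht
  have main := le_of_energy_inequality (E := fun s => p.errorEnergy (v s) (θ s))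
    (n := fun s => ‖θ s‖) (H := P.h ^ 2) (m := min 1 p.μ) (K := K) hα hαβ hK0 hm
    (fun s => p.hasDerivAt_errorEnergy (hv.hasDerivAt s) (hdθ s))
    (fun s => Params.le_errorEnergy hp _ _)
    (fun s hs => Params.errorEnergyDeriv_add_le hp hα' P (hv.mem s hs)
      (fun χ => hw.eq s hs χ trivial) (hv.eq s hs) hC0.le (Real.exp_pos _).le (hexp1 s hs)
      (bw s hs).1 (bw s hs).2 (bv s hs).1 (bv s hs).2 (berr s hs).1 (berr s hs).2) ht
  have h0 : ‖θ 0‖ ≤ L * P.h ^ 2 := by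
    have h1 := hproj.norm_sub_interp_le hlam
    have h2 := (con w D hw hw0 P 0 le_rfl).1
    rw [mul_zero, Real.exp_zero, mul_one, hw0] at h2
    rw [hθ]
    simp only [hw0]
    refine h1.trans ?_
    rw [hL, mul_assoc]
    exact mul_le_mul_of_nonneg_left h2 (by positivity)
  have hE0 : p.errorEnergy (v 0) (θ 0) + (P.h ^ 2) ^ 2 ≤ (M * L ^ 2 + 1) * (P.h ^ 2) ^ 2 := by
    have h1 := Params.errorEnergy_le hp (bC 0 _ le_rfl (bv 0 le_rfl).1) (θ 0)
    have h2 : ‖θ 0‖ ^ 2 ≤ (L * P.h ^ 2) ^ 2 := pow_le_pow_left₀ (norm_nonneg _) h0 2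
    have h3 := mul_le_mul_of_nonneg_left h2 hM0
    rw [mul_pow] at h3
    linarith
  refine ⟨(bC t _ ht (bw t ht).1).trans (by linarith), (bC t _ ht (bv t ht).1).trans (by linarith),
    ?_⟩
  have hfin : ‖θ t‖ ≤ S * (P.h ^ 2 * Real.exp (-α * t)) := by
    refine abs_le_of_sq_le_sq' ?_ (by positivity) |>.2
    have e1 : Real.exp (-α * t) ^ 2 = Real.exp (-(2 * α) * t) := by
      rw [← Real.exp_nat_mul]; congr 1; push_cast; ring
    have e2 : (S * (P.h ^ 2 * Real.exp (-α * t))) ^ 2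
        = (M * L ^ 2 + 1) * X * ((P.h ^ 2) ^ 2 * Real.exp (-(2 * α) * t)) / min 1 p.μ := by
      rw [mul_pow S, hS, Real.sq_sqrt (by positivity), mul_pow (P.h ^ 2), e1]
      ring
    rw [e2, le_div_iff₀ hm, mul_comm _ (min 1 p.μ)]
    refine (Params.le_errorEnergy hp (v t) (θ t)).trans (main.trans ?_)
    have := mul_le_mul_of_nonneg_right hE0 (by positivity : 0 ≤ X * Real.exp (-(2 * α) * t))
    linarith
  refine hfin.trans (mul_le_mul_of_nonneg_right (by linarith) (by positivity))

/-! ### The interpolation error in the maximum norm -/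

theorem abs_inner_le_of_ae_le {f : L2} {A : ℝ} (hf : ∀ᵐ x ∂volI, |f x| ≤ A) (χ : H1) :
    |inner ℝ f χ.fn| ≤ A * ∫ x, |χ.val x| ∂volI := by
  rw [L2.inner_eq, ← integral_const_mul]
  refine (abs_integral_le_integral_abs).trans (integral_mono_ae (L2.integrable_mul _ _).abs
    (((memLp_val χ 2).integrable (by norm_num)).abs.const_mul A) ?_)
  filter_upwards [hf, χ.fn_ae_eq_val] with x h1 h2
  rw [abs_mul, h2]
  exact mul_le_mul_of_nonneg_right h1 (abs_nonneg _)

theorem ae_abs_dx_le {u : H1} {L : ℝ} (hL : 0 ≤ L)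
    (h : ∀ x y : ℝ, 0 ≤ x → x ≤ y → y ≤ 1 → |u.val y - u.val x| ≤ L * (y - x)) :
    ∀ᵐ x ∂volI, |u.dx x| ≤ L := by
  have hlip : LipschitzOnWith (Real.toNNReal L) u.val (Ioo 0 1) := by
    refine LipschitzOnWith.of_dist_le_mul fun x hx y hy => ?_
    rw [Real.dist_eq, Real.dist_eq, Real.coe_toNNReal _ hL]
    rcases le_total x y with hxy | hxy
    · rw [abs_sub_comm, abs_sub_comm x, abs_of_nonneg (sub_nonneg.2 hxy)]
      exact h x y hx.1.le hxy hy.2.le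
    · rw [abs_of_nonneg (sub_nonneg.2 hxy)]
      exact h y x hy.1.le hxy hx.2.le
  filter_upwards [u.ae_hasDerivAt, ae_restrict_mem measurableSet_Ioo] with x hx hxI
  have := hx.le_of_lipschitzOn (isOpen_Ioo.mem_nhds hxI) hlip
  rwa [Real.coe_toNNReal _ hL, Real.norm_eq_abs] at this

theorem abs_ramp_val_le {a b : ℝ} (ha : 0 ≤ a) (hab : a ≤ b) {x : ℝ} (hx : x ∈ Icc (0 : ℝ) 1) :
    |(ramp a b).val x| ≤ b - a := by
  rw [ramp_val ha hab hx, abs_of_nonneg (sub_nonneg.2 (min_le_min_left x hab))]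
  rcases le_total x a with h | h
  · rw [min_eq_left h, min_eq_left (h.trans hab)]; linarith
  · rw [min_eq_right h]; linarith [min_le_right x b]

/-- The derivative `u_x` lies in `H¹` and is therefore bounded by `2 * ‖v‖`. -/
theorem IsH2.exists_lipschitz {u : H1} (hu : IsH2 u) : ∃ L, 0 ≤ L ∧
    ∀ x y : ℝ, 0 ≤ x → x ≤ y → y ≤ 1 → |u.val y - u.val x| ≤ L * (y - x) := by
  obtain ⟨v, hv⟩ := hu
  refine ⟨2 * ‖v‖, by positivity, fun x y hx hxy hy => ?_⟩
  rw [u.val_sub' ⟨hx, hxy.trans hy⟩ ⟨hx.trans hxy, hy⟩, ← hv]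
  have h1 : ∀ᵐ z ∂volI, |v.fn z| ≤ 2 * ‖v‖ := by
    filter_upwards [v.fn_ae_eq_val, ae_restrict_mem measurableSet_Ioo] with z hz hI
    rw [hz]; exact v.abs_val_le (Ioo_subset_Icc_self hI)
  rw [← Real.norm_eq_abs, ← abs_of_nonneg (sub_nonneg.2 hxy)]
  refine intervalIntegral.norm_integral_le_of_norm_le_const_ae ?_
  rw [ae_restrict_iff' measurableSet_Ioo] at h1
  filter_upwards [h1, (measure_eq_zero_iff_ae_notMem.1 (measure_singleton (μ := volume) (1 : ℝ)))]
    with z hz hz1 hzI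
  rw [uIoc_of_le hxy] at hzI
  exact hz ⟨hx.trans_lt hzI.1, lt_of_le_of_ne (hzI.2.trans hy) hz1⟩

/-- Solutions are Lipschitz in space, with exponentially decaying constant. -/
theorem Params.exists_lipschitz {p : Params} (hp : p.Pos) {β : ℝ} (hβ : p.Rate β) {w₀ : H1}
    (hw₀ : IsH2 w₀) :
    ∃ L, 0 < L ∧ ∀ (w D : ℝ → H1), p.IsC1Sol ⊤ w D → w 0 = w₀ → ∀ t, 0 ≤ t →
      ∀ x y : ℝ, 0 ≤ x → x ≤ y → y ≤ 1 →
        |(w t).val y - (w t).val x| ≤ L * Real.exp (-β * t) * (y - x) := by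
  obtain ⟨C, hC, hdec⟩ := Params.exists_decay hp hβ ‖w₀‖
  obtain ⟨L₀, hL₀, hlip⟩ := hw₀.exists_lipschitz
  have hp' := hp
  obtain ⟨hμ, hν, hwd, hc₀, hc₁⟩ := hp'
  set A := C + (1 + p.wd) * C + 2 * C * C with hA
  set b : ℝ → ℝ := fun c => p.μ / p.ν * ((c + 1 + p.wd) * (2 * C)
    + 2 / (3 * c) * (2 * C) ^ 2 * (2 * C)) + ((c + 1 + p.wd) * (2 * C)
    + 2 / (9 * c) * ((2 * C) ^ 2 * (2 * C))) with hb
  have hb0 : ∀ c, 0 < c → 0 ≤ b c := fun c hc => by rw [hb]; positivity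
  have hA0 : 0 ≤ A := by positivity
  set B := A + b p.c₀ + b p.c₁ with hB
  have hB0 : 0 ≤ B := add_nonneg (add_nonneg hA0 (hb0 _ hc₀)) (hb0 _ hc₁)
  refine ⟨L₀ + 2 * B / p.ν + 1, by positivity, fun w D hw hw0 t ht x y hx hxy hy => ?_⟩
  have hxI : x ∈ Icc (0 : ℝ) 1 := ⟨hx, hxy.trans hy⟩
  have hyI : y ∈ Icc (0 : ℝ) 1 := ⟨hx.trans hxy, hy⟩
  have hyx : 0 ≤ y - x := sub_nonneg.2 hxy
  have hz : ∀ s, HasDerivAt (fun s => (w s).val y - (w s).val x) ((D s).val y - (D s).val x) s :=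
    fun s => (hasDerivAt_val (hw.hasDerivAt s) hyI).sub (hasDerivAt_val (hw.hasDerivAt s) hxI)
  have hbound : ∀ s, 0 ≤ s → ‖p.μ • ((D s).val y - (D s).val x)
      + p.ν • ((w s).val y - (w s).val x)‖ ≤ B * (y - x) * Real.exp (-β * s) := by
    intro s hs
    obtain ⟨d1, d2⟩ := hdec ⊤ w D hw (by rw [hw0]) s hs
    set q := Real.exp (-β * s) with hq
    have hq0 : 0 < q := Real.exp_pos _
    have hq1 : q ≤ 1 := by rw [hq, Real.exp_le_one_iff]; nlinarith [hβ.nonneg]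
    -- Testing with the ramp over `[x,y]` gives an ODE in time for the increment. The ramp is at
    -- most `y - x`, so all remaining terms, boundary terms included, are `O(y - x)`.
    have e1 : p.μ • ((D s).val y - (D s).val x) + p.ν • ((w s).val y - (w s).val x)
        = inner ℝ (p.μ • D s + p.ν • w s).dx (ramp x y).dx := by
      rw [inner_dx_ramp _ hx hxy hy, H1.val_add _ _ hxI, H1.val_add _ _ hyI, H1.val_smul _ _ hxI,
        H1.val_smul _ _ hyI, H1.val_smul _ _ hxI, H1.val_smul _ _ hyI, smul_eq_mul, smul_eq_mul]
      ring
    have e2 := hw.eq s hs (ramp x y) trivial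
    rw [p.weakForm_eq_force] at e2
    have hwC : ‖w s‖ ≤ C := d1.trans (by nlinarith)
    have i1 : |inner ℝ (p.force (w s) (D s)) (ramp x y).fn| ≤ A * q * (y - x) := by
      refine (abs_real_inner_le_norm _ _).trans (mul_le_mul ?_
        ((ramp x y).norm_fn_le_of_val hyx fun z hz => abs_ramp_val_le hx hxy hz)
        (norm_nonneg _) (by positivity))
      refine (p.norm_force_le hp _ _).trans ?_
      calc ‖D s‖ + (1 + p.wd) * ‖w s‖ + 2 * ‖w s‖ * ‖w s‖
          ≤ C * q + (1 + p.wd) * (C * q) + 2 * C * (C * q) := by gcongr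
        _ = _ := by rw [hA]; ring
    have i2 : ∀ (c z : ℝ), 0 < c → z ∈ Icc (0 : ℝ) 1 →
        |(p.μ / p.ν * ((c + 1 + p.wd) * (D s).val z
          + 2 / (3 * c) * (w s).val z ^ 2 * (D s).val z)
          + ((c + 1 + p.wd) * (w s).val z + 2 / (9 * c) * (w s).val z ^ 3)) * (ramp x y).val z|
        ≤ b c * q * (y - x) := by
      intro c z hc hz
      rw [abs_mul]
      refine mul_le_mul ?_ (abs_ramp_val_le hx hxy hz) (abs_nonneg _)
        (mul_nonneg (hb0 c hc) hq0.le)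
      have a1 : |(w s).val z| ≤ 2 * (C * q) := ((w s).abs_val_le hz).trans (by linarith)
      have a2 : |(D s).val z| ≤ 2 * (C * q) := ((D s).abs_val_le hz).trans (by linarith)
      have a3 : |(w s).val z| ≤ 2 * C := ((w s).abs_val_le hz).trans (by linarith)
      have hk : 0 < c + 1 + p.wd := by positivity
      have r : p.μ / p.ν * ((c + 1 + p.wd) * (D s).val z
          + 2 / (3 * c) * (w s).val z ^ 2 * (D s).val z)
          + ((c + 1 + p.wd) * (w s).val z + 2 / (9 * c) * (w s).val z ^ 3)
          = p.μ / p.ν * ((c + 1 + p.wd) * (D s).val z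
          + 2 / (3 * c) * (w s).val z ^ 2 * (D s).val z)
          + ((c + 1 + p.wd) * (w s).val z + 2 / (9 * c) * ((w s).val z ^ 2 * (w s).val z)) := by
        ring
      rw [r]
      calc _ ≤ p.μ / p.ν * ((c + 1 + p.wd) * |(D s).val z|
          + 2 / (3 * c) * |(w s).val z| ^ 2 * |(D s).val z|)
          + ((c + 1 + p.wd) * |(w s).val z|
            + 2 / (9 * c) * (|(w s).val z| ^ 2 * |(w s).val z|)) := by
            refine (abs_add_le _ _).trans (add_le_add ?_ ?_)
            · rw [abs_mul, abs_of_pos (div_pos hμ hν)]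
              refine mul_le_mul_of_nonneg_left ((abs_add_le _ _).trans (le_of_eq ?_))
                (div_pos hμ hν).le
              rw [abs_mul, abs_mul, abs_mul, abs_pow, abs_of_pos hk,
                abs_of_pos (by positivity : 0 < 2 / (3 * c))]
            · refine (abs_add_le _ _).trans (le_of_eq ?_)
              rw [abs_mul, abs_mul, abs_mul, abs_pow, abs_of_pos hk,
                abs_of_pos (by positivity : 0 < 2 / (9 * c))]
        _ ≤ p.μ / p.ν * ((c + 1 + p.wd) * (2 * (C * q))
          + 2 / (3 * c) * (2 * C) ^ 2 * (2 * (C * q)))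
          + ((c + 1 + p.wd) * (2 * (C * q)) + 2 / (9 * c) * ((2 * C) ^ 2 * (2 * (C * q)))) := by
            gcongr
        _ = b c * q := by rw [hb]; ring
    have j0 := i2 p.c₀ 0 hc₀ zero_mem_I
    have j1 := i2 p.c₁ 1 hc₁ one_mem_I
    rw [e1, Real.norm_eq_abs, abs_le, hB]
    rw [abs_le] at i1 j0 j1
    constructor
    · linarith only [e2, i1.2, j0.2, j1.2]
    · linarith only [e2, i1.1, j0.1, j1.1]
  have := norm_le_of_ode hμ hν hβ.ode (by positivity) hz hbound ht
  rw [Real.norm_eq_abs, Real.norm_eq_abs, hw0] at this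
  refine this.trans ?_
  have h1 := hlip x y hx hxy hy
  have h2 : |w₀.val y - w₀.val x| + 2 * (B * (y - x)) / p.ν
      ≤ (L₀ + 2 * B / p.ν + 1) * (y - x) := by
    have : 2 * (B * (y - x)) / p.ν = 2 * B / p.ν * (y - x) := by ring
    rw [this]
    linarith
  have := mul_le_mul_of_nonneg_right h2 (Real.exp_pos (-β * t)).le
  linarith

/-- Supplies the hypothesis of `Mesh.abs_err_le` at time zero; the only use of the boundedness of
the second derivative. -/
theorem IsW2Inf.exists_abs_inner_le {u : H1} (hu : IsW2Inf u) : ∃ M, 0 ≤ M ∧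
    ∀ χ : H1, χ.val 0 = 0 → χ.val 1 = 0 → |inner ℝ u.dx χ.dx| ≤ M * ∫ x, |χ.val x| ∂volI := by
  obtain ⟨v, hv, -, -, hb⟩ := hu
  refine ⟨(eLpNormEssSup v.dx volI).toReal, ENNReal.toReal_nonneg, fun χ h0 h1 => ?_⟩
  have h2 := v.inner_dx_fn_add χ
  rw [h0, h1, hv, real_inner_comm (u.dx)] at h2
  have h3 : inner ℝ u.dx χ.dx = -inner ℝ v.dx χ.fn := by linarith
  rw [h3, abs_neg]
  have hfin : eLpNormEssSup v.dx volI ≠ (⊤ : ℝ≥0∞) := by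
    rw [← eLpNorm_exponent_top]; exact hb.eLpNorm_ne_top
  refine abs_inner_le_of_ae_le ?_ χ
  filter_upwards [enorm_ae_le_eLpNormEssSup v.dx volI] with x hx
  have := ENNReal.toReal_mono hfin hx
  simpa using this

/-- The interpolation error of the solution in the maximum norm. -/
theorem Params.exists_abs_err_le {p : Params} (hp : p.Pos) {β : ℝ} (hβ : p.Rate β) {w₀ : H1}
    (hw₀ : IsW2Inf w₀) :
    ∃ C, 0 < C ∧ ∀ (w D : ℝ → H1), p.IsC1Sol ⊤ w D → w 0 = w₀ → ∀ (P : Mesh) (t : ℝ), 0 ≤ t →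
      ∀ x ∈ Icc (0 : ℝ) 1, |(P.err (w t)).val x| ≤ C * (P.h ^ 2 * Real.exp (-β * t)) := by
  have hH2 : IsH2 w₀ := ⟨hw₀.choose, hw₀.choose_spec.1⟩
  obtain ⟨C, hC, hdec⟩ := Params.exists_decay hp hβ ‖w₀‖
  obtain ⟨L, hL, hlip⟩ := Params.exists_lipschitz hp hβ hH2
  obtain ⟨M, hM, hinit⟩ := hw₀.exists_abs_inner_le
  have hp' := hp
  obtain ⟨hμ, hν, hwd, -, -⟩ := hp'
  set A := 2 * C + (1 + p.wd) * L + 2 * C * L with hA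
  have hA0 : 0 ≤ A := by positivity
  refine ⟨M + 2 * A / p.ν + 1, by positivity, fun w D hw hw0 P t ht x hx => ?_⟩
  have hz : ∀ s, HasDerivAt (fun s => (P.err (w s)).val x) ((P.err (D s)).val x) s := fun s =>
    hasDerivAt_val (P.err.hasFDerivAt.comp_hasDerivAt s (hw.hasDerivAt s)) hx
  have hbound : ∀ s, 0 ≤ s → ‖p.μ • (P.err (D s)).val x + p.ν • (P.err (w s)).val x‖
      ≤ P.h ^ 2 * A * Real.exp (-β * s) := by
    intro s hs
    obtain ⟨d1, d2⟩ := hdec ⊤ w D hw (by rw [hw0]) s hs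
    set q := Real.exp (-β * s) with hq
    have hq0 : 0 < q := Real.exp_pos _
    have hq1 : q ≤ 1 := by rw [hq, Real.exp_le_one_iff]; nlinarith [hβ.nonneg]
    have e1 : p.μ • (P.err (D s)).val x + p.ν • (P.err (w s)).val x
        = (P.err (p.μ • D s + p.ν • w s)).val x := by
      rw [map_add, map_smul, map_smul, H1.val_add _ _ hx, H1.val_smul _ _ hx, H1.val_smul _ _ hx,
        smul_eq_mul, smul_eq_mul]
    rw [e1, Real.norm_eq_abs, mul_assoc]
    refine P.abs_err_le (by positivity) (fun χ h0 h1 => ?_) hx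
    rw [hw.inner_dx_eq hs h0 h1, abs_neg]
    refine abs_inner_le_of_ae_le ?_ χ
    -- The force contains `w_x`, and the Lipschitz bound makes it essentially bounded.
    have hdx := ae_abs_dx_le (by positivity) (hlip w D hw hw0 s hs)
    filter_upwards [hdx, (D s).fn_ae_eq_val, mulL_ae (w s) (w s).dx,
      Lp.coeFn_add ((D s).fn + (1 + p.wd) • (w s).dx) (mulL (w s) (w s).dx),
      Lp.coeFn_add (D s).fn ((1 + p.wd) • (w s).dx), Lp.coeFn_smul (1 + p.wd) (w s).dx,
      ae_restrict_mem measurableSet_Ioo] with z g1 g2 g3 g4 g5 g6 hzI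
    have hzI' := Ioo_subset_Icc_self hzI
    rw [Params.force, g4, Pi.add_apply, g5, Pi.add_apply, g6, Pi.smul_apply, g2, g3, smul_eq_mul]
    have a1 : |(D s).val z| ≤ 2 * (C * q) := ((D s).abs_val_le hzI').trans (by linarith)
    have a2 : |(w s).val z| ≤ 2 * C := ((w s).abs_val_le hzI').trans (by nlinarith)
    calc _ ≤ |(D s).val z| + (1 + p.wd) * |(w s).dx z| + |(w s).val z| * |(w s).dx z| := by
          refine (abs_add_le _ _).trans (add_le_add ((abs_add_le _ _).trans
            (add_le_add le_rfl (le_of_eq ?_))) (abs_mul _ _).le)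
          rw [abs_mul, abs_of_pos (by linarith : 0 < 1 + p.wd)]
      _ ≤ 2 * (C * q) + (1 + p.wd) * (L * q) + 2 * C * (L * q) := by gcongr
      _ = A * q := by rw [hA]; ring
  have hi : |(P.err w₀).val x| ≤ P.h ^ 2 * M := P.abs_err_le hM hinit hx
  have := norm_le_of_ode hμ hν hβ.ode (by positivity) hz hbound ht
  rw [Real.norm_eq_abs, Real.norm_eq_abs, hw0] at this
  refine this.trans ?_
  rw [← mul_assoc (M + 2 * A / p.ν + 1)]
  refine mul_le_mul_of_nonneg_right ?_ (Real.exp_pos _).le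
  have : 2 * (P.h ^ 2 * A) / p.ν = 2 * A / p.ν * P.h ^ 2 := by ring
  rw [this]
  linarith [sq_nonneg P.h]

/-! ### The feedback laws -/

theorem abs_cubic_sub_le {k l R a b : ℝ} (hk : 0 ≤ k) (hl : 0 ≤ l) (ha : |a| ≤ R) (hb : |b| ≤ R) :
    |(k * a + l * a ^ 3) - (k * b + l * b ^ 3)| ≤ (k + 3 * l * R ^ 2) * |a - b| := by
  have h1 : (k * a + l * a ^ 3) - (k * b + l * b ^ 3)
      = (k + l * (a ^ 2 + a * b + b ^ 2)) * (a - b) := by ring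
  have hR : 0 ≤ R := (abs_nonneg _).trans ha
  have h2 : |a ^ 2 + a * b + b ^ 2| ≤ 3 * R ^ 2 := by
    rw [abs_le] at ha hb
    rw [abs_le]
    constructor <;> nlinarith
  rw [h1, abs_mul]
  refine mul_le_mul_of_nonneg_right ?_ (abs_nonneg _)
  refine (abs_add_le _ _).trans ?_
  rw [abs_mul, abs_of_nonneg hk, abs_of_nonneg hl]
  nlinarith

end BBMB

end

/-! ### The two error bounds -/

theorem mainTheorem2 (p : BBMB.Params) (hμ : 0 < p.μ) (hν : 0 < p.ν) (hwd : 0 ≤ p.wd)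
    (hc₀ : 0 < p.c₀) (hc₁ : 0 < p.c₁) (lam : ℝ) (hlam : 0 < lam)
    (α : ℝ) (hα : 0 ≤ α) (hα' : α ≤ p.rateMax)
    (w₀ : BBMB.H1) (hw₀ : BBMB.IsH2 w₀) :
    (BBMB.IsW2Inf w₀ →
      ∃ C : ℝ, 0 < C ∧ ∀ w : ℝ → BBMB.H1, p.IsWeakSolution w₀ w →
        ∀ (P : BBMB.Mesh) (w₀h : BBMB.H1), P.IsProjection lam w₀ w₀h →
        ∀ wh : ℝ → BBMB.H1, p.IsSemidiscrete P w₀h wh → ∀ t : ℝ, 0 ≤ t →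
          eLpNorm (w t - wh t).fn ∞ BBMB.volI
            ≤ ENNReal.ofReal (C * (P.h ^ 2 / Real.sqrt p.μ * Real.exp (-α * t)))) ∧
    (∃ C : ℝ, 0 < C ∧ ∀ w : ℝ → BBMB.H1, p.IsWeakSolution w₀ w →
        ∀ (P : BBMB.Mesh) (w₀h : BBMB.H1), P.IsProjection lam w₀ w₀h →
        ∀ wh : ℝ → BBMB.H1, p.IsSemidiscrete P w₀h wh → ∀ t : ℝ, 0 ≤ t →
          |p.K₀ ((w t).val 0) - p.K₀ ((wh t).val 0)|
              ≤ C * (P.h ^ 2 / Real.sqrt p.μ * Real.exp (-α * t)) ∧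
          |p.K₁ ((w t).val 1) - p.K₁ ((wh t).val 1)|
              ≤ C * (P.h ^ 2 / Real.sqrt p.μ * Real.exp (-α * t))) := by
  have hp : p.Pos := ⟨hμ, hν, hwd, hc₀, hc₁⟩
  obtain ⟨β, hαβ, hβ⟩ := BBMB.Params.exists_rate hp hα hα'
  obtain ⟨C, hC, hθ⟩ := BBMB.Params.exists_norm_sub_interp_le hp hα hαβ hβ hlam hw₀
  have hsq : 0 < Real.sqrt p.μ := Real.sqrt_pos.2 hμ
  -- As `μ` is fixed, a factor `√μ` in the constant cancels the denominator.
  have hscale : ∀ (c h E : ℝ), c * Real.sqrt p.μ * (h / Real.sqrt p.μ * E) = c * (h * E) :=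
    fun c h E => by field_simp
  refine ⟨fun hw₀' => ?_, ?_⟩
  · obtain ⟨C', hC', herr⟩ := BBMB.Params.exists_abs_err_le hp hβ hw₀'
    refine ⟨(C' + 2 * C) * Real.sqrt p.μ, by positivity, fun w hw P w₀h hP wh hwh t ht => ?_⟩
    obtain ⟨w', D, hw1, hw2, hw3⟩ := hw.exists_isC1Sol hp isClosed_univ
    obtain ⟨v', e, hv1, hv2, hv3⟩ := hwh.exists_isC1Sol hp P.isClosed_V
    have h1 := (hθ w' D hw1 hw3 P v' e hv1 (by rw [hv3]; exact hP) t ht).2.2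
    have h2 := herr w' D hw1 hw3 P t ht
    rw [hscale, ← hw2 t ht, ← hv2 t ht, eLpNorm_exponent_top]
    refine eLpNormEssSup_le_of_ae_bound ?_
    filter_upwards [(w' t - v' t).fn_ae_eq_val, ae_restrict_mem measurableSet_Ioo] with x hx hxI
    have hxI' := Ioo_subset_Icc_self hxI
    -- The splitting `η - θ`: the first part is bounded pointwise, the second through the embedding
    -- of `H¹` into `C[0,1]`.
    have h3 : w' t - v' t = P.err (w' t) - (v' t - P.interp (w' t)) := by
      rw [BBMB.Mesh.err_apply]; abel
    rw [hx, h3, BBMB.H1.val_sub _ _ hxI', Real.norm_eq_abs]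
    have h4 := (v' t - P.interp (w' t)).abs_val_le hxI'
    have h5 : Real.exp (-β * t) ≤ Real.exp (-α * t) := by
      rw [Real.exp_le_exp]; nlinarith
    have h6 : C' * (P.h ^ 2 * Real.exp (-β * t)) ≤ C' * (P.h ^ 2 * Real.exp (-α * t)) := by
      gcongr
    have h7 := abs_sub ((P.err (w' t)).val x) ((v' t - P.interp (w' t)).val x)
    linarith [h2 x hxI']
  -- A Lipschitz constant of the feedback law on `[-2C, 2C]`, where both states take their values.
  · set B : ℝ → ℝ := fun c => 1 / p.ν * ((c + 1 + p.wd) + 3 * (2 / (9 * c)) * (2 * C) ^ 2)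
    have hB : ∀ c, 0 < c → 0 < B c := fun c hc => by positivity
    have hB₀ := hB _ hc₀
    have hB₁ := hB _ hc₁
    refine ⟨(B p.c₀ + B p.c₁) * (2 * C) * Real.sqrt p.μ, by positivity,
      fun w hw P w₀h hP wh hwh t ht => ?_⟩
    obtain ⟨w', D, hw1, hw2, hw3⟩ := hw.exists_isC1Sol hp isClosed_univ
    obtain ⟨v', e, hv1, hv2, hv3⟩ := hwh.exists_isC1Sol hp P.isClosed_V
    obtain ⟨b1, b2, h1⟩ := hθ w' D hw1 hw3 P v' e hv1 (by rw [hv3]; exact hP) t ht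
    rw [hscale, ← hw2 t ht, ← hv2 t ht]
    -- Where interpolation is exact, `w - w_h = -θ`. No maximum norm of `η` enters, so `H²` data
    -- suffice.
    have key : ∀ c x : ℝ, 0 < c → x ∈ Icc (0 : ℝ) 1 → (P.interp (w' t)).val x = (w' t).val x →
        |1 / p.ν * ((c + 1 + p.wd) * (w' t).val x + 2 / (9 * c) * (w' t).val x ^ 3)
          - 1 / p.ν * ((c + 1 + p.wd) * (v' t).val x + 2 / (9 * c) * (v' t).val x ^ 3)|
        ≤ B c * (2 * C) * (P.h ^ 2 * Real.exp (-α * t)) := by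
      intro c x hc hx hi
      have a1 := (w' t).abs_val_le hx
      have a2 := (v' t).abs_val_le hx
      have a3 := (v' t - P.interp (w' t)).abs_val_le hx
      rw [BBMB.H1.val_sub _ _ hx, hi, abs_sub_comm] at a3
      have a4 := BBMB.abs_cubic_sub_le (k := c + 1 + p.wd) (l := 2 / (9 * c)) (R := 2 * C)
        (by positivity) (by positivity) (a1.trans (by linarith)) (a2.trans (by linarith))
      rw [← mul_sub, abs_mul, abs_of_pos (by positivity : 0 < 1 / p.ν)]
      calc _ ≤ 1 / p.ν * (((c + 1 + p.wd) + 3 * (2 / (9 * c)) * (2 * C) ^ 2)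
            * |(w' t).val x - (v' t).val x|) := mul_le_mul_of_nonneg_left a4 (by positivity)
        _ = B c * |(w' t).val x - (v' t).val x| := by ring
        _ ≤ B c * (2 * (C * (P.h ^ 2 * Real.exp (-α * t)))) :=
            mul_le_mul_of_nonneg_left (a3.trans (by linarith)) (hB c hc).le
        _ = _ := by ring
    have hq : 0 ≤ 2 * C * (P.h ^ 2 * Real.exp (-α * t)) := by positivity
    have q0 := mul_nonneg hB₀.le hq
    have q1 := mul_nonneg hB₁.le hq
    constructor
    · have hi := P.interp_node (w' t) 0
      rw [P.node_zero] at hi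
      have := key p.c₀ 0 hc₀ BBMB.zero_mem_I hi
      rw [BBMB.Params.K₀, BBMB.Params.K₀]
      linarith
    · have hi := P.interp_node (w' t) (Fin.last _)
      rw [P.node_last] at hi
      have := key p.c₁ 1 hc₁ BBMB.one_mem_I hi
      rw [BBMB.Params.K₁, BBMB.Params.K₁, neg_sub_neg, abs_sub_comm]
      linarith
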